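/- Let $F/\mathbb Q_p$ be a finite extension with ring of integers $\mathcal O_F$, uniformizer $\pi$ and residue field $\mathbb F_q$, and assume $q>2$. Let $k/\mathbb F_q$ be a finite extension and $\Gamma=\mathcal O_F^\times$. For $\gamma\in\Gamma$ let $[\gamma](t)$ be the power series by which $\gamma$ acts on the Lubin–Tate group with $[\pi](t)=\Phi(t)=\pi t+t^q$; $\Gamma$ acts $k$-linearly on $k[[t]]$ and $k((t))$ through $\gamma(t)=[\gamma](t)$, and $\varphi$ is the $k$-algebra endomorphism with $\varphi(t)=t^q$. An étale $(\varphi,\Gamma)$-module is a finite dimensional $k((t))$-vector space $\mathbf D$ with commuting semilinear actions of $\varphi$ and $\Gamma$ such that $k((t))\otimes_{\varphi,k((t))}\mathbf D\to\mathbf D$, $a\otimes x\mapsto a\varphi(x)$, is bijective. A surjective $\psi$-operator is an additive map $\psi$ on $k((t))$ which maps $k[[t]]$ onto $k[[t]]$, commutes with $\Gamma$ and satisfies $\psi(\varphi(a)x)=a\psi(x)$. Such operators exist; fix any one of them. On an étale $(\varphi,\Gamma)$-module $\mathbf D$ let $\psi$ be the inverse of $k((t))\otimes_{\varphi}\mathbf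 D\cong\mathbf D$ followed by $a\otimes x\mapsto\psi(a)x$. A lattice in $\mathbf D$ is a finitely generated $k[[t]]$-submodule generating $\mathbf D$ over $k((t))$. Let $\mathbf D^\sharp$ be the unique lattice with $\psi(\mathbf D^\sharp)=\mathbf D^\sharp$ such that every $x\in\mathbf D$ satisfies $\psi^n(x)\in\mathbf D^\sharp$ for some $n$, and let $\mathbf D^\natural$ be the intersection of all $\psi$-stable lattices contained in $\mathbf D^\sharp$. Let $0\le s\le q-2$ and $a\in\mathbb Z$. Let $M$ be the $k$-vector space with basis $e_1,e_2,\tilde e,f_1,f_2$, and let $\Delta$ be the quotient of $k[[t]][\varphi]\otimes_kM$ by the $k[[t]][\varphi]$-submodule generated by $$t^{q-1}\varphi e_1-e_2-t^s\varphi f_2,\quad \varphi e_2-e_1,\quad t^{q-2-s}\varphi f_1-f_2,\quad t^{1+s}\varphi f_2-f_1,\quad te_1-\tilde e,\ t\tilde e,\ te_2,\ tf_1,\ tf_2 .$$ Let $\Delta_1$ be the module presented by the generators $f_1,f_2$ and the relations $t^{q-2-s}\varphi f_1=f_2$, $t^{1+s}\varphi f_2=f_1$, $tf_1=tf_2=0$,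 and let $\Delta_2$ be the module presented by the generators $e_1,e_2,\tilde e$ and the relations $t^{q-1}\varphi e_1=e_2$, $\varphi e_2=e_1$, $te_1=\tilde e$, $t\tilde e=te_2=0$. Then the formulas (in which $\gamma$ on the right stands for its image in $\mathbb F_q^\times$) $$\gamma e_1=\gamma^ae_1,\quad \gamma e_2=\gamma^ae_2,\quad \gamma\tilde e=\gamma^{a+1}\tilde e,\quad \gamma f_1=\gamma^{1+a}f_1,\quad \gamma f_2=\gamma^{a-s}f_2$$ define actions of $\Gamma$ on $\Delta_1,\Delta,\Delta_2$ which make them $k[[t]][\varphi,\Gamma]$-modules, and the obvious maps form an exact sequence $0\to\Delta_1\to\Delta\to\Delta_2\to0$ of such modules. Put $(\cdot)^*=\mathrm{Hom}_k(\cdot,k)$ and $$\mathbf D_1=\Delta_2^*\otimes_{k[[t]]}k((t)),\quad \mathbf D=\Delta^*\otimes_{k[[t]]}k((t)),\quad \mathbf D_2=\Delta_1^*\otimes_{k[[t]]}k((t)).$$ These are étale $(\varphi,\Gamma)$-modules, where $\Gamma$ acts on $\Delta^*$ by $(\gamma\ell)(\delta)=\ell(\gamma^{-1}\delta)$ and $\varphi$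 is such that $\psi$ acts on $\Delta^*$ by $(\psi\ell)(\delta)=\ell(\varphi\delta)$ (likewise for $\Delta_1^*$, $\Delta_2^*$), and one obtains an exact sequence of étale $(\varphi,\Gamma)$-modules $$0\to\mathbf D_1\to\mathbf D\to\mathbf D_2\to0 .$$ Moreover $\dim_{k((t))}\mathbf D_1=\dim_{k((t))}\mathbf D_2=2$, both $\mathbf D_1$ and $\mathbf D_2$ are irreducible, $\mathbf D_1^\sharp=\mathbf D_1^\natural$ and $\mathbf D_2^\sharp=\mathbf D_2^\natural$, but the induced sequence $$0\to\mathbf D_1^\sharp\to\mathbf D^\sharp\to\mathbf D_2^\sharp\to0,$$ which is exact on the left and on the right, is not exact in the middle. -/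

import Mathlib

open PowerSeries
open scoped PowerSeries

namespace PhiGamma
section LubinTate
variable {O : Type*} [CommRing O]

/-- The Lubin–Tate polynomial `Φ(t) = π t + t ^ q`. -/
noncomputable def ltPoly (π : O) (q : ℕ) : PowerSeries O := C π * X + X ^ q

/-- The defect `Φ(f(t)) - f(Φ(t))` of commutation with `Φ`. -/
noncomputable def ltErr (π : O) (q : ℕ) (f : PowerSeries O) : PowerSeries O :=
  (ltPoly π q).subst f - f.subst (ltPoly π q)

theorem X_dvd_ltPoly (π : O) {q : ℕ} (hq : 2 ≤ q) : (X : PowerSeries O) ∣ ltPoly π q :=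
  dvd_add (dvd_mul_left _ _) (dvd_pow_self _ (by omega))

theorem hasSubst_ltPoly (π : O) {q : ℕ} (hq : 2 ≤ q) : HasSubst (ltPoly π q) :=
  HasSubst.of_constantCoeff_zero' (X_dvd_iff.1 (X_dvd_ltPoly π hq))

theorem ltErr_eq (π : O) {q : ℕ} {f : PowerSeries O} (hf : X ∣ f) :
    ltErr π q f = C π * f + f ^ q - f.subst (ltPoly π q) := by
  have h : HasSubst f := HasSubst.of_constantCoeff_zero' (X_dvd_iff.1 hf)
  rw [ltErr, ltPoly, subst_add h, subst_mul h, subst_pow h, subst_X h, subst_C]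
  rfl

theorem X_pow_dvd_subst (π : O) {q : ℕ} (hq : 2 ≤ q) {k : ℕ} {f : PowerSeries O}
    (h : X ^ k ∣ f) : X ^ k ∣ f.subst (ltPoly π q) := by
  obtain ⟨u, rfl⟩ := h
  have hs := hasSubst_ltPoly π hq
  rw [subst_mul hs, subst_pow hs, subst_X hs]
  exact Dvd.dvd.mul_right (pow_dvd_pow_of_dvd (X_dvd_ltPoly π hq) k) _

theorem X_pow_dvd_ltErr_sub (π : O) {q : ℕ} (hq : 2 ≤ q) {k : ℕ} {f g : PowerSeries O}
    (hf : X ∣ f) (hg : X ∣ g) (h : X ^ k ∣ f - g) : X ^ k ∣ ltErr π q f - ltErr π q g := by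
  have hs := hasSubst_ltPoly π hq
  rw [ltErr_eq π hf, ltErr_eq π hg]
  have e : C π * f + f ^ q - f.subst (ltPoly π q) - (C π * g + g ^ q - g.subst (ltPoly π q))
      = C π * (f - g) + (f ^ q - g ^ q) - (f - g).subst (ltPoly π q) := by
    rw [subst_sub hs]; ring
  rw [e]
  exact dvd_sub (dvd_add (h.mul_left _) (h.trans (sub_dvd_pow_sub_pow f g q)))
    (X_pow_dvd_subst π hq h)

theorem coeff_ltErr_add (π : O) {q : ℕ} (hq : 2 ≤ q) {g : PowerSeries O} (hg : X ∣ g)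
    (c : O) (n : ℕ) :
    coeff (n + 2) (ltErr π q (g + C c * X ^ (n + 2))) =
      coeff (n + 2) (ltErr π q g) + c * (π - π ^ (n + 2)) := by
  have hs := hasSubst_ltPoly π hq
  set h := C c * (X : PowerSeries O) ^ (n + 2) with hh
  have hX : X ∣ h := (dvd_pow_self X (by omega)).mul_left _
  rw [ltErr_eq π hg, ltErr_eq π (dvd_add hg hX), subst_add hs]
  have h1 : coeff (n + 2) ((g + h) ^ q) = coeff (n + 2) (g ^ q) := by
    have : X ^ (n + 2 + 1) ∣ (g + h) ^ q - g ^ q := by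
      rw [← Commute.geom_sum₂_mul (Commute.all _ _) q]
      rw [pow_succ', add_sub_cancel_left]
      refine mul_dvd_mul (Finset.dvd_sum fun i hi => ?_) (dvd_mul_left _ _)
      have := Finset.mem_range.1 hi
      rcases Nat.eq_zero_or_pos i with rfl | hi0
      · exact (dvd_pow hg (by omega)).mul_left _
      · exact (dvd_pow (dvd_add hg hX) (by omega)).mul_right _
    have := X_pow_dvd_iff.1 this (n + 2) (by omega)
    rwa [map_sub, sub_eq_zero] at this
  have h2 : coeff (n + 2) (h.subst (ltPoly π q)) = c * π ^ (n + 2) := by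
    have e : ltPoly π q = X * (C π + X ^ (q - 1)) := by
      rw [ltPoly, mul_add, ← pow_succ', show q - 1 + 1 = q by omega, mul_comm (C π)]
    rw [hh, subst_mul hs, subst_pow hs, subst_X hs, subst_C]
    change coeff (n + 2) (C c * ltPoly π q ^ (n + 2)) = _
    rw [coeff_C_mul, e, mul_pow, coeff_X_pow_mul', if_pos le_rfl, Nat.sub_self,
      coeff_zero_eq_constantCoeff]
    simp [show q - 1 ≠ 0 by omega]
  have h3 : coeff (n + 2) h = c := by simp [hh]
  simp only [map_add, map_sub, coeff_C_mul, h1, h2, h3]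
  ring

theorem powerSeries_pow_card {K : Type*} [Field K] [Finite K] (f : PowerSeries K) :
    f ^ Nat.card K = f.subst (X ^ Nat.card K : PowerSeries K) := by
  have := Fintype.ofFinite K
  obtain ⟨p, hc, n, hp, hn⟩ := FiniteField.card' K
  have hp' : Fact p.Prime := ⟨hp⟩
  rw [Nat.card_eq_fintype_card, ← expand_apply (Fintype.card K) Fintype.card_ne_zero]
  have h := MvPowerSeries.map_iterateFrobenius_expand (R := K) (σ := Unit) p hp.ne_zero
    (f := f) (n : ℕ)
  have hid : iterateFrobenius K p (n : ℕ) = RingHom.id K := by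
    ext x
    rw [iterateFrobenius_def, ← hn, FiniteField.pow_card]; rfl
  rw [hid, MvPowerSeries.map_id] at h
  rw [expand]
  simp only [hn]
  exact h.symm

section Exist
variable [IsDomain O] [IsDiscreteValuationRing O] [Finite (IsLocalRing.ResidueField O)]

theorem two_le_card : 2 ≤ Nat.card (IsLocalRing.ResidueField O) := Finite.one_lt_card

theorem dvd_coeff_ltErr {π : O} (hπ : Irreducible π) {f : PowerSeries O} (hf : X ∣ f) (m : ℕ) :
    π ∣ coeff m (ltErr π (Nat.card (IsLocalRing.ResidueField O)) f) := by
  have hs := hasSubst_ltPoly π (two_le_card (O := O))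
  rw [← Ideal.mem_span_singleton, ← Irreducible.maximalIdeal_eq hπ, ← IsLocalRing.residue_eq_zero_iff,
    ← PowerSeries.coeff_map]
  have h0 : IsLocalRing.residue O π = 0 := by
    rw [IsLocalRing.residue_eq_zero_iff, Irreducible.maximalIdeal_eq hπ]
    exact Ideal.mem_span_singleton_self π
  have : PowerSeries.map (IsLocalRing.residue O)
      (ltErr π (Nat.card (IsLocalRing.ResidueField O)) f) = 0 := by
    rw [ltErr_eq π hf, map_sub, map_add, map_mul, map_pow, map_C, h0,
      powerSeries_pow_card, map_zero, zero_mul, zero_add, sub_eq_zero]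
    have e : PowerSeries.map (IsLocalRing.residue O)
        (ltPoly π (Nat.card (IsLocalRing.ResidueField O))) =
        X ^ Nat.card (IsLocalRing.ResidueField O) := by
      simp [ltPoly, h0]
    rw [← e]
    exact (map_subst hs f).symm
  rw [this, map_zero]

/-- One-variable case of the Lubin–Tate lemma. -/
theorem exists_lubinTate {π : O} (hπ : Irreducible π) (a : O) :
    ∃ f : PowerSeries O, constantCoeff f = 0 ∧ coeff 1 f = a ∧
      (ltPoly π (Nat.card (IsLocalRing.ResidueField O))).subst f =
        f.subst (ltPoly π (Nat.card (IsLocalRing.ResidueField O))) := by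
  set q := Nat.card (IsLocalRing.ResidueField O) with hqdef
  have hq : 2 ≤ q := two_le_card
  let P : ℕ → PowerSeries O → Prop := fun n g =>
    X ∣ g ∧ coeff 1 g = a ∧ X ^ (n + 2) ∣ ltErr π q g
  have h0 : P 0 (C a * X) := by
    have hX : (X : PowerSeries O) ∣ C a * X := dvd_mul_left _ _
    have hs := hasSubst_ltPoly π hq
    refine ⟨hX, by simp, ?_⟩
    rw [ltErr_eq π hX, subst_mul hs, subst_X hs, subst_C]
    change X ^ 2 ∣ C π * (C a * X) + (C a * X) ^ q - C a * ltPoly π q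
    have e : C π * (C a * X) + (C a * X) ^ q - C a * ltPoly π q =
      (C a * X) ^ q - C a * X ^ q := by rw [ltPoly]; ring
    rw [e, mul_pow]
    exact dvd_sub ((pow_dvd_pow X hq).mul_left _) ((pow_dvd_pow X hq).mul_left _)
  have hstep : ∀ n g, P n g → ∃ c : O, P (n + 1) (g + C c * X ^ (n + 2)) := by
    rintro n g ⟨hg, h1, h2⟩
    obtain ⟨e, he⟩ := dvd_coeff_ltErr hπ hg (n + 2)
    have hu : IsUnit (1 - π ^ (n + 1)) := by
      refine (IsLocalRing.isUnit_or_isUnit_one_sub_self (π ^ (n + 1))).resolve_left fun h => ?_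
      exact hπ.not_isUnit ((isUnit_pow_iff (Nat.succ_ne_zero n)).1 h)
    obtain ⟨v, hv⟩ := hu.exists_right_inv
    have hX : (X : PowerSeries O) ∣ C (-e * v) * X ^ (n + 2) :=
      (dvd_pow_self X (by omega)).mul_left _
    refine ⟨-e * v, dvd_add hg hX, ?_, ?_⟩
    · rw [map_add, h1, coeff_C_mul, coeff_X_pow, if_neg (by omega), mul_zero, add_zero]
    · rw [X_pow_dvd_iff]
      intro m hm
      rcases Nat.lt_or_ge m (n + 2) with hm' | hm'
      · have := X_pow_dvd_ltErr_sub π hq (k := n + 2) (dvd_add hg hX) hg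
          (by rw [add_sub_cancel_left]; exact dvd_mul_left _ _)
        have h3 := X_pow_dvd_iff.1 this m hm'
        rw [map_sub, X_pow_dvd_iff.1 h2 m hm', sub_zero] at h3
        exact h3
      · obtain rfl : m = n + 2 := by omega
        rw [coeff_ltErr_add π hq hg, ← hqdef.symm, he]
        linear_combination (-π * e) * hv
  choose! c hc using hstep
  let g : ℕ → PowerSeries O := fun n => Nat.rec (C a * X) (fun n g => g + C (c n g) * X ^ (n + 2)) n
  have hg : ∀ n, P n (g n) := fun n => by
    induction n with
    | zero => exact h0
    | succ n ih => exact hc n _ ih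
  have hcoh : ∀ n m, X ^ (n + 2) ∣ g (n + m) - g n := by
    intro n m
    induction m with
    | zero => simp
    | succ m ih =>
      have : g (n + (m + 1)) - g n =
        (g (n + m) - g n) + C (c (n + m) (g (n + m))) * X ^ (n + m + 2) := by
        change g (n + m) + C (c (n + m) (g (n + m))) * X ^ (n + m + 2) - g n = _
        ring
      rw [this]
      exact dvd_add ih ((pow_dvd_pow X (by omega)).mul_left _)
  let f : PowerSeries O := mk fun m => coeff m (g m)
  have hfg : ∀ n, X ^ (n + 1) ∣ f - g n := by
    intro n
    rw [X_pow_dvd_iff]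
    intro m hm
    obtain ⟨j, rfl⟩ : ∃ j, n = m + j := ⟨n - m, by omega⟩
    have := X_pow_dvd_iff.1 (hcoh m j) m (by omega)
    rw [map_sub, sub_eq_zero] at this
    rw [map_sub, sub_eq_zero, coeff_mk, this]
  have hfX : X ∣ f := by
    have := dvd_add (hfg 0) (by simpa using (hg 0).1)
    simpa using this
  refine ⟨f, X_dvd_iff.1 hfX, ?_, ?_⟩
  · rw [coeff_mk]; exact (hg 1).2.1
  · have : ltErr π q f = 0 := by
      ext m
      have h1 := X_pow_dvd_iff.1 (X_pow_dvd_ltErr_sub π hq hfX (hg m).1 (hfg m)) m (by omega)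
      have h2 := X_pow_dvd_iff.1 (hg m).2.2 m (by omega)
      rw [map_sub, h2, sub_zero] at h1
      rw [h1, map_zero]
    exact sub_eq_zero.1 this
end Exist
end LubinTate

/-! ### The coefficient rings and their endomorphisms -/

section Rings

open IsLocalRing

/-- `t ↦ a(t)` on `k[[t]]`, for a series `a` without constant term. -/
noncomputable def substPS {k : Type*} [Field k] (a : k⟦X⟧) (h0 : constantCoeff a = 0) :
    k⟦X⟧ →ₐ[k] k⟦X⟧ :=
  substAlgHom (HasSubst.of_constantCoeff_zero' h0)

/-- `t ↦ a(t)` on `k((t))`, for a nonzero series `a` without constant term: the unique extension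
of `substPS a` to the localization `k((t))` of `k[[t]]` at the powers of `t`. -/
noncomputable def substLS {k : Type*} [Field k] (a : k⟦X⟧) (h0 : constantCoeff a = 0)
    (h : a ≠ 0) : LaurentSeries k →+* LaurentSeries k :=
  IsLocalization.lift (M := Submonoid.powers (X : k⟦X⟧))
    (g := (algebraMap k⟦X⟧ (LaurentSeries k)).comp (substPS a h0 : k⟦X⟧ →+* k⟦X⟧)) <| by
      rintro ⟨_, n, rfl⟩
      have hX : substPS a h0 X = a := by
        rw [substPS, coe_substAlgHom]
        exact subst_X (HasSubst.of_constantCoeff_zero' h0)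
      have ha : algebraMap k⟦X⟧ (LaurentSeries k) a ≠ 0 := by
        rwa [Ne, FaithfulSMul.algebraMap_eq_zero_iff]
      simpa [hX] using (IsUnit.mk0 _ ha).pow n

variable (O : Type*) [CommRing O] [IsDomain O] [IsDiscreteValuationRing O]
  [Finite (ResidueField O)]

/-- The number `q` of elements of the residue field. -/
noncomputable abbrev resCard : ℕ := Nat.card (ResidueField O)

theorem resCard_ne_zero : resCard O ≠ 0 :=
  (lt_of_lt_of_le Nat.zero_lt_two (two_le_card (O := O))).ne'

variable (k : Type*) [Field k]

/-- `φ` on `k[[t]]`: the `k`-algebra endomorphism with `φ(t) = t ^ q`. -/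
noncomputable def phiPS : k⟦X⟧ →ₐ[k] k⟦X⟧ :=
  substPS (X ^ resCard O) (by
    rw [map_pow, constantCoeff_X, zero_pow (resCard_ne_zero O)])

/-- `φ` on `k((t))`, with `φ(t) = t ^ q`. -/
noncomputable def phiLS : LaurentSeries k →+* LaurentSeries k :=
  substLS (X ^ resCard O) (by
    rw [map_pow, constantCoeff_X, zero_pow (resCard_ne_zero O)]) (pow_ne_zero _ X_ne_zero)

variable {O}

/-- The series `[a](t)` over `O` by which `a` acts on the Lubin–Tate formal group attached to
`Φ(t) = π t + t ^ q`, i.e. the unique `f` with `f(t) ≡ a t` modulo `t ^ 2` and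
`Φ(f(t)) = f(Φ(t))`. -/
noncomputable def lubinTate {π : O} (hπ : Irreducible π) (a : O) : O⟦X⟧ :=
  (exists_lubinTate hπ a).choose

/-- Reduction of scalars `O → k`. -/
noncomputable def toCoeff [Algebra (ResidueField O) k] : O →+* k :=
  (algebraMap (ResidueField O) k).comp (residue O)

variable [Algebra (ResidueField O) k]

/-- The scalar in `kˣ` to which `γ ∈ Γ = Oˣ` is mapped. -/
noncomputable def scalar (γ : Oˣ) : kˣ := Units.map (toCoeff (O := O) k : O →* k) γ

/-- The reduction in `k[[t]]` of `[γ](t)`. -/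
noncomputable def gammaSeries {π : O} (hπ : Irreducible π) (γ : Oˣ) : k⟦X⟧ :=
  PowerSeries.map (toCoeff k) (lubinTate hπ (γ : O))

theorem constantCoeff_gammaSeries {π : O} (hπ : Irreducible π) (γ : Oˣ) :
    constantCoeff (gammaSeries k hπ γ) = 0 := by
  rw [← coeff_zero_eq_constantCoeff_apply, gammaSeries, coeff_map, coeff_zero_eq_constantCoeff_apply,
    lubinTate, (exists_lubinTate hπ (γ : O)).choose_spec.1, map_zero]

theorem gammaSeries_ne_zero {π : O} (hπ : Irreducible π) (γ : Oˣ) : gammaSeries k hπ γ ≠ 0 := by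
  intro h
  have h1 : coeff 1 (gammaSeries k hπ γ) = scalar k γ := by
    rw [gammaSeries, coeff_map, lubinTate, (exists_lubinTate hπ (γ : O)).choose_spec.2.1]
    rfl
  rw [h, map_zero] at h1
  exact (scalar k γ).ne_zero h1.symm

/-- `γ` on `k[[t]]`: the `k`-algebra endomorphism with `γ(t) = [γ](t)`. -/
noncomputable def gammaPS {π : O} (hπ : Irreducible π) (γ : Oˣ) : k⟦X⟧ →ₐ[k] k⟦X⟧ :=
  substPS (gammaSeries k hπ γ) (constantCoeff_gammaSeries k hπ γ)

/-- `γ` on `k((t))`, with `γ(t) = [γ](t)`. -/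
noncomputable def gammaLS {π : O} (hπ : Irreducible π) (γ : Oˣ) :
    LaurentSeries k →+* LaurentSeries k :=
  substLS (gammaSeries k hπ γ) (constantCoeff_gammaSeries k hπ γ) (gammaSeries_ne_zero k hπ γ)

/-- A surjective `ψ`-operator, extended from `k[[t]]` to `k((t))`: an additive map with
`ψ(φ(a) x) = a ψ(x)` that commutes with `Γ` and maps `k[[t]]` onto `k[[t]]`. -/
structure PsiOperator {π : O} (hπ : Irreducible π) where
  toHom : LaurentSeries k →+ LaurentSeries k
  map_phi_mul : ∀ a x, toHom (phiLS O k a * x) = a * toHom x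
  map_gamma : ∀ γ x, toHom (gammaLS k hπ γ x) = gammaLS k hπ γ (toHom x)
  image_eq : toHom '' Set.range (algebraMap k⟦X⟧ (LaurentSeries k)) =
    Set.range (algebraMap k⟦X⟧ (LaurentSeries k))

end Rings

/-! ### `(φ,Γ)`-modules -/

section Modules

open TensorProduct

/-- A module over `A[φ,Γ]`, for a ring `A` with an endomorphism `φ` and an action of `Γ`:
an `A`-module with semilinear, commuting actions of `φ` and of the group `Γ`. -/
structure PhiGammaModule {A Γ : Type*} [CommRing A] [Group Γ] (σ : A →+* A) (τ : Γ → A →+* A)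
    (M : Type*) [AddCommGroup M] [Module A M] where
  phi : M →ₛₗ[σ] M
  gamma : ∀ γ, M →ₛₗ[τ γ] M
  gamma_one : ∀ x, gamma 1 x = x
  gamma_mul : ∀ γ γ' x, gamma (γ * γ') x = gamma γ (gamma γ' x)
  gamma_phi : ∀ γ x, gamma γ (phi x) = phi (gamma γ x)

/-- `A` as a right module over itself by means of `σ`. -/
def Twist {A : Type*} [CommRing A] (_σ : A →+* A) : Type _ := A

instance {A : Type*} [CommRing A] (σ : A →+* A) : AddCommGroup (Twist σ) :=
  inferInstanceAs (AddCommGroup A)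

instance {A : Type*} [CommRing A] (σ : A →+* A) : Module A (Twist σ) :=
  Module.compHom A σ

/-- The underlying element of `A`. -/
def Twist.val {A : Type*} [CommRing A] {σ : A →+* A} (a : Twist σ) : A := a

theorem Twist.val_smul {A : Type*} [CommRing A] {σ : A →+* A} (r : A) (a : Twist σ) :
    (r • a).val = σ r * a.val := rfl

theorem Twist.val_add {A : Type*} [CommRing A] {σ : A →+* A} (a b : Twist σ) :
    (a + b).val = a.val + b.val := rfl

section Generic
variable {A Γ : Type*} [CommRing A] [Group Γ] {σ : A →+* A} {τ : Γ → A →+* A}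
  {M : Type*} [AddCommGroup M] [Module A M]

/-- The linearized structure map `A ⊗_{φ,A} M → M`, `a ⊗ x ↦ a φ(x)`. -/
noncomputable def linearization (f : M →ₛₗ[σ] M) : Twist σ ⊗[A] M →+ M :=
  TensorProduct.liftAddHom
    (AddMonoidHom.mk' (fun a : Twist σ => AddMonoidHom.mk' (fun x : M => a.val • f x)
      (fun x y => by rw [map_add, smul_add]))
      (fun a b => by ext x; exact add_smul a.val b.val (f x)))
    (fun r a x => by
      change (r • a).val • f x = a.val • f (r • x)
      rw [Twist.val_smul, map_smulₛₗ, smul_smul, mul_comm])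

/-- Étale `(φ,Γ)`-modules. -/
structure EtalePhiGammaModule (σ : A →+* A) (τ : Γ → A →+* A)
    (M : Type*) [AddCommGroup M] [Module A M] extends PhiGammaModule σ τ M where
  finite : Module.Finite A M
  bijective : Function.Bijective (linearization phi)

/-- An `A`-linear map between modules over `A[φ,Γ]` is a morphism. -/
def PhiGammaModule.IsEquivariant {M' : Type*} [AddCommGroup M'] [Module A M']
    (S : PhiGammaModule σ τ M) (S' : PhiGammaModule σ τ M') (f : M →ₗ[A] M') : Prop :=
  (∀ x, f (S.phi x) = S'.phi (f x)) ∧ ∀ γ x, f (S.gamma γ x) = S'.gamma γ (f x)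

/-- Irreducibility: `M` is nonzero and has no `φ`- and `Γ`-stable submodules except `0` and `M`. -/
def PhiGammaModule.IsIrreducible (S : PhiGammaModule σ τ M) : Prop :=
  Nontrivial M ∧ ∀ W : Submodule A M, (∀ x ∈ W, S.phi x ∈ W) →
    (∀ γ, ∀ x ∈ W, S.gamma γ x ∈ W) → W = ⊥ ∨ W = ⊤

end Generic

end Modules

/-! ### The operator `ψ` and the lattices `D^♯` and `D^♮` -/

section Lattices

open IsLocalRing TensorProduct

variable {O : Type*} [CommRing O] [IsDomain O] [IsDiscreteValuationRing O]
  [Finite (ResidueField O)] {k : Type*} [Field k] [Algebra (ResidueField O) k]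
  {π : O} {hπ : Irreducible π}

/-- `k((t)) ⊗_{φ,k((t))} D → D`, `a ⊗ x ↦ ψ(a) x`. -/
noncomputable def psiContract (ψ : PsiOperator k hπ) (D : Type*) [AddCommGroup D]
    [Module (LaurentSeries k) D] : Twist (phiLS O k) ⊗[LaurentSeries k] D →+ D :=
  TensorProduct.liftAddHom
    (AddMonoidHom.mk' (fun a : Twist (phiLS O k) =>
      AddMonoidHom.mk' (fun x : D => ψ.toHom a.val • x) (fun x y => smul_add _ x y))
      (fun a b => by
        ext x
        change ψ.toHom (a + b).val • x = ψ.toHom a.val • x + ψ.toHom b.val • x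
        rw [Twist.val_add, map_add, add_smul]))
    (fun r a x => by
      change ψ.toHom (r • a).val • x = ψ.toHom a.val • r • x
      rw [Twist.val_smul, ψ.map_phi_mul, smul_smul, mul_comm])

variable {D : Type*} [AddCommGroup D] [Module (LaurentSeries k) D]

/-- The operator `ψ` on an étale `(φ,Γ)`-module: the inverse of the linearized structure map,
followed by `a ⊗ x ↦ ψ(a) x`. -/
noncomputable def psi (ψ : PsiOperator k hπ)
    (S : EtalePhiGammaModule (phiLS O k) (gammaLS k hπ) D) : D →+ D :=
  (psiContract ψ D).comp
    (AddEquiv.ofBijective (linearization S.phi) S.bijective).symm.toAddMonoidHom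

variable [Module k⟦X⟧ D]

/-- Lattices: finitely generated `k[[t]]`-submodules generating `D` over `k((t))`. -/
def IsLattice (E : Submodule k⟦X⟧ D) : Prop :=
  E.FG ∧ Submodule.span (LaurentSeries k) (E : Set D) = ⊤

/-- The characterization of `D^♯`: a lattice `E` with `ψ(E) = E` such that each `x ∈ D` satisfies
`ψ ^ n (x) ∈ E` for some `n`. -/
def IsSharp (ψ : PsiOperator k hπ) (S : EtalePhiGammaModule (phiLS O k) (gammaLS k hπ) D)
    (E : Submodule k⟦X⟧ D) : Prop :=
  IsLattice E ∧ psi ψ S '' (E : Set D) = E ∧ ∀ x, ∃ n : ℕ, (psi ψ S)^[n] x ∈ E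

/-- The lattice `D^♯`, the unique one satisfying `IsSharp`. -/
noncomputable def sharp (ψ : PsiOperator k hπ)
    (S : EtalePhiGammaModule (phiLS O k) (gammaLS k hπ) D) : Submodule k⟦X⟧ D :=
  Classical.epsilon (IsSharp ψ S)

/-- The lattice `D^♮`: the intersection of all `ψ`-stable lattices contained in `D^♯`. -/
noncomputable def natural (ψ : PsiOperator k hπ)
    (S : EtalePhiGammaModule (phiLS O k) (gammaLS k hπ) D) : Submodule k⟦X⟧ D :=
  sInf {E | IsLattice E ∧ E ≤ sharp ψ S ∧ ∀ x ∈ E, psi ψ S x ∈ E}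

end Lattices

/-! ### From `k[[t]][φ,Γ]`-modules to étale `(φ,Γ)`-modules -/

section Duals

open IsLocalRing TensorProduct

variable (k : Type*) [Field k]

/-- `Δ^* = Hom_k(Δ, k)`. -/
def DualMod (Δ : Type*) [AddCommGroup Δ] [Module k Δ] : Type _ := Δ →ₗ[k] k

variable {k} {Δ : Type*} [AddCommGroup Δ] [Module k Δ] [Module k⟦X⟧ Δ] [IsScalarTower k k⟦X⟧ Δ]
  {Δ' : Type*} [AddCommGroup Δ'] [Module k Δ'] [Module k⟦X⟧ Δ'] [IsScalarTower k k⟦X⟧ Δ']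

/-- The underlying linear form. -/
def DualMod.toLin (l : DualMod k Δ) : Δ →ₗ[k] k := l

instance : AddCommGroup (DualMod k Δ) := inferInstanceAs (AddCommGroup (Δ →ₗ[k] k))

/-- The transpose `ℓ ↦ ℓ ∘ h` of a map `h : Δ → Δ'` which is semilinear with respect to an
endomorphism of the `k`-algebra `k[[t]]`, and hence `k`-linear. -/
noncomputable def transpose {σ : k⟦X⟧ →ₐ[k] k⟦X⟧} (h : Δ →ₛₗ[(σ : k⟦X⟧ →+* k⟦X⟧)] Δ')
    (l : DualMod k Δ') : DualMod k Δ :=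
  l.toLin.comp
    { toFun := h
      map_add' := map_add h
      map_smul' := fun c x => by
        rw [← algebraMap_smul k⟦X⟧ c x, map_smulₛₗ, RingHom.coe_coe, AlgHom.commutes,
          algebraMap_smul, RingHom.id_apply] }

/-- `k[[t]]` acts on `Δ^*` by `(a ℓ)(δ) = ℓ(a δ)`. -/
noncomputable instance : Module k⟦X⟧ (DualMod k Δ) where
  smul a l := l.toLin.comp
    ({ toFun := fun x => a • x
       map_add' := smul_add a
       map_smul' := fun c x => smul_comm a c x } : Δ →ₗ[k] Δ)
  one_smul l := LinearMap.ext fun x => congrArg l.toLin (one_smul k⟦X⟧ x)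
  mul_smul a b l := LinearMap.ext fun x => congrArg l.toLin
    (show (a * b) • x = b • a • x by rw [smul_smul, mul_comm])
  smul_zero _ := rfl
  smul_add _ _ _ := rfl
  add_smul a b l := LinearMap.ext fun x =>
    (congrArg l.toLin (add_smul a b x)).trans (map_add l.toLin _ _)
  zero_smul l := LinearMap.ext fun x =>
    (congrArg l.toLin (zero_smul k⟦X⟧ x)).trans (map_zero l.toLin)

variable (k) in
/-- `Δ^* ⊗_{k[[t]]} k((t))`. -/
abbrev LocDual (Δ : Type*) [AddCommGroup Δ] [Module k Δ] [Module k⟦X⟧ Δ]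
    [IsScalarTower k k⟦X⟧ Δ] : Type _ :=
  LaurentSeries k ⊗[k⟦X⟧] DualMod k Δ

/-- The transpose of a `k[[t]]`-linear map. -/
noncomputable def dualMap (f : Δ →ₗ[k⟦X⟧] Δ') : DualMod k Δ' →ₗ[k⟦X⟧] DualMod k Δ where
  toFun l := l.toLin.comp (f.restrictScalars k)
  map_add' _ _ := rfl
  map_smul' a l := LinearMap.ext fun x =>
    congrArg l.toLin (map_smul f a x).symm

/-- The `k((t))`-linear map `Δ'^* ⊗ k((t)) → Δ^* ⊗ k((t))` induced by `f : Δ → Δ'`. -/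
noncomputable def locDualMap (f : Δ →ₗ[k⟦X⟧] Δ') :
    LocDual k Δ' →ₗ[LaurentSeries k] LocDual k Δ :=
  (dualMap f).baseChange (LaurentSeries k)

variable {O : Type*} [CommRing O] [IsDomain O] [IsDiscreteValuationRing O]
  [Finite (ResidueField O)] [Algebra (ResidueField O) k] {π : O} {hπ : Irreducible π}

variable (k hπ Δ) in
/-- Modules over `k[[t]][φ,Γ]`. -/
abbrev TorsionPhiGamma : Type _ :=
  PhiGammaModule (Γ := Oˣ) (phiPS O k : k⟦X⟧ →+* k⟦X⟧)
    (fun γ => (gammaPS k hπ γ : k⟦X⟧ →+* k⟦X⟧)) Δ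

/-- `S` is the étale `(φ,Γ)`-module structure on `D = Δ^* ⊗ k((t))` attached to `Δ`: the group `Γ`
acts on (the image in `D` of) `Δ^*` by `(γ ℓ)(δ) = ℓ(γ⁻¹ δ)`, and `ψ` acts on it by
`(ψ ℓ)(δ) = ℓ(φ(δ))`. The second condition determines `φ` on `D`. -/
def IsAttached (ψ : PsiOperator k hπ) (T : TorsionPhiGamma k Δ hπ)
    (S : EtalePhiGammaModule (phiLS O k) (gammaLS k hπ) (LocDual k Δ)) : Prop :=
  (∀ (γ : Oˣ) (l : DualMod k Δ), S.gamma γ (1 ⊗ₜ l) = 1 ⊗ₜ transpose (T.gamma γ⁻¹) l) ∧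
    ∀ l : DualMod k Δ, psi ψ S (1 ⊗ₜ l) = 1 ⊗ₜ transpose T.phi l

end Duals

/-! ### Modules given by generators and relations -/

section Presentations

open IsLocalRing

/-- `k[[t]][φ] ⊗_k M` for the `k`-vector space `M` with basis indexed by the finite set `ι`: the
function `x` stands for the sum of the `x i n • φ ^ n ⊗ e_i`. -/
abbrev FreeMod (k : Type*) [Field k] (ι : Type*) : Type _ := ι → ℕ →₀ k⟦X⟧

variable (O : Type*) [CommRing O] [IsDomain O] [IsDiscreteValuationRing O]
  [Finite (ResidueField O)] {k : Type*} [Field k] {ι : Type*}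

/-- The basis element `1 ⊗ e_i`. -/
noncomputable def gen [DecidableEq ι] (i : ι) : FreeMod k ι := Pi.single i (Finsupp.single 0 1)

/-- Multiplication by `φ`: `f φ ^ n ⊗ e_i ↦ f(t ^ q) φ ^ (n + 1) ⊗ e_i`. -/
noncomputable def phiFree : FreeMod k ι →ₛₗ[(phiPS O k : k⟦X⟧ →+* k⟦X⟧)] FreeMod k ι where
  toFun x i := ((x i).mapRange (phiPS O k) (map_zero _)).mapDomain Nat.succ
  map_add' x y := by
    funext i
    rw [Pi.add_apply, Finsupp.mapRange_add (map_add _), Finsupp.mapDomain_add, Pi.add_apply]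
  map_smul' c x := by
    funext i
    rw [Pi.smul_apply, Pi.smul_apply, ← Finsupp.mapDomain_smul]
    congr 1
    ext1 n
    simp

variable {O} in
/-- The action of `Γ` when `γ e_i = γ ^ (w i) e_i`:
`f φ ^ n ⊗ e_i ↦ γ(f) φ ^ n ⊗ γ ^ (w i) e_i`. -/
noncomputable def gammaFree [Algebra (ResidueField O) k] {π : O} (hπ : Irreducible π)
    (w : ι → ℤ) (γ : Oˣ) : FreeMod k ι →ₛₗ[(gammaPS k hπ γ : k⟦X⟧ →+* k⟦X⟧)] FreeMod k ι where
  toFun x i := ((scalar k γ ^ w i : kˣ) : k) • (x i).mapRange (gammaPS k hπ γ) (map_zero _)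
  map_add' x y := by
    funext i
    rw [Pi.add_apply, Finsupp.mapRange_add (map_add _), smul_add, Pi.add_apply]
  map_smul' c x := by
    funext i
    ext1 n
    simp

/-- The `k[[t]][φ]`-submodule generated by `R`. -/
noncomputable def nabla (R : Set (FreeMod k ι)) : Submodule k⟦X⟧ (FreeMod k ι) :=
  Submodule.span k⟦X⟧ {y | ∃ n : ℕ, ∃ r ∈ R, y = (phiFree O)^[n] r}

/-- The quotient of `k[[t]][φ] ⊗_k M` by the `k[[t]][φ]`-submodule generated by `R`. -/
abbrev Presented (R : Set (FreeMod k ι)) : Type _ := FreeMod k ι ⧸ nabla O R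

variable {O}

theorem nabla_le_comap {κ : Type*} {R : Set (FreeMod k ι)} {R' : Set (FreeMod k κ)}
    (h : FreeMod k ι →ₗ[k⟦X⟧] FreeMod k κ) (hφ : ∀ x, h (phiFree O x) = phiFree O (h x))
    (hR : ∀ r ∈ R, h r = 0 ∨ h r ∈ R') : nabla O R ≤ (nabla O R').comap h := by
  refine Submodule.span_le.2 ?_
  rintro _ ⟨n, r, hr, rfl⟩
  have e : h ((phiFree O)^[n] r) = (phiFree O)^[n] (h r) := by
    induction n with
    | zero => rfl
    | succ n ih => rw [Function.iterate_succ_apply', hφ, ih, Function.iterate_succ_apply']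
  change h ((phiFree O)^[n] r) ∈ nabla O R'
  rw [e]
  rcases hR r hr with h0 | h1
  · rw [h0, iterate_map_zero]
    exact zero_mem _
  · exact Submodule.subset_span ⟨n, _, h1, rfl⟩

/-- The actions of `φ` and `Γ` on `k[[t]][φ] ⊗_k M` induce the actions `T` on the quotient. -/
def IsInduced [Algebra (ResidueField O) k] {π : O} {hπ : Irreducible π} (w : ι → ℤ)
    (R : Set (FreeMod k ι)) (T : TorsionPhiGamma k (Presented O R) hπ) : Prop :=
  (∀ x, T.phi ((nabla O R).mkQ x) = (nabla O R).mkQ (phiFree O x)) ∧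
    ∀ γ x, T.gamma γ ((nabla O R).mkQ x) = (nabla O R).mkQ (gammaFree hπ w γ x)

end Presentations

/-! ### The extension

The basis vectors `e_1, e_2, ẽ` of `M` are indexed by `Fin 3` in this order, and `f_1, f_2` are
indexed by `Fin 2`. -/

section Extension

open IsLocalRing

variable (O : Type*) [CommRing O] [IsDomain O] [IsDiscreteValuationRing O]
  [Finite (ResidueField O)] (k : Type*) [Field k]

/-- The relations between `f_1, f_2`. -/
noncomputable def relSub (s : ℕ) : Set (FreeMod k (Fin 2)) :=
  let f₁ : FreeMod k (Fin 2) := gen 0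
  let f₂ : FreeMod k (Fin 2) := gen 1
  { (X : k⟦X⟧) ^ (resCard O - 2 - s) • phiFree O f₁ - f₂,
    (X : k⟦X⟧) ^ (1 + s) • phiFree O f₂ - f₁,
    (X : k⟦X⟧) • f₁, (X : k⟦X⟧) • f₂ }

/-- The relations between the images of `e_1, e_2, ẽ` in the quotient. -/
noncomputable def relQuot : Set (FreeMod k (Fin 3)) :=
  let e₁ : FreeMod k (Fin 3) := gen 0
  let e₂ : FreeMod k (Fin 3) := gen 1
  let e' : FreeMod k (Fin 3) := gen 2
  { (X : k⟦X⟧) ^ (resCard O - 1) • phiFree O e₁ - e₂,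
    phiFree O e₂ - e₁,
    (X : k⟦X⟧) • e₁ - e', (X : k⟦X⟧) • e', (X : k⟦X⟧) • e₂ }

/-- The relations between `e_1, e_2, ẽ, f_1, f_2`. -/
noncomputable def rel (s : ℕ) : Set (FreeMod k (Fin 3 ⊕ Fin 2)) :=
  let e₁ : FreeMod k (Fin 3 ⊕ Fin 2) := gen (Sum.inl 0)
  let e₂ : FreeMod k (Fin 3 ⊕ Fin 2) := gen (Sum.inl 1)
  let e' : FreeMod k (Fin 3 ⊕ Fin 2) := gen (Sum.inl 2)
  let f₁ : FreeMod k (Fin 3 ⊕ Fin 2) := gen (Sum.inr 0)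
  let f₂ : FreeMod k (Fin 3 ⊕ Fin 2) := gen (Sum.inr 1)
  { (X : k⟦X⟧) ^ (resCard O - 1) • phiFree O e₁ - e₂ - (X : k⟦X⟧) ^ s • phiFree O f₂,
    phiFree O e₂ - e₁,
    (X : k⟦X⟧) ^ (resCard O - 2 - s) • phiFree O f₁ - f₂,
    (X : k⟦X⟧) ^ (1 + s) • phiFree O f₂ - f₁,
    (X : k⟦X⟧) • e₁ - e', (X : k⟦X⟧) • e', (X : k⟦X⟧) • e₂,
    (X : k⟦X⟧) • f₁, (X : k⟦X⟧) • f₂ }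

/-- `Δ₁`, the part generated by `f_1, f_2`. -/
abbrev DeltaSub (s : ℕ) : Type _ := Presented O (relSub O k s)

/-- `Δ₂`, the quotient generated by the images of `e_1, e_2, ẽ`. -/
abbrev DeltaQuot : Type _ := Presented O (relQuot O k)

/-- `Δ`. -/
abbrev Delta (s : ℕ) : Type _ := Presented O (rel O k s)

/-- The exponents with which `Γ` acts on `f_1, f_2`. -/
def weightSub (s : ℕ) (a : ℤ) : Fin 2 → ℤ := ![1 + a, a - s]

/-- The exponents with which `Γ` acts on `e_1, e_2, ẽ`. -/
def weightQuot (a : ℤ) : Fin 3 → ℤ := ![a, a, a + 1]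

/-- The exponents with which `Γ` acts on `e_1, e_2, ẽ, f_1, f_2`. -/
def weight (s : ℕ) (a : ℤ) : Fin 3 ⊕ Fin 2 → ℤ := Sum.elim (weightQuot a) (weightSub s a)

/-- The inclusion of the span of `f_1, f_2`, extended to `k[[t]][φ] ⊗_k M`. -/
noncomputable def inclFree : FreeMod k (Fin 2) →ₗ[k⟦X⟧] FreeMod k (Fin 3 ⊕ Fin 2) where
  toFun x := Sum.elim 0 x
  map_add' x y := by
    funext i; rcases i with i | i <;> simp
  map_smul' c x := by
    funext i; rcases i with i | i <;> simp

/-- The projection along the span of `f_1, f_2`, extended to `k[[t]][φ] ⊗_k M`. -/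
noncomputable def projFree : FreeMod k (Fin 3 ⊕ Fin 2) →ₗ[k⟦X⟧] FreeMod k (Fin 3) where
  toFun x i := x (Sum.inl i)
  map_add' _ _ := rfl
  map_smul' _ _ := rfl

theorem inclFree_gen (i : Fin 2) : inclFree k (gen i) = gen (Sum.inr i) := by
  funext j
  rcases j with j | j
  · simp [inclFree, gen]
  · by_cases h : j = i
    · subst h; simp [inclFree, gen]
    · simp [inclFree, gen, h]

theorem inclFree_phi (x : FreeMod k (Fin 2)) :
    inclFree k (phiFree O x) = phiFree O (inclFree k x) := by
  funext j
  rcases j with j | j <;> simp [inclFree, phiFree]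

theorem projFree_gen_inl (i : Fin 3) : projFree k (gen (Sum.inl i)) = gen i := by
  funext j
  by_cases h : j = i
  · subst h; simp [projFree, gen]
  · simp [projFree, gen, h]

theorem projFree_gen_inr (i : Fin 2) : projFree k (gen (Sum.inr i)) = 0 := by
  funext j
  simp [projFree, gen]

theorem projFree_phi (x : FreeMod k (Fin 3 ⊕ Fin 2)) :
    projFree k (phiFree O x) = phiFree O (projFree k x) := rfl

/-- The map `Δ₁ → Δ` with `f_i ↦ f_i`. -/
noncomputable def incl (s : ℕ) : DeltaSub O k s →ₗ[k⟦X⟧] Delta O k s :=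
  Submodule.mapQ _ _ (inclFree k) <| nabla_le_comap _ (inclFree_phi O k) <| by
    intro r hr
    right
    simp only [relSub, Set.mem_insert_iff, Set.mem_singleton_iff] at hr
    rcases hr with rfl | rfl | rfl | rfl <;>
      simp [rel, inclFree_phi, inclFree_gen]

/-- The map `Δ → Δ₂` with `e_i ↦ e_i`, `ẽ ↦ ẽ` and `f_i ↦ 0`. -/
noncomputable def proj (s : ℕ) : Delta O k s →ₗ[k⟦X⟧] DeltaQuot O k :=
  Submodule.mapQ _ _ (projFree k) <| nabla_le_comap _ (projFree_phi O k) <| by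
    intro r hr
    simp only [rel, Set.mem_insert_iff, Set.mem_singleton_iff] at hr
    rcases hr with rfl | rfl | rfl | rfl | rfl | rfl | rfl | rfl | rfl <;>
      simp [relQuot, projFree_phi, projFree_gen_inl, projFree_gen_inr]

end Extension

end PhiGamma

open PhiGamma
open scoped ValuativeRel

/-! The three torsion modules become explicit as quotients of spaces of Laurent series. Iterating
the relations t^(w_i) φ(g_σ(i)) = g_i between generators identifies Δ₁ with k((t))² modulo (t
k[[t]])² and Δ₂ with k((t))² modulo t²k[[t]] ⊕ t k[[t]]. Here φ acts by u ↦ (t^(-w_i) φ(u_σ(i)))_i,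
σ is the transposition, and w = (1+s, q-2-s), respectively w = (0, q-1). Δ is k((t))⁴ modulo the sum
of the two lattices, and φ gets one off-diagonal entry t^(-q) from e_1 to f_1 (`nabla_relSub`,
`nabla_relQuot`, `nabla_rel`, `exists_uniformization`).

Taking the constant term of Σ g_i u_i identifies the dual of k((t))^ι modulo ⊕ t^(m_i) k[[t]] with ⊕
t^(1-m_i) k[[t]], and the transpose of φ with an operator built from κ = `kap`, Σ a_n t^n ↦ Σ a_(qn)
t^n. Every ψ-operator has the form x ↦ κ(cx) with c ≠ 0. So the φ on D that yields the prescribed ψ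
is found by inverting a matrix (`exists_isAttached`). A ψ-operator exists because a suitable
multiple of the Cartier operator commutes with Γ (`nonempty_psiOperator`).

In both rank two cases w_0 + w_1 = q-1. This makes k[[t]]² the lattice D_i^♯ and forces every
ψ-stable lattice to contain it, whence D_i^♯ = D_i^♮ (`isSharp_coordLattice`,
`coordLattice_le_of_stable`). A φ-stable line would make w_1 - w_0 divisible by q+1. For D₁ this is
impossible. For D₂ it leaves only w_0 = w_1, and then Γ acts on the two coordinates through
different characters (`isIrreducible_quot`, `isIrreducible_sub`).

Exactness fails because of ẽ. In Δ₂ one has φ(ẽ) = t^q φ(e_1) = t e_2 = 0, so φ is not injective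
there and D₁^♯ = k[[t]]² is strictly smaller than Δ₂^* = t^(-1)k[[t]] ⊕ k[[t]]. In Δ the same
computation gives φ(ẽ) = t^(s+1) φ(f_2) = f_1 ≠ 0. There φ is injective (`mem_of_matExt_mem`), so ψ
maps Δ^* onto itself and D^♯ = Δ^* (`isSharp_dualLattice_ext`). Hence Δ₂^* lies in the kernel of D^♯
→ D₂^♯ without being contained in D₁^♯. -/

namespace PhiGamma

/-! ### Laurent series and their order of vanishing. -/

section Laurent
variable {k : Type*} [Field k]

/-- The monomial `t ^ n` in `k((t))`. -/
noncomputable abbrev tpow (k : Type*) [Field k] (n : ℤ) : LaurentSeries k := HahnSeries.single n 1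

theorem tpow_add (m n : ℤ) : tpow k (m + n) = tpow k m * tpow k n := by
  simp [tpow, HahnSeries.single_mul_single]

theorem tpow_zero : tpow k 0 = 1 := rfl

theorem tpow_ne_zero (n : ℤ) : tpow k n ≠ 0 := by simp [tpow]

theorem tpow_mul_neg (n : ℤ) : tpow k n * tpow k (-n) = 1 := by
  rw [← tpow_add, add_neg_cancel, tpow_zero]

theorem tpow_neg_mul (n : ℤ) : tpow k (-n) * tpow k n = 1 := by
  rw [← tpow_add, neg_add_cancel, tpow_zero]

theorem algebraMap_X_pow (n : ℕ) :
    algebraMap k⟦X⟧ (LaurentSeries k) (X ^ n) = tpow k n := by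
  simp [tpow, HahnSeries.single_pow]

theorem coeff_tpow_mul (m n : ℤ) (x : LaurentSeries k) :
    (tpow k m * x).coeff n = x.coeff (n - m) := by
  rw [HahnSeries.coeff_single_mul, one_mul]

/-- All coefficients of exponent less than `d` vanish. -/
def VanishBelow (d : ℤ) (x : LaurentSeries k) : Prop := ∀ n < d, x.coeff n = 0

theorem VanishBelow.mono {d d' : ℤ} {x : LaurentSeries k} (h : VanishBelow d x) (hd : d' ≤ d) :
    VanishBelow d' x := fun n hn => h n (hn.trans_le hd)

theorem VanishBelow.add {d : ℤ} {x y : LaurentSeries k} (hx : VanishBelow d x)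
    (hy : VanishBelow d y) : VanishBelow d (x + y) := fun n hn => by
  rw [HahnSeries.coeff_add, hx n hn, hy n hn, add_zero]

theorem VanishBelow.mul {d d' : ℤ} {x y : LaurentSeries k} (hx : VanishBelow d x)
    (hy : VanishBelow d' y) : VanishBelow (d + d') (x * y) := fun n hn => by
  rw [HahnSeries.coeff_mul]
  refine Finset.sum_eq_zero fun ij hij => ?_
  have h := (Finset.mem_antidiagonal.1 hij).2.2
  rcases lt_or_ge ij.1 d with h1 | h1
  · rw [hx _ h1, zero_mul]
  · rw [hy _ (by omega), mul_zero]

theorem vanishBelow_zero (d : ℤ) : VanishBelow d (0 : LaurentSeries k) := fun _ _ => rfl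

theorem vanishBelow_tpow (d : ℤ) : VanishBelow d (tpow k d) := fun _ hn =>
  HahnSeries.coeff_single_of_ne hn.ne

theorem vanishBelow_algebraMap (f : k⟦X⟧) : VanishBelow 0 (algebraMap k⟦X⟧ (LaurentSeries k) f) :=
  fun n hn => by
    change ((f : k⟦X⟧) : LaurentSeries k).coeff n = 0
    rw [PowerSeries.coeff_coe, if_pos hn]

theorem coeff_algebraMap (f : k⟦X⟧) (n : ℕ) :
    (algebraMap k⟦X⟧ (LaurentSeries k) f).coeff n = PowerSeries.coeff n f :=
  LaurentSeries.coeff_coe_powerSeries f n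

theorem vanishBelow_tpow_mul {d : ℤ} (m : ℤ) {x : LaurentSeries k} :
    VanishBelow d (tpow k m * x) ↔ VanishBelow (d - m) x := by
  constructor
  · intro h n hn
    have := h (n + m) (by omega)
    rwa [coeff_tpow_mul, add_sub_cancel_right] at this
  · intro h n hn
    rw [coeff_tpow_mul]
    exact h _ (by omega)

theorem vanishBelow_zero_iff {x : LaurentSeries k} :
    VanishBelow 0 x ↔ ∃ f : k⟦X⟧, algebraMap k⟦X⟧ (LaurentSeries k) f = x := by
  constructor
  · intro h
    refine ⟨PowerSeries.mk fun n => x.coeff n, ?_⟩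
    ext n
    rcases lt_or_ge n 0 with hn | hn
    · rw [h n hn, vanishBelow_algebraMap _ n hn]
    · lift n to ℕ using hn
      rw [coeff_algebraMap, coeff_mk]
  · rintro ⟨f, rfl⟩
    exact vanishBelow_algebraMap f

theorem vanishBelow_iff {d : ℤ} {x : LaurentSeries k} :
    VanishBelow d x ↔ ∃ f : k⟦X⟧, x = tpow k d * algebraMap k⟦X⟧ (LaurentSeries k) f := by
  have e : x = tpow k d * (tpow k (-d) * x) := by rw [← mul_assoc, tpow_mul_neg, one_mul]
  constructor
  · intro h
    rw [e, vanishBelow_tpow_mul, sub_self, vanishBelow_zero_iff] at h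
    obtain ⟨f, hf⟩ := h
    exact ⟨f, by rw [hf]; exact e⟩
  · rintro ⟨f, rfl⟩
    rw [vanishBelow_tpow_mul, sub_self]
    exact vanishBelow_algebraMap f

theorem exists_vanishBelow (x : LaurentSeries k) : ∃ N : ℕ, VanishBelow (-N) x := by
  refine ⟨x.order.natAbs, fun n hn => HahnSeries.coeff_eq_zero_of_lt_order (by omega)⟩

theorem order_eq_of_vanishBelow {d : ℤ} {x : LaurentSeries k} (h : VanishBelow d x)
    (hd : x.coeff d ≠ 0) : x.order = d :=
  le_antisymm (HahnSeries.order_le_of_coeff_ne_zero hd)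
    (le_of_not_gt fun h' => by
      have hx : x ≠ 0 := fun h0 => hd (by rw [h0]; rfl)
      exact HahnSeries.coeff_order_eq_zero.not.2 hx (h _ h'))

theorem order_tpow (n : ℤ) : (tpow k n).order = n := HahnSeries.order_single one_ne_zero

end Laurent

/-! ### The endomorphism φ of k((t)) and its left inverse κ. -/

section Kappa
open IsLocalRing
variable (O : Type*) [CommRing O] [IsDomain O] [IsDiscreteValuationRing O]
  [Finite (ResidueField O)] {k : Type*} [Field k]

theorem resCard_pos : (0 : ℤ) < resCard O := by
  exact_mod_cast Nat.pos_of_ne_zero (resCard_ne_zero O)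

theorem two_le_resCard : (2 : ℤ) ≤ resCard O := by exact_mod_cast two_le_card (O := O)

theorem phiPS_apply (f : k⟦X⟧) : phiPS O k f = expand (resCard O) (resCard_ne_zero O) f := by
  rw [phiPS, substPS, coe_substAlgHom, expand_apply]

theorem phiPS_apply_subst (f : k⟦X⟧) : phiPS O k f = f.subst (X ^ resCard O : k⟦X⟧) := by
  rw [phiPS_apply, expand_apply]

theorem substLS_algebraMap (a : k⟦X⟧) (h0 : constantCoeff a = 0) (h : a ≠ 0) (f : k⟦X⟧) :
    substLS a h0 h (algebraMap k⟦X⟧ (LaurentSeries k) f) =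
      algebraMap k⟦X⟧ (LaurentSeries k) (substPS a h0 f) := by
  rw [substLS, IsLocalization.lift_eq]
  rfl

theorem phiLS_algebraMap (f : k⟦X⟧) :
    phiLS O k (algebraMap k⟦X⟧ (LaurentSeries k) f) =
      algebraMap k⟦X⟧ (LaurentSeries k) (phiPS O k f) := substLS_algebraMap _ _ _ _

theorem phiLS_eq : phiLS O k = HahnSeries.embDomainRingHom (R := k)
    (AddMonoidHom.mulLeft (resCard O : ℤ))
    (mul_right_injective₀ (resCard_pos O).ne')
    (fun _ _ => mul_le_mul_iff_right₀ (resCard_pos O)) := by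
  refine IsLocalization.ringHom_ext (Submonoid.powers (X : k⟦X⟧)) ?_
  ext f n
  rw [RingHom.comp_apply, phiLS_algebraMap, phiPS_apply, RingHom.comp_apply]
  by_cases h : (resCard O : ℤ) ∣ n
  · obtain ⟨m, rfl⟩ := h
    refine Eq.trans ?_ (HahnSeries.embDomain_mk_coeff (f := AddMonoidHom.mulLeft (resCard O : ℤ))
      (mul_right_injective₀ (resCard_pos O).ne')
      (fun _ _ => mul_le_mul_iff_right₀ (resCard_pos O))).symm
    rcases lt_or_ge m 0 with hm | hm
    · rw [vanishBelow_algebraMap _ m hm, vanishBelow_algebraMap]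
      exact mul_neg_of_pos_of_neg (resCard_pos O) hm
    · lift m to ℕ using hm
      rw [coeff_algebraMap, ← Nat.cast_mul, coeff_algebraMap, coeff_expand_mul]
  · have e : (algebraMap k⟦X⟧ (LaurentSeries k)
        (expand (resCard O) (resCard_ne_zero O) f)).coeff n = 0 := by
      rcases lt_or_ge n 0 with hm | hm
      · rw [vanishBelow_algebraMap _ n hm]
      · lift n to ℕ using hm
        rw [coeff_algebraMap, coeff_expand_of_not_dvd]
        exact fun h' => h (by exact_mod_cast h')
    rw [e]
    symm
    refine HahnSeries.embDomain_of_notMem_range ?_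
    rintro ⟨m, rfl⟩
    exact h (dvd_mul_right _ _)

theorem coeff_phiLS_mul (x : LaurentSeries k) (n : ℤ) :
    (phiLS O k x).coeff (resCard O * n) = x.coeff n := by
  rw [phiLS_eq]
  exact HahnSeries.embDomain_mk_coeff _ _

theorem coeff_phiLS_of_not_dvd (x : LaurentSeries k) {n : ℤ} (h : ¬ (resCard O : ℤ) ∣ n) :
    (phiLS O k x).coeff n = 0 := by
  rw [phiLS_eq]
  refine HahnSeries.embDomain_of_notMem_range ?_
  rintro ⟨m, rfl⟩
  exact h (dvd_mul_right _ _)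

theorem phiLS_single (n : ℤ) (c : k) :
    phiLS O k (HahnSeries.single n c) = HahnSeries.single (resCard O * n) c := by
  rw [phiLS_eq]
  exact HahnSeries.embDomain_single

theorem phiLS_tpow (n : ℤ) : phiLS O k (tpow k n) = tpow k (resCard O * n) := phiLS_single O n 1

theorem VanishBelow.phi {d : ℤ} {x : LaurentSeries k} (h : VanishBelow d x) :
    VanishBelow (resCard O * d) (phiLS O k x) := by
  intro n hn
  by_cases hd : (resCard O : ℤ) ∣ n
  · obtain ⟨m, rfl⟩ := hd
    rw [coeff_phiLS_mul]
    exact h m (lt_of_mul_lt_mul_left hn (resCard_pos O).le)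
  · exact coeff_phiLS_of_not_dvd O x hd

theorem order_phiLS {x : LaurentSeries k} (hx : x ≠ 0) :
    (phiLS O k x).order = resCard O * x.order := by
  refine order_eq_of_vanishBelow
    (VanishBelow.phi O fun n hn => HahnSeries.coeff_eq_zero_of_lt_order hn) ?_
  rw [coeff_phiLS_mul]
  exact HahnSeries.coeff_order_eq_zero.not.2 hx

theorem kap_bdd (x : LaurentSeries k) :
    BddBelow (Function.support fun n : ℤ => x.coeff (resCard O * n)) := by
  obtain ⟨N, hN⟩ := exists_vanishBelow x
  refine ⟨-N, fun n hn => le_of_not_gt fun h => hn ?_⟩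
  refine hN _ ?_
  have := resCard_pos O
  nlinarith

/-- The operator `∑ a_n t ^ n ↦ ∑ a_{qn} t ^ n` on `k((t))`. -/
noncomputable def kap : LaurentSeries k →+ LaurentSeries k where
  toFun x := HahnSeries.ofSuppBddBelow (fun n : ℤ => x.coeff (resCard O * n)) (kap_bdd O x)
  map_zero' := by ext n; simp
  map_add' x y := by ext n; simp

theorem coeff_kap (x : LaurentSeries k) (n : ℤ) :
    (kap O x).coeff n = x.coeff (resCard O * n) := by
  exact congrFun (HahnSeries.coeff_ofSuppBddBelow (hf := kap_bdd O x)) n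

theorem kap_phi_mul (a x : LaurentSeries k) : kap O (phiLS O k a * x) = a * kap O x := by
  have hq := resCard_pos O
  ext n
  rw [coeff_kap, HahnSeries.coeff_mul, HahnSeries.coeff_mul]
  symm
  refine Finset.sum_of_injOn (fun ij => (resCard O * ij.1, resCard O * ij.2)) ?_ ?_ ?_ ?_
  · rintro ⟨i, j⟩ - ⟨i', j'⟩ - h
    simp only [Prod.mk.injEq] at h
    exact Prod.ext (mul_left_cancel₀ hq.ne' h.1) (mul_left_cancel₀ hq.ne' h.2)
  · rintro ⟨i, j⟩ h
    rw [Finset.mem_coe, Finset.mem_antidiagonal] at h ⊢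
    simp only [HahnSeries.mem_support, coeff_kap, coeff_phiLS_mul] at h ⊢
    exact ⟨h.1, h.2.1, by rw [← mul_add, h.2.2]⟩
  · rintro ⟨i, j⟩ h h'
    rw [Finset.mem_antidiagonal] at h
    by_cases hi : (resCard O : ℤ) ∣ i
    · obtain ⟨i', rfl⟩ := hi
      have hj : (resCard O : ℤ) ∣ j := by
        rw [← Int.dvd_add_right (dvd_mul_right (resCard O : ℤ) i'), h.2.2]
        exact dvd_mul_right _ _
      obtain ⟨j', rfl⟩ := hj
      refine absurd ⟨(i', j'), ?_, rfl⟩ h'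
      rw [Finset.mem_coe, Finset.mem_antidiagonal]
      simp only [HahnSeries.mem_support, coeff_kap, coeff_phiLS_mul] at h ⊢
      refine ⟨h.1, h.2.1, mul_left_cancel₀ hq.ne' ?_⟩
      rw [mul_add]; exact h.2.2
    · rw [coeff_phiLS_of_not_dvd O a hi, zero_mul]
  · rintro ⟨i, j⟩ h
    simp only [coeff_kap, coeff_phiLS_mul]

theorem kap_one : kap O (1 : LaurentSeries k) = 1 := by
  ext n
  rw [coeff_kap, HahnSeries.coeff_one, HahnSeries.coeff_one]
  simp [resCard_ne_zero O]

theorem kap_phi (a : LaurentSeries k) : kap O (phiLS O k a) = a := by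
  rw [← mul_one (phiLS O k a), kap_phi_mul, kap_one, mul_one]

theorem kap_tpow_of_not_dvd {n : ℤ} (h : ¬ (resCard O : ℤ) ∣ n) : kap O (tpow k n) = 0 := by
  ext m
  rw [coeff_kap, HahnSeries.coeff_zero, HahnSeries.coeff_single_of_ne]
  rintro rfl
  exact h (dvd_mul_right _ _)

theorem kap_tpow_phi_of_not_dvd {n : ℤ} (h : ¬ (resCard O : ℤ) ∣ n) (a : LaurentSeries k) :
    kap O (tpow k n * phiLS O k a) = 0 := by
  rw [mul_comm, kap_phi_mul, kap_tpow_of_not_dvd O h, mul_zero]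

theorem kap_tpow_neg_mul_cancel (n : ℤ) (a : LaurentSeries k) :
    kap O (tpow k (-n) * (tpow k n * phiLS O k a)) = a := by
  rw [← mul_assoc, tpow_neg_mul, one_mul, kap_phi]

/-- k((t)) is free over φ(k((t))) with basis 1, t, …, t^(q-1), and κ(t^(-i) x) is the i-th
coordinate of x. -/
theorem kap_decomp (x : LaurentSeries k) :
    x = ∑ i ∈ Finset.range (resCard O), phiLS O k (kap O (tpow k (-i) * x)) * tpow k i := by
  have hq := resCard_pos O
  ext n
  have h0 := Int.emod_nonneg n hq.ne'
  have hlt := Int.emod_lt_of_pos n hq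
  rw [HahnSeries.coeff_sum, Finset.sum_eq_single (n % resCard O).toNat]
  · rw [mul_comm, coeff_tpow_mul, Int.toNat_of_nonneg h0]
    have e : n - n % resCard O = resCard O * (n / resCard O) := by
      have := Int.mul_ediv_add_emod n (resCard O); omega
    rw [e, coeff_phiLS_mul, coeff_kap, coeff_tpow_mul, ← e]
    congr 1; ring
  · intro i hi hne
    rw [mul_comm, coeff_tpow_mul, coeff_phiLS_of_not_dvd]
    intro hd
    apply hne
    have hi' : (i : ℤ) < resCard O := by exact_mod_cast Finset.mem_range.1 hi
    have : n % resCard O = i :=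
      Eq.trans (Int.modEq_iff_dvd.2 hd).symm (Int.emod_eq_of_lt (by omega) hi')
    omega
  · intro h
    refine absurd (Finset.mem_range.2 ?_) h
    omega

theorem eq_zero_of_kap_mul {z : LaurentSeries k} (h : ∀ b, kap O (b * z) = 0) : z = 0 := by
  rw [kap_decomp O z]
  exact Finset.sum_eq_zero fun i _ => by rw [h, map_zero, zero_mul]

/-- The bound `he` expresses e ≤ ⌈d/q⌉ without a division. Most estimates of ψ below come down to
it. -/
theorem VanishBelow.kap {d e : ℤ} {x : LaurentSeries k} (h : VanishBelow d x)
    (he : resCard O * (e - 1) < d) : VanishBelow e (kap O x) := by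
  intro n hn
  rw [coeff_kap]
  refine h _ (lt_of_le_of_lt ?_ he)
  exact mul_le_mul_of_nonneg_left (by omega) (resCard_pos O).le

/-- κ is adjoint to φ for the pairing given by the constant term of a product. For this reason κ
describes the transpose of φ on duals. -/
theorem coeff_zero_mul_phi (g u : LaurentSeries k) :
    (g * phiLS O k u).coeff 0 = (kap O g * u).coeff 0 := by
  rw [mul_comm, mul_comm (kap O g), ← kap_phi_mul, coeff_kap, mul_zero]

end Kappa

end PhiGamma

namespace PhiGamma

/-! ### Uniqueness, multiplicativity and linear term of the Lubin–Tate series. -/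

section LubinTateSeries
open IsLocalRing
variable {O : Type*} [CommRing O] [IsDomain O] [IsDiscreteValuationRing O]
  [Finite (ResidueField O)] {π : O} (hπ : Irreducible π)

theorem coeff_zero_subst {R : Type*} [CommRing R] {f g : R⟦X⟧} (hg : X ∣ g) :
    coeff 0 (f.subst g) = coeff 0 f := by
  have hs : HasSubst g := HasSubst.of_constantCoeff_zero' (X_dvd_iff.1 hg)
  have e := eq_X_mul_shift_add_const f
  conv_lhs => rw [e, subst_add hs, subst_mul hs, subst_X hs, subst_C]
  rw [coeff_zero_eq_constantCoeff_apply, coeff_zero_eq_constantCoeff_apply, map_add, map_mul,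
    X_dvd_iff.1 hg, zero_mul, zero_add]
  exact constantCoeff_C _

theorem coeff_one_subst {R : Type*} [CommRing R] {f g : R⟦X⟧} (hf : X ∣ f) (hg : X ∣ g) :
    coeff 1 (f.subst g) = coeff 1 f * coeff 1 g := by
  have hs : HasSubst g := HasSubst.of_constantCoeff_zero' (X_dvd_iff.1 hg)
  obtain ⟨u, rfl⟩ := hf
  obtain ⟨v, hv⟩ := id hg
  rw [subst_mul hs, subst_X hs]
  nth_rewrite 1 [hv]
  have h1 : ∀ w : R⟦X⟧, coeff 1 (X * w) = coeff 0 w := fun w => coeff_succ_X_mul 0 w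
  have h0 : coeff 0 (v * u.subst g) = coeff 0 v * coeff 0 (u.subst g) := by
    simp [coeff_mul]
  rw [mul_assoc, h1, h1, h0, coeff_zero_subst hg, hv, h1, mul_comm]

include hπ in
-- Changing the coefficient of degree n+2 by d changes the defect in that degree by d(π - π^(n+2)),
-- and the second factor is nonzero. The truncated form is needed because it also compares a
-- solution with an approximate one, as in `lubinTate_linear`.
theorem X_pow_dvd_sub_of_ltErr {f g : O⟦X⟧} (hf : X ∣ f) (hg : X ∣ g)
    (h1 : coeff 1 f = coeff 1 g) (N : ℕ)
    (hN : X ^ N ∣ ltErr π (resCard O) f - ltErr π (resCard O) g) : X ^ N ∣ f - g := by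
  have hq := two_le_card (O := O)
  have h2 : X ^ 2 ∣ f - g := by
    rw [X_pow_dvd_iff]
    intro m hm
    interval_cases m
    · rw [map_sub, coeff_zero_eq_constantCoeff_apply, coeff_zero_eq_constantCoeff_apply,
        X_dvd_iff.1 hf, X_dvd_iff.1 hg, sub_zero]
    · rw [map_sub, h1, sub_self]
  induction N with
  | zero => simp
  | succ N ih =>
    rcases Nat.lt_or_ge N 2 with hlt | hge
    · exact (pow_dvd_pow X (by omega)).trans h2
    obtain ⟨n, rfl⟩ : ∃ n, N = n + 2 := ⟨N - 2, by omega⟩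
    have hI := ih ((pow_dvd_pow X (by omega)).trans hN)
    set d := coeff (n + 2) (f - g) with hd
    have hX : (X : O⟦X⟧) ∣ C d * X ^ (n + 2) := (dvd_pow_self X (by omega)).mul_left _
    have h3 : X ^ (n + 3) ∣ f - (g + C d * X ^ (n + 2)) := by
      rw [X_pow_dvd_iff]
      intro m hm
      rw [← sub_sub, map_sub, coeff_C_mul, coeff_X_pow]
      rcases Nat.lt_or_ge m (n + 2) with hm' | hm'
      · rw [X_pow_dvd_iff.1 hI m hm', if_neg (by omega), mul_zero, sub_zero]
      · obtain rfl : m = n + 2 := by omega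
        rw [if_pos rfl, mul_one, ← hd, sub_self]
    have h4 := X_pow_dvd_iff.1 (X_pow_dvd_ltErr_sub π hq hf (dvd_add hg hX) h3) (n + 2) (by omega)
    have h5 := X_pow_dvd_iff.1 hN (n + 2) (by omega)
    rw [map_sub, sub_eq_zero] at h4 h5
    rw [coeff_ltErr_add π hq hg, h5, left_eq_add, mul_eq_zero] at h4
    have hne : π - π ^ (n + 2) ≠ 0 := by
      rw [pow_succ', ← mul_one_sub]
      refine mul_ne_zero hπ.ne_zero fun h0 => hπ.not_isUnit ?_
      exact (isUnit_pow_iff (Nat.succ_ne_zero n)).1 (by rw [← sub_eq_zero.1 h0]; exact isUnit_one)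
    have hd0 := h4.resolve_right hne
    rw [hd0, map_zero, zero_mul, add_zero] at h3
    exact h3

theorem lubinTate_X_dvd (a : O) : X ∣ lubinTate hπ a :=
  X_dvd_iff.2 (exists_lubinTate hπ a).choose_spec.1

theorem coeff_one_lubinTate (a : O) : coeff 1 (lubinTate hπ a) = a :=
  (exists_lubinTate hπ a).choose_spec.2.1

theorem lubinTate_comm (a : O) : (ltPoly π (resCard O)).subst (lubinTate hπ a) =
    (lubinTate hπ a).subst (ltPoly π (resCard O)) :=
  (exists_lubinTate hπ a).choose_spec.2.2

theorem ltErr_lubinTate (a : O) : ltErr π (resCard O) (lubinTate hπ a) = 0 :=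
  sub_eq_zero.2 (lubinTate_comm hπ a)

theorem hasSubst_lubinTate (a : O) : HasSubst (lubinTate hπ a) :=
  HasSubst.of_constantCoeff_zero' (X_dvd_iff.1 (lubinTate_X_dvd hπ a))

include hπ in
theorem eq_of_ltErr_eq_zero {f g : O⟦X⟧} (hf : X ∣ f) (hg : X ∣ g)
    (h1 : coeff 1 f = coeff 1 g) (hf0 : ltErr π (resCard O) f = 0)
    (hg0 : ltErr π (resCard O) g = 0) : f = g := by
  ext n
  have := X_pow_dvd_iff.1 (X_pow_dvd_sub_of_ltErr hπ hf hg h1 (n + 1)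
    (by rw [hf0, hg0, sub_zero]; exact dvd_zero _)) n (by omega)
  rwa [map_sub, sub_eq_zero] at this

theorem lubinTate_one : lubinTate hπ 1 = X := by
  refine eq_of_ltErr_eq_zero hπ (lubinTate_X_dvd hπ 1) dvd_rfl
    (by rw [coeff_one_lubinTate, coeff_one_X]) (ltErr_lubinTate hπ 1) ?_
  rw [ltErr, subst_X (hasSubst_ltPoly π two_le_card), ← map_algebraMap_eq_subst_X]
  simp

/-- Both series commute with Φ and have linear coefficient ab, so uniqueness applies. -/
theorem lubinTate_mul (a b : O) :
    lubinTate hπ (a * b) = (lubinTate hπ b).subst (lubinTate hπ a) := by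
  have hs := hasSubst_ltPoly π (two_le_card (O := O))
  have hX : X ∣ (lubinTate hπ b).subst (lubinTate hπ a) := by
    rw [X_dvd_iff, ← coeff_zero_eq_constantCoeff_apply, coeff_zero_subst (lubinTate_X_dvd hπ a),
      coeff_zero_eq_constantCoeff_apply, X_dvd_iff.1 (lubinTate_X_dvd hπ b)]
  refine eq_of_ltErr_eq_zero hπ (lubinTate_X_dvd hπ _) hX ?_ (ltErr_lubinTate hπ _) ?_
  · rw [coeff_one_subst (lubinTate_X_dvd hπ b) (lubinTate_X_dvd hπ a), coeff_one_lubinTate,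
      coeff_one_lubinTate, coeff_one_lubinTate, mul_comm]
  · rw [ltErr, ← subst_comp_subst_apply (hasSubst_lubinTate hπ b) (hasSubst_lubinTate hπ a),
      lubinTate_comm, subst_comp_subst_apply hs (hasSubst_lubinTate hπ a), lubinTate_comm,
      subst_comp_subst_apply (hasSubst_lubinTate hπ a) hs, sub_self]

/-- The linear series at commutes with Φ up to (a^q - a) t^q, hence agrees with [a](t) modulo t^q.
Thus γ multiplies t by a scalar up to terms q-1 degrees higher, which makes the prescribed action of
Γ respect the relations. -/
theorem lubinTate_linear (a : O) :
    ∃ v : O⟦X⟧, lubinTate hπ a = C a * X + X ^ resCard O * v := by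
  have hX : (X : O⟦X⟧) ∣ C a * X := dvd_mul_left _ _
  have hs := hasSubst_ltPoly π (two_le_card (O := O))
  have h : X ^ resCard O ∣ lubinTate hπ a - C a * X := by
    refine X_pow_dvd_sub_of_ltErr hπ (lubinTate_X_dvd hπ a) hX
      (by rw [coeff_one_lubinTate]; simp) _ ?_
    rw [ltErr_lubinTate, zero_sub, dvd_neg, ltErr_eq π hX, subst_mul hs, subst_X hs, subst_C]
    change X ^ _ ∣ C π * (C a * X) + (C a * X) ^ _ - C a * ltPoly π (resCard O)
    have e : C π * (C a * X) + (C a * X) ^ resCard O - C a * ltPoly π (resCard O) =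
      (C a * X) ^ resCard O - C a * X ^ resCard O := by rw [ltPoly]; ring
    rw [e, mul_pow]
    exact dvd_sub (dvd_mul_left _ _) (dvd_mul_left _ _)
  obtain ⟨v, hv⟩ := h
  exact ⟨v, by rw [← hv]; ring⟩

end LubinTateSeries

theorem toCoeff_uniformizer {O : Type*} [CommRing O] [IsDomain O] [IsDiscreteValuationRing O]
    {π : O} (hπ : Irreducible π) (k : Type*) [Field k] [Algebra (IsLocalRing.ResidueField O) k] :
    toCoeff k π = 0 := by
  have : IsLocalRing.residue O π = 0 := by
    rw [IsLocalRing.residue_eq_zero_iff, Irreducible.maximalIdeal_eq hπ]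
    exact Ideal.mem_span_singleton_self π
  rw [toCoeff, RingHom.comp_apply, this, map_zero]

/-! ### The action of Γ on k[[t]] and k((t)). -/

section GammaAction
open IsLocalRing
variable {O : Type*} [CommRing O] [IsDomain O] [IsDiscreteValuationRing O]
  [Finite (ResidueField O)] {π : O} (hπ : Irreducible π) (k : Type*) [Field k]
  [Algebra (ResidueField O) k]

theorem hasSubst_gammaSeries (γ : Oˣ) : HasSubst (gammaSeries k hπ γ) :=
  HasSubst.of_constantCoeff_zero' (constantCoeff_gammaSeries k hπ γ)

theorem gammaPS_apply (γ : Oˣ) (f : k⟦X⟧) : gammaPS k hπ γ f = f.subst (gammaSeries k hπ γ) := by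
  rw [gammaPS, substPS, coe_substAlgHom]

theorem gammaPS_X (γ : Oˣ) : gammaPS k hπ γ X = gammaSeries k hπ γ := by
  rw [gammaPS_apply, subst_X (hasSubst_gammaSeries hπ k γ)]

theorem gammaSeries_one : gammaSeries k hπ 1 = X := by
  rw [gammaSeries, Units.val_one, lubinTate_one, map_X]

theorem gammaSeries_mul (γ γ' : Oˣ) :
    gammaSeries k hπ (γ * γ') = (gammaSeries k hπ γ').subst (gammaSeries k hπ γ) := by
  rw [gammaSeries, Units.val_mul, lubinTate_mul]
  exact map_subst (hasSubst_lubinTate hπ _) _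

theorem gammaPS_one (f : k⟦X⟧) : gammaPS k hπ 1 f = f := by
  rw [gammaPS_apply, gammaSeries_one, ← map_algebraMap_eq_subst_X]
  simp

theorem gammaPS_mul (γ γ' : Oˣ) (f : k⟦X⟧) :
    gammaPS k hπ (γ * γ') f = gammaPS k hπ γ (gammaPS k hπ γ' f) := by
  simp only [gammaPS_apply]
  rw [gammaSeries_mul, subst_comp_subst_apply (hasSubst_gammaSeries hπ k γ')
    (hasSubst_gammaSeries hπ k γ)]

theorem map_ltPoly {O : Type*} [CommRing O] [IsDomain O] [IsDiscreteValuationRing O]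
    {π : O} (hπ : Irreducible π) (k : Type*) [Field k] [Algebra (ResidueField O) k] : PowerSeries.map (toCoeff k) (ltPoly π (resCard O)) = X ^ resCard O := by
  simp [ltPoly, toCoeff_uniformizer hπ k]

/-- Φ reduces to t^q modulo π, so this is the reduction of Φ([γ](t)) = [γ](Φ(t)). It amounts to γ
commuting with φ. -/
theorem gammaSeries_pow (γ : Oˣ) :
    gammaSeries k hπ γ ^ resCard O = (gammaSeries k hπ γ).subst (X ^ resCard O : k⟦X⟧) := by
  have h := congrArg (PowerSeries.map (toCoeff k)) (ltErr_lubinTate hπ (γ : O))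
  rw [ltErr_eq π (lubinTate_X_dvd hπ _), map_sub, map_add, map_mul, map_C,
    toCoeff_uniformizer hπ k, map_pow, map_zero, map_zero, zero_mul, zero_add, sub_eq_zero] at h
  rw [gammaSeries, h, ← map_ltPoly hπ k]
  exact map_subst (hasSubst_ltPoly π two_le_card) _

theorem gammaPS_phiPS (γ : Oˣ) (f : k⟦X⟧) :
    gammaPS k hπ γ (phiPS O k f) = phiPS O k (gammaPS k hπ γ f) := by
  have hX : HasSubst (X ^ resCard O : k⟦X⟧) := HasSubst.X_pow (resCard_ne_zero O)
  have hg := hasSubst_gammaSeries hπ k γ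
  simp only [gammaPS_apply, phiPS_apply_subst]
  rw [subst_comp_subst_apply hX hg, subst_comp_subst_apply hg hX, subst_pow hg, subst_X hg,
    gammaSeries_pow]

theorem gammaSeries_linear (γ : Oˣ) : ∃ v : k⟦X⟧,
    gammaSeries k hπ γ = C ((scalar k γ : kˣ) : k) * X + X ^ resCard O * v := by
  obtain ⟨v, hv⟩ := lubinTate_linear hπ (γ : O)
  refine ⟨PowerSeries.map (toCoeff k) v, ?_⟩
  rw [gammaSeries, hv]
  simp [scalar]

/-- The clause for n = 0 lets `isHomogeneous_pow_smul` treat φ^n e_i itself without knowing that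
t^(q-1) annihilates it. -/
theorem gammaPS_X_pow (γ : Oˣ) (n : ℕ) : ∃ v : k⟦X⟧,
    gammaPS k hπ γ (X ^ n) =
      C (((scalar k γ ^ n : kˣ) : k)) * X ^ n + X ^ (n + (resCard O - 1)) * v ∧ (n = 0 → v = 0) := by
  obtain ⟨v, hv⟩ := gammaSeries_linear hπ k γ
  have hq : 2 ≤ resCard O := two_le_card (O := O)
  rcases Nat.eq_zero_or_pos n with rfl | hn
  · exact ⟨0, by simp, fun _ => rfl⟩
  have e : gammaSeries k hπ γ =
      X * (C ((scalar k γ : kˣ) : k) + X ^ (resCard O - 1) * v) := by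
    rw [hv, mul_add, ← mul_assoc, ← pow_succ', show resCard O - 1 + 1 = resCard O by omega,
      mul_comm X]
  obtain ⟨w, hw⟩ := sub_dvd_pow_sub_pow
    (C ((scalar k γ : kˣ) : k) + X ^ (resCard O - 1) * v) (C ((scalar k γ : kˣ) : k)) n
  refine ⟨v * w, ?_, fun h => absurd h hn.ne'⟩
  rw [map_pow, gammaPS_X, e, mul_pow, sub_eq_iff_eq_add.1 hw]
  rw [Units.val_pow_eq_pow_val, map_pow, pow_add]
  ring

theorem gammaLS_algebraMap (γ : Oˣ) (f : k⟦X⟧) :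
    gammaLS k hπ γ (algebraMap k⟦X⟧ (LaurentSeries k) f) =
      algebraMap k⟦X⟧ (LaurentSeries k) (gammaPS k hπ γ f) := substLS_algebraMap _ _ _ _

theorem gammaLS_one (x : LaurentSeries k) : gammaLS k hπ 1 x = x := by
  have : gammaLS k hπ 1 = RingHom.id _ := by
    refine IsLocalization.ringHom_ext (Submonoid.powers (X : k⟦X⟧)) (RingHom.ext fun f => ?_)
    rw [RingHom.comp_apply, gammaLS_algebraMap, gammaPS_one]
    rfl
  rw [this]; rfl

theorem gammaLS_mul (γ γ' : Oˣ) (x : LaurentSeries k) :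
    gammaLS k hπ (γ * γ') x = gammaLS k hπ γ (gammaLS k hπ γ' x) := by
  have : gammaLS k hπ (γ * γ') = (gammaLS k hπ γ).comp (gammaLS k hπ γ') := by
    refine IsLocalization.ringHom_ext (Submonoid.powers (X : k⟦X⟧)) (RingHom.ext fun f => ?_)
    simp only [RingHom.comp_apply, gammaLS_algebraMap, gammaPS_mul]
  rw [this]; rfl

theorem gammaLS_phiLS (γ : Oˣ) (x : LaurentSeries k) :
    gammaLS k hπ γ (phiLS O k x) = phiLS O k (gammaLS k hπ γ x) := by
  have : (gammaLS k hπ γ).comp (phiLS O k) = (phiLS O k).comp (gammaLS k hπ γ) := by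
    refine IsLocalization.ringHom_ext (Submonoid.powers (X : k⟦X⟧)) (RingHom.ext fun f => ?_)
    simp only [RingHom.comp_apply, gammaLS_algebraMap, phiLS_algebraMap, gammaPS_phiPS]
  exact RingHom.congr_fun this x

theorem gammaLS_inv_gammaLS (γ : Oˣ) (x : LaurentSeries k) :
    gammaLS k hπ γ (gammaLS k hπ γ⁻¹ x) = x := by
  rw [← gammaLS_mul, mul_inv_cancel, gammaLS_one]

end GammaAction

/-! ### Existence of a ψ-operator, by means of the Cartier operator. -/

section PsiExists
open IsLocalRing
variable {O : Type*} [CommRing O] [IsDomain O] [IsDiscreteValuationRing O]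
  [Finite (ResidueField O)] {π : O} (hπ : Irreducible π) (k : Type*) [Field k]
  [Algebra (ResidueField O) k]

theorem natCast_resCard : ((resCard O : ℕ) : k) = 0 := by
  have := Fintype.ofFinite (ResidueField O)
  have h : ((resCard O : ℕ) : ResidueField O) = 0 := by
    rw [resCard, Nat.card_eq_fintype_card, FiniteField.cast_card_eq_zero]
  have h2 := congrArg (algebraMap (ResidueField O) k) h
  rwa [map_natCast, map_zero] at h2

include hπ in
-- The element c enters through Φ'(t) = π + q t^(q-1) = π(1 + c t^(q-1)).
theorem exists_resCard_eq : ∃ c : O, ((resCard O : ℕ) : O) = π * c := by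
  have : residue O ((resCard O : ℕ) : O) = 0 := by
    rw [map_natCast]; exact natCast_resCard (O := O) (ResidueField O)
  rw [residue_eq_zero_iff, Irreducible.maximalIdeal_eq hπ, Ideal.mem_span_singleton] at this
  exact this

theorem derivative_map' {R S : Type*} [CommRing R] [CommRing S] (g : R →+* S) (f : R⟦X⟧) :
    PowerSeries.map g (derivative R f) = derivative S (PowerSeries.map g f) := by
  ext n
  simp [coeff_derivative]

/-- This is the chain rule for Φ([a](t)) = [a](Φ(t)). The common factor π has to be cancelled over
O, since after reduction both sides would be zero. -/
theorem derivative_lubinTate {c : O} (hc : ((resCard O : ℕ) : O) = π * c) (a : O) :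
    derivative O (lubinTate hπ a) * (1 + C c * lubinTate hπ a ^ (resCard O - 1)) =
      (derivative O (lubinTate hπ a)).subst (ltPoly π (resCard O)) *
        (1 + C c * X ^ (resCard O - 1)) := by
  have hs := hasSubst_ltPoly π (two_le_card (O := O))
  have h := sub_eq_zero.1 ((ltErr_eq π (lubinTate_X_dvd hπ a)).symm.trans (ltErr_lubinTate hπ a))
  have h' := congrArg (derivative O) h
  have hC : C π ≠ (0 : O⟦X⟧) := by
    rw [Ne, map_eq_zero_iff _ C_injective]; exact hπ.ne_zero
  have hcast : ((resCard O : ℕ) : O⟦X⟧) = C π * C c := by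
    rw [← map_mul, ← hc, map_natCast]
  have hCd : ∀ (x : O) (f : O⟦X⟧), derivative O (C x * f) = C x * derivative O f := fun x f => by
    rw [← smul_eq_C_mul, ← smul_eq_C_mul, Derivation.map_smul]
  rw [derivative_subst hs, map_add, derivative_pow, ltPoly, map_add, derivative_pow, hCd, hCd,
    derivative_X, mul_one, mul_one, hcast] at h'
  refine mul_left_cancel₀ hC ?_
  rw [ltPoly]
  linear_combination h'

theorem derivative_gammaSeries {c : O} (hc : ((resCard O : ℕ) : O) = π * c) (γ : Oˣ) :
    derivative k (gammaSeries k hπ γ) *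
      (1 + C (toCoeff k c) * gammaSeries k hπ γ ^ (resCard O - 1)) =
      phiPS O k (derivative k (gammaSeries k hπ γ)) *
        (1 + C (toCoeff k c) * X ^ (resCard O - 1)) := by
  have h := congrArg (PowerSeries.map (toCoeff k)) (derivative_lubinTate hπ hc (γ : O))
  have e : PowerSeries.map (toCoeff k)
      ((derivative O (lubinTate hπ (γ : O))).subst (ltPoly π (resCard O))) =
      (PowerSeries.map (toCoeff k) (derivative O (lubinTate hπ (γ : O)))).subst
        (PowerSeries.map (toCoeff k) (ltPoly π (resCard O))) :=
    map_subst (hasSubst_ltPoly π two_le_card) _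
  simp only [map_mul, map_add, map_one, map_C, map_pow, map_X] at h
  rw [e, map_ltPoly hπ, derivative_map'] at h
  rw [phiPS_apply_subst]
  exact h

/-- The reduction of a coefficient identity which holds over `O` up to a factor. -/
theorem toCoeff_eq_zero_of_mul {i m : ℕ} (hi : 0 < i) (hiq : i < resCard O) [CharZero O]
    {x y : O} (h : (i : O) * x = ((resCard O * m : ℕ) : O) * y) : toCoeff k x = 0 := by
  have := Fintype.ofFinite (ResidueField O)
  obtain ⟨p, hc, n, hp, hn⟩ := FiniteField.card' (ResidueField O)
  have hcard : resCard O = p ^ (n : ℕ) := by rw [← hn, resCard, Nat.card_eq_fintype_card]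
  have hk : CharP k p := charP_of_injective_algebraMap (algebraMap (ResidueField O) k).injective p
  -- After division by the gcd, i becomes a number a prime to p, while q becomes a number b
  -- divisible by p because i < q. So b vanishes in k and a does not.
  set d := Nat.gcd i (resCard O) with hd
  have hdpos : 0 < d := Nat.gcd_pos_of_pos_left _ hi
  obtain ⟨a, ha⟩ := Nat.gcd_dvd_left i (resCard O)
  obtain ⟨b, hb⟩ := Nat.gcd_dvd_right i (resCard O)
  have hcop : Nat.Coprime a b := by
    have := Nat.coprime_div_gcd_div_gcd hdpos
    rwa [Nat.div_eq_of_eq_mul_right hdpos ha, Nat.div_eq_of_eq_mul_right hdpos hb] at this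
  have hb1 : b ≠ 1 := by
    rintro rfl
    rw [mul_one] at hb
    have := Nat.gcd_le_left (resCard O) hi
    omega
  have hpb : p ∣ b := by
    obtain ⟨j, -, hj⟩ := (Nat.dvd_prime_pow hp).1 (hcard ▸ (⟨d, by rw [mul_comm]; exact hb⟩ :
      b ∣ resCard O))
    rcases Nat.eq_zero_or_pos j with rfl | hj0
    · exact absurd (by simpa using hj) hb1
    · exact hj ▸ dvd_pow_self p hj0.ne'
  have hpa : ¬ p ∣ a := fun h' => hp.one_lt.ne' (Nat.dvd_one.1 (hcop ▸ Nat.dvd_gcd h' hpb))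
  have h2 : (a : O) * x = ((b * m : ℕ) : O) * y := by
    have hd0 : (d : O) ≠ 0 := by exact_mod_cast hdpos.ne'
    refine mul_left_cancel₀ hd0 ?_
    rw [← mul_assoc, ← mul_assoc, ← Nat.cast_mul, ← Nat.cast_mul, ← mul_assoc, ← ha, ← hb]
    exact h
  have h3 := congrArg (toCoeff k) h2
  rw [map_mul, map_mul, map_natCast, map_natCast, Nat.cast_mul, (CharP.cast_eq_zero_iff k p b).2 hpb,
    zero_mul, zero_mul, mul_eq_zero] at h3
  exact h3.resolve_left (by rwa [CharP.cast_eq_zero_iff k p])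

/-- Over O, which has characteristic zero, (i+1) f^i f' is the derivative of f^(i+1), so its
coefficient in degree qn+q-1 is divisible by q. For i+1 < q, p divides i+1 less often than q, and
the coefficient of f^i f' reduces to zero. For i+1 = q the factor q cancels and f^q ≡ f(t^q) gives
the rest. -/
theorem coeff_gammaSeries_pow_mul_derivative [CharZero O] (γ : Oˣ) {i : ℕ} (hi : i < resCard O)
    (n : ℕ) :
    coeff (resCard O * n + (resCard O - 1))
      (gammaSeries k hπ γ ^ i * derivative k (gammaSeries k hπ γ)) =
      if i = resCard O - 1 then coeff n (derivative k (gammaSeries k hπ γ)) else 0 := by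
  set q := resCard O with hq
  have hq2 : 2 ≤ q := two_le_card (O := O)
  set f := lubinTate hπ (γ : O) with hf
  have e1 : q * n + (q - 1) + 1 = q * (n + 1) := by rw [mul_add]; omega
  have key : ((i + 1 : ℕ) : O) * coeff (q * n + (q - 1)) (f ^ i * derivative O f) =
      ((q * (n + 1) : ℕ) : O) * coeff (q * (n + 1)) (f ^ (i + 1)) := by
    have h := congrArg (coeff (q * n + (q - 1))) (derivative_pow f (i + 1))
    rw [coeff_derivative, Nat.add_sub_cancel, mul_assoc, ← map_natCast (C : O →+* O⟦X⟧),
      coeff_C_mul] at h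
    rw [← h, mul_comm, e1, ← e1]
    push_cast
    ring
  have hmap : coeff (q * n + (q - 1))
      (gammaSeries k hπ γ ^ i * derivative k (gammaSeries k hπ γ)) =
      toCoeff k (coeff (q * n + (q - 1)) (f ^ i * derivative O f)) := by
    rw [← coeff_map, map_mul (PowerSeries.map (toCoeff k)), map_pow, derivative_map']
    rfl
  rw [hmap]
  split_ifs with h
  · have hi1 : i + 1 = q := by omega
    rw [hi1, Nat.cast_mul, mul_assoc] at key
    have hq0 : ((q : ℕ) : O) ≠ 0 := by exact_mod_cast (by omega : q ≠ 0)
    rw [mul_left_cancel₀ hq0 key, map_mul, map_natCast, ← coeff_map, map_pow]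
    change _ * coeff _ (gammaSeries k hπ γ ^ q) = _
    have e2 : gammaSeries k hπ γ ^ q = expand q (resCard_ne_zero O) (gammaSeries k hπ γ) := by
      rw [gammaSeries_pow, expand_apply]
    rw [e2, coeff_expand_mul, coeff_derivative]
    push_cast
    ring
  · exact toCoeff_eq_zero_of_mul k (Nat.succ_pos i) (by omega) key

theorem kap_gamma_tpow [CharZero O] (γ : Oˣ) {i : ℕ} (hi : i < resCard O) :
    kap O (tpow k (-(resCard O - 1 : ℕ)) * (algebraMap k⟦X⟧ (LaurentSeries k) (gammaSeries k hπ γ ^ i)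
      * algebraMap k⟦X⟧ (LaurentSeries k) (derivative k (gammaSeries k hπ γ)))) =
      if i = resCard O - 1 then
        algebraMap k⟦X⟧ (LaurentSeries k) (derivative k (gammaSeries k hπ γ)) else 0 := by
  have hq2 : 2 ≤ resCard O := two_le_card (O := O)
  ext n
  rw [coeff_kap, coeff_tpow_mul, ← map_mul]
  rcases lt_or_ge n 0 with hn | hn
  · have h1 : (if i = resCard O - 1 then
        algebraMap k⟦X⟧ (LaurentSeries k) (derivative k (gammaSeries k hπ γ)) else 0).coeff n = 0 := by
      split_ifs
      · exact vanishBelow_algebraMap _ n hn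
      · rfl
    rw [h1]
    refine vanishBelow_algebraMap _ _ ?_
    have : (resCard O : ℤ) * n ≤ resCard O * (-1) :=
      mul_le_mul_of_nonneg_left (by omega) (resCard_pos O).le
    omega
  · lift n to ℕ using hn
    have e : (resCard O : ℤ) * n - -((resCard O - 1 : ℕ) : ℤ) =
        ((resCard O * n + (resCard O - 1) : ℕ) : ℤ) := by push_cast; ring
    rw [e, coeff_algebraMap, coeff_gammaSeries_pow_mul_derivative hπ k γ hi]
    split_ifs
    · rw [coeff_algebraMap]
    · rfl

theorem gammaLS_tpow (γ : Oˣ) (i : ℕ) : gammaLS k hπ γ (tpow k i) =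
    algebraMap k⟦X⟧ (LaurentSeries k) (gammaSeries k hπ γ ^ i) := by
  rw [← algebraMap_X_pow, gammaLS_algebraMap, map_pow, gammaPS_X]

/-- The map x ↦ κ(t^(1-q) x) is the Cartier operator on the differentials x dt, and the identity
says that it respects the change of variable t ↦ [γ](t). By φ-semilinearity it is enough to know it
for x = t^i with i < q. -/
theorem kap_gamma [CharZero O] (γ : Oˣ) (x : LaurentSeries k) :
    kap O (tpow k (-(resCard O - 1 : ℕ)) * (gammaLS k hπ γ x *
      algebraMap k⟦X⟧ (LaurentSeries k) (derivative k (gammaSeries k hπ γ)))) =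
      gammaLS k hπ γ (kap O (tpow k (-(resCard O - 1 : ℕ)) * x)) *
        algebraMap k⟦X⟧ (LaurentSeries k) (derivative k (gammaSeries k hπ γ)) := by
  have hq2 : 2 ≤ resCard O := two_le_card (O := O)
  conv_lhs => rw [kap_decomp O x]
  rw [map_sum, Finset.sum_mul, Finset.mul_sum, map_sum, Finset.sum_eq_single (resCard O - 1)]
  · rw [map_mul (gammaLS k hπ γ), gammaLS_phiLS, gammaLS_tpow, mul_assoc, mul_left_comm, kap_phi_mul,
      kap_gamma_tpow hπ k γ (by omega), if_pos rfl]
  · intro i hi hne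
    rw [map_mul (gammaLS k hπ γ), gammaLS_phiLS, gammaLS_tpow, mul_assoc, mul_left_comm, kap_phi_mul,
      kap_gamma_tpow hπ k γ (Finset.mem_range.1 hi), if_neg hne, mul_zero]
  · intro h
    exact absurd (Finset.mem_range.2 (by omega)) h

/-- The operator is x ↦ κ(t^(1-q) U x) with U = 1 + c t^(q-1). The Cartier operator commutes with γ
only up to the derivative G of [γ](t), and G γ(U) = φ(G) U shows that the factor U absorbs this
discrepancy. -/
theorem nonempty_psiOperator [CharZero O] : Nonempty (PsiOperator k hπ) := by
  have hq2 : 2 ≤ resCard O := two_le_card (O := O)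
  obtain ⟨c, hc⟩ := exists_resCard_eq hπ
  set u : k⟦X⟧ := 1 + C (toCoeff k c) * X ^ (resCard O - 1) with hu
  set U := algebraMap k⟦X⟧ (LaurentSeries k) u with hU
  set T := tpow k (-(resCard O - 1 : ℕ)) with hT
  have hTU : T * U = T + HahnSeries.C (toCoeff k c) := by
    rw [hU, hu, map_add, map_one, map_mul, algebraMap_X_pow, mul_add, mul_one, mul_left_comm,
      hT, tpow_neg_mul, mul_one, LaurentSeries.coe_algebraMap, PowerSeries.coe_C]
  have hkap : ∀ y : LaurentSeries k, kap O (T * (tpow k (resCard O - 1 : ℕ) * phiLS O k y)) = y :=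
    fun y => kap_tpow_neg_mul_cancel O _ y
  have hphiC : ∀ c : k, HahnSeries.C c = phiLS O k (HahnSeries.C c) := fun c => by
    rw [HahnSeries.C_apply, phiLS_single, mul_zero]
  refine ⟨⟨(kap O).comp (AddMonoidHom.mulLeft (T * U)), ?_, ?_, ?_⟩⟩
  · intro a x
    change kap O (T * U * (phiLS O k a * x)) = a * kap O (T * U * x)
    rw [mul_left_comm, kap_phi_mul]
  · intro γ x
    change kap O (T * U * gammaLS k hπ γ x) = gammaLS k hπ γ (kap O (T * U * x))
    set G := algebraMap k⟦X⟧ (LaurentSeries k) (derivative k (gammaSeries k hπ γ)) with hG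
    have hG0 : G ≠ 0 := by
      rw [hG, Ne, FaithfulSMul.algebraMap_eq_zero_iff]
      intro h0
      have h1 := congrArg (coeff 0) h0
      rw [coeff_derivative, gammaSeries, coeff_map, coeff_one_lubinTate, map_zero] at h1
      have : (scalar k γ : k) = 0 := by simpa [scalar] using h1
      exact (scalar k γ).ne_zero this
    have hGU : G * gammaLS k hπ γ U = phiLS O k G * U := by
      have := congrArg (algebraMap k⟦X⟧ (LaurentSeries k)) (derivative_gammaSeries hπ k hc γ)
      rw [map_mul, map_mul] at this
      rw [hU, hG, gammaLS_algebraMap, phiLS_algebraMap, ← this, hu]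
      congr 2
      rw [map_add, map_one, map_mul, map_pow, gammaPS_X]
      congr 2
      exact AlgHom.commutes (gammaPS k hπ γ) _
    refine mul_left_cancel₀ hG0 ?_
    rw [← kap_phi_mul, mul_comm G, mul_assoc T U x, ← kap_gamma hπ k γ (U * x)]
    congr 1
    rw [map_mul]
    linear_combination (-(T * gammaLS k hπ γ x)) * hGU
  · have hmem : ∀ x : LaurentSeries k, x ∈ Set.range (algebraMap k⟦X⟧ (LaurentSeries k)) ↔
        VanishBelow 0 x := fun x => vanishBelow_zero_iff.symm
    ext y
    rw [hmem]
    constructor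
    · rintro ⟨x, hx, rfl⟩
      rw [hmem] at hx
      change VanishBelow 0 (kap O (T * U * x))
      rw [mul_assoc]
      have h1 : VanishBelow (-(resCard O - 1 : ℕ) + (0 + 0)) (T * (U * x)) :=
        (vanishBelow_tpow _).mul ((vanishBelow_algebraMap u).mul hx)
      exact h1.kap O (by omega)
    · intro hy
      -- On t^(q-1) φ(y) the summand 1 of U returns y, and the summand c t^(q-1) contributes c
      -- κ(t^(q-1) φ(y)) = 0 since q does not divide q-1.
      refine ⟨tpow k (resCard O - 1 : ℕ) * phiLS O k y, ?_, ?_⟩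
      · rw [hmem, vanishBelow_tpow_mul]
        exact (hy.phi O).mono (by rw [mul_zero]; omega)
      · change kap O (T * U * _) = y
        rw [hTU, add_mul, map_add, hkap, hphiC, kap_phi_mul, kap_tpow_phi_of_not_dvd, mul_zero,
          add_zero]
        intro h
        have := Int.le_of_dvd (by omega) h
        omega

end PsiExists

/-! ### The shape of an arbitrary ψ-operator. -/

section PsiForm
open IsLocalRing
variable {O : Type*} [CommRing O] [IsDomain O] [IsDiscreteValuationRing O]
  [Finite (ResidueField O)] {π : O} {hπ : Irreducible π} {k : Type*} [Field k]
  [Algebra (ResidueField O) k]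

/-- ψ is determined by its values on the φ-basis 1, …, t^(q-1), so c = Σ φ(ψ(t^i)) t^(-i) works. It
is nonzero because ψ attains the value 1. -/
theorem PsiOperator.exists_eq_kap (ψ : PsiOperator k hπ) :
    ∃ c : LaurentSeries k, c ≠ 0 ∧ ∀ x, ψ.toHom x = kap O (c * x) := by
  have h : ∀ x, ψ.toHom x = kap O ((∑ i ∈ Finset.range (resCard O),
      phiLS O k (ψ.toHom (tpow k i)) * tpow k (-i)) * x) := fun x => by
    conv_lhs => rw [kap_decomp O x]
    rw [map_sum, Finset.sum_mul, map_sum]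
    refine Finset.sum_congr rfl fun i _ => ?_
    rw [ψ.map_phi_mul, mul_assoc, kap_phi_mul, mul_comm]
  refine ⟨_, fun h0 => ?_, h⟩
  have h1 : (1 : LaurentSeries k) ∈ ψ.toHom '' Set.range (algebraMap k⟦X⟧ (LaurentSeries k)) := by
    rw [ψ.image_eq]
    exact ⟨1, map_one _⟩
  obtain ⟨x, -, hx⟩ := h1
  rw [h, h0, zero_mul, map_zero] at hx
  exact zero_ne_one hx

end PsiForm

end PhiGamma

namespace PhiGamma

/-! ### The linearization of φ in terms of bases. -/

section Linearization
open TensorProduct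
variable {A : Type*} [CommRing A] {σ : A →+* A} {M : Type*} [AddCommGroup M] [Module A M]

/-- An element of `A`, regarded as an element of `Twist σ`. -/
def Twist.of (σ : A →+* A) (a : A) : Twist σ := a

theorem linearization_tmul (f : M →ₛₗ[σ] M) (a : A) (x : M) :
    linearization f (Twist.of σ a ⊗ₜ x) = a • f x := rfl

theorem exists_sum_tmul_basis {ι : Type*} [Fintype ι] (b : Module.Basis ι A M)
    (t : Twist σ ⊗[A] M) : ∃ a : ι → A, t = ∑ i, Twist.of σ (a i) ⊗ₜ[A] b i := by
  induction t with
  | zero => exact ⟨0, by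
      symm; exact Finset.sum_eq_zero fun i _ => TensorProduct.zero_tmul _ _⟩
  | tmul a x =>
    refine ⟨fun i => σ (b.repr x i) * a.val, ?_⟩
    conv_lhs => rw [← b.sum_repr x]
    rw [TensorProduct.tmul_sum]
    refine Finset.sum_congr rfl fun i _ => ?_
    rw [TensorProduct.tmul_smul, TensorProduct.smul_tmul']
    rfl
  | add t t' ht ht' =>
    obtain ⟨a, rfl⟩ := ht
    obtain ⟨a', rfl⟩ := ht'
    refine ⟨a + a', ?_⟩
    rw [← Finset.sum_add_distrib]
    refine Finset.sum_congr rfl fun i _ => ?_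
    rw [← TensorProduct.add_tmul]
    rfl

theorem bijective_linearization {ι : Type*} [Fintype ι] (f : M →ₛₗ[σ] M)
    (b b' : Module.Basis ι A M) (h : ∀ i, f (b i) = b' i) :
    Function.Bijective (linearization f) := by
  have hs : ∀ a : ι → A, linearization f (∑ i, Twist.of σ (a i) ⊗ₜ[A] b i) = ∑ i, a i • b' i :=
    fun a => by
      rw [map_sum]
      exact Finset.sum_congr rfl fun i _ => by rw [linearization_tmul, h]
  constructor
  · rw [injective_iff_map_eq_zero]
    intro t ht
    obtain ⟨a, rfl⟩ := exists_sum_tmul_basis b t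
    rw [hs] at ht
    refine Finset.sum_eq_zero fun i _ => ?_
    rw [Fintype.linearIndependent_iff.1 b'.linearIndependent a ht i]
    exact TensorProduct.zero_tmul _ _
  · intro y
    exact ⟨∑ i, Twist.of σ (b'.repr y i) ⊗ₜ[A] b i, by rw [hs, b'.sum_repr]⟩

end Linearization

/-! ### The operator ψ on an étale module and the uniqueness of D^♯. -/

section Psi
open IsLocalRing TensorProduct

variable {O : Type*} [CommRing O] [IsDomain O] [IsDiscreteValuationRing O]
  [Finite (ResidueField O)] {k : Type*} [Field k] [Algebra (ResidueField O) k]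
  {π : O} {hπ : Irreducible π} (ψ : PsiOperator k hπ)
  {D : Type*} [AddCommGroup D] [Module (LaurentSeries k) D]
  (S : EtalePhiGammaModule (phiLS O k) (gammaLS k hπ) D)

theorem psi_smul_phi (a : LaurentSeries k) (x : D) :
    psi ψ S (a • S.phi x) = ψ.toHom a • x := by
  have : (AddEquiv.ofBijective (linearization S.phi) S.bijective).symm (a • S.phi x) =
      Twist.of (phiLS O k) a ⊗ₜ x := by
    rw [AddEquiv.symm_apply_eq]
    rfl
  change psiContract ψ D ((AddEquiv.ofBijective (linearization S.phi) S.bijective).symm _) = _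
  rw [this]
  rfl

theorem EtalePhiGammaModule.induction {S : EtalePhiGammaModule (phiLS O k) (gammaLS k hπ) D}
    {P : D → Prop} (h0 : P 0)
    (h : ∀ (a : LaurentSeries k) (x : D), P (a • S.phi x)) (hadd : ∀ x y, P x → P y → P (x + y))
    (x : D) : P x := by
  obtain ⟨t, rfl⟩ := S.bijective.2 x
  induction t with
  | zero => rw [map_zero]; exact h0
  | tmul a x => exact h a.val x
  | add t t' ht ht' => rw [map_add]; exact hadd _ _ ht ht'

theorem psi_eq_of_forall (Ψ : D →+ D)
    (h : ∀ (a : LaurentSeries k) (x : D), Ψ (a • S.phi x) = ψ.toHom a • x) (x : D) :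
    psi ψ S x = Ψ x := by
  induction x using EtalePhiGammaModule.induction (S := S) with
  | h0 => rw [map_zero, map_zero]
  | h a x => rw [psi_smul_phi, h]
  | hadd x y hx hy => rw [map_add, map_add, hx, hy]

theorem psi_phi_smul (a : LaurentSeries k) (x : D) :
    psi ψ S (phiLS O k a • x) = a • psi ψ S x := by
  induction x using EtalePhiGammaModule.induction (S := S) with
  | h0 => rw [smul_zero, map_zero, smul_zero]
  | h b x => rw [smul_smul, psi_smul_phi, psi_smul_phi, ψ.map_phi_mul, smul_smul]
  | hadd x y hx hy => rw [smul_add, map_add, map_add, hx, hy, smul_add]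

variable [Module k⟦X⟧ D] [IsScalarTower k⟦X⟧ (LaurentSeries k) D]

theorem IsLattice.exists_pow_smul_mem {E : Submodule k⟦X⟧ D} (hE : IsLattice E) (x : D) :
    ∃ N : ℕ, (X ^ N : k⟦X⟧) • x ∈ E := by
  have hx : x ∈ Submodule.span (LaurentSeries k) (E : Set D) := hE.2 ▸ Submodule.mem_top
  induction hx using Submodule.span_induction with
  | mem x hx => exact ⟨0, E.smul_mem _ hx⟩
  | zero => exact ⟨0, by rw [smul_zero]; exact E.zero_mem⟩
  | add x y _ _ hx hy =>
    obtain ⟨N, hN⟩ := hx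
    obtain ⟨N', hN'⟩ := hy
    refine ⟨N + N', ?_⟩
    rw [smul_add]
    refine E.add_mem ?_ ?_
    · rw [pow_add, mul_comm, mul_smul]; exact E.smul_mem _ hN
    · rw [pow_add, mul_smul]; exact E.smul_mem _ hN'
  | smul a x _ hx =>
    obtain ⟨N, hN⟩ := hx
    obtain ⟨M, hM⟩ := exists_vanishBelow a
    obtain ⟨f, hf⟩ := vanishBelow_iff.1 hM
    refine ⟨M + N, ?_⟩
    have e : (X ^ (M + N) : k⟦X⟧) • a • x = f • (X ^ N : k⟦X⟧) • x := by
      rw [← algebraMap_smul (LaurentSeries k) (X ^ (M + N) : k⟦X⟧) (a • x),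
        ← algebraMap_smul (LaurentSeries k) f ((X ^ N : k⟦X⟧) • x),
        ← algebraMap_smul (LaurentSeries k) (X ^ N : k⟦X⟧) x, smul_smul, smul_smul, hf, pow_add,
        map_mul, algebraMap_X_pow, algebraMap_X_pow]
      congr 1
      calc _ = tpow k M * tpow k (-M) * (algebraMap k⟦X⟧ (LaurentSeries k) f * tpow k N) := by ring
        _ = _ := by rw [tpow_mul_neg, one_mul]
    rw [e]
    exact E.smul_mem _ hN

omit [IsScalarTower k⟦X⟧ (LaurentSeries k) D] in
theorem psi_iterate_mem {E : Submodule k⟦X⟧ D} (h : ∀ x ∈ E, psi ψ S x ∈ E) {x : D} (hx : x ∈ E)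
    (n : ℕ) : (psi ψ S)^[n] x ∈ E := by
  induction n with
  | zero => exact hx
  | succ n ih => rw [Function.iterate_succ_apply']; exact h _ ih

theorem psi_C_smul (c : k) (x : D) : psi ψ S ((C c : k⟦X⟧) • x) = (C c : k⟦X⟧) • psi ψ S x := by
  rw [← algebraMap_smul (LaurentSeries k) (C c : k⟦X⟧) x,
    ← algebraMap_smul (LaurentSeries k) (C c : k⟦X⟧) (psi ψ S x), ← psi_phi_smul,
    phiLS_algebraMap]
  congr 3
  exact (AlgHom.commutes (phiPS O k) c).symm

theorem psi_iterate_C_smul (c : k) (x : D) (n : ℕ) :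
    (psi ψ S)^[n] ((C c : k⟦X⟧) • x) = (C c : k⟦X⟧) • (psi ψ S)^[n] x := by
  induction n with
  | zero => rfl
  | succ n ih => rw [Function.iterate_succ_apply', Function.iterate_succ_apply', ih, psi_C_smul]

variable {ψ S}

/-- One power of ψ carries all of E into E', because E is finitely generated. As ψ maps E onto E, it
follows that E = ψ^n(E) ⊆ E'. By symmetry D^♯ is unique, so the choice in `sharp` is harmless. -/
theorem IsSharp.le {E E' : Submodule k⟦X⟧ D} (hE : IsSharp ψ S E) (hE' : IsSharp ψ S E') :
    E ≤ E' := by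
  have hst : ∀ x ∈ E', psi ψ S x ∈ E' := fun x hx => by
    have : psi ψ S x ∈ psi ψ S '' (E' : Set D) := ⟨x, hx, rfl⟩
    rwa [hE'.2.1] at this
  obtain ⟨G, hG⟩ := hE.1.1
  choose N hN using hE'.1.exists_pow_smul_mem
  set M := G.sup N with hM
  have hMG : ∀ g ∈ G, (X ^ M : k⟦X⟧) • g ∈ E' := fun g hg => by
    have hle : N g ≤ M := Finset.le_sup (f := N) hg
    rw [← Nat.sub_add_cancel hle, pow_add, mul_smul]
    exact E'.smul_mem _ (hN g)
  choose r hr using hE'.2.2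
  -- Since t^M E ⊆ E', only the finitely many vectors t^j g with g a generator and j < M have to be
  -- brought into E'. Scalars from k commute with ψ.
  set n := (G ×ˢ Finset.range M).sup fun p => r ((X ^ p.2 : k⟦X⟧) • p.1) with hn
  have hmono : ∀ x m, r x ≤ m → (psi ψ S)^[m] x ∈ E' := fun x m hm => by
    rw [← Nat.sub_add_cancel hm, Function.iterate_add_apply]
    exact psi_iterate_mem ψ S hst (hr x) _
  have hiter : ∀ x ∈ E, (psi ψ S)^[n] x ∈ E' := by
    intro x hx
    rw [← hG, Submodule.mem_span_finset] at hx
    obtain ⟨f, -, rfl⟩ := hx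
    obtain ⟨P, hP⟩ : ∃ P : D →+ D, ∀ x, P x = (psi ψ S)^[n] x :=
      ⟨(show AddMonoid.End D from psi ψ S) ^ n, fun x =>
        congrFun (AddMonoid.End.coe_pow D (psi ψ S) n) x⟩
    rw [← hP, map_sum]
    refine E'.sum_mem fun g hg => ?_
    rw [eq_X_pow_mul_shift_add_trunc M (f g), add_smul, map_add]
    refine E'.add_mem ?_ ?_
    · rw [hP, mul_comm, mul_smul]
      exact psi_iterate_mem ψ S hst (E'.smul_mem _ (hMG g hg)) _
    · have e : ((trunc M (f g) : Polynomial k) : k⟦X⟧) =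
          ∑ j ∈ Finset.range M, C (coeff j (f g)) * X ^ j := by
        ext m
        rw [Polynomial.coeff_coe, coeff_trunc, map_sum]
        simp [coeff_X_pow]
      rw [e, Finset.sum_smul, map_sum]
      refine E'.sum_mem fun j hj => ?_
      rw [mul_smul, hP, psi_iterate_C_smul]
      refine E'.smul_mem _ (hmono _ _ ?_)
      exact Finset.le_sup (f := fun p : D × ℕ => r ((X ^ p.2 : k⟦X⟧) • p.1))
        (Finset.mem_product.2 ⟨hg, hj⟩ : (g, j) ∈ G ×ˢ Finset.range M)
  have hsurj : ∀ m, ∀ x ∈ E, ∃ y ∈ E, (psi ψ S)^[m] y = x := by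
    intro m
    induction m with
    | zero => exact fun x hx => ⟨x, hx, rfl⟩
    | succ m ih =>
      intro x hx
      obtain ⟨y, hy, rfl⟩ := ih x hx
      have : y ∈ psi ψ S '' (E : Set D) := by rw [hE.2.1]; exact hy
      obtain ⟨z, hz, rfl⟩ := this
      exact ⟨z, hz, by rw [Function.iterate_succ_apply]⟩
  intro x hx
  obtain ⟨y, hy, rfl⟩ := hsurj n x hx
  exact hiter y hy

theorem IsSharp.sharp_eq {E : Submodule k⟦X⟧ D} (hE : IsSharp ψ S E) : sharp ψ S = E := by
  have h : IsSharp ψ S (sharp ψ S) := Classical.epsilon_spec ⟨E, hE⟩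
  exact le_antisymm (h.le hE) (hE.le h)

theorem natural_eq_sharp {E : Submodule k⟦X⟧ D} (hE : IsSharp ψ S E)
    (h : ∀ E' : Submodule k⟦X⟧ D, IsLattice E' → E' ≤ E → (∀ x ∈ E', psi ψ S x ∈ E') → E ≤ E') :
    sharp ψ S = natural ψ S := by
  rw [natural, hE.sharp_eq]
  refine le_antisymm (le_sInf fun E' hE' => h E' hE'.1 hE'.2.1 hE'.2.2) (sInf_le ⟨hE.1, le_rfl, ?_⟩)
  intro x hx
  have : psi ψ S x ∈ psi ψ S '' (E : Set D) := ⟨x, hx, rfl⟩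
  rwa [hE.2.1] at this

end Psi

end PhiGamma

namespace PhiGamma

/-! ### Nondegeneracy of ψ. -/

section PsiNondegenerate
open IsLocalRing TensorProduct
variable {O : Type*} [CommRing O] [IsDomain O] [IsDiscreteValuationRing O]
  [Finite (ResidueField O)] {k : Type*} [Field k] [Algebra (ResidueField O) k]
  {π : O} {hπ : Irreducible π} {ψ : PsiOperator k hπ}
  {D : Type*} [AddCommGroup D] [Module (LaurentSeries k) D]
  {D' : Type*} [AddCommGroup D'] [Module (LaurentSeries k) D']

theorem PsiOperator.eq_zero_of_forall {z : LaurentSeries k} (h : ∀ b, ψ.toHom (b * z) = 0) :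
    z = 0 := by
  obtain ⟨c, hc, hψ⟩ := ψ.exists_eq_kap
  have : c * z = 0 := eq_zero_of_kap_mul O fun b => by
    rw [mul_left_comm, ← hψ, h]
  exact (mul_eq_zero.1 this).resolve_left hc

/-- If y = Σ a_i φ(b_i) for a basis b, then ψ(ry) = Σ ψ(r a_i) b_i, and the claim reduces to k((t)).
It allows identities involving φ to be verified after applying ψ. -/
theorem eq_zero_of_psi_smul (S : EtalePhiGammaModule (phiLS O k) (gammaLS k hπ) D) {y : D}
    (h : ∀ b : LaurentSeries k, psi ψ S (b • y) = 0) : y = 0 := by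
  have := S.finite
  let b := Module.finBasis (LaurentSeries k) D
  obtain ⟨t, rfl⟩ := S.bijective.2 y
  obtain ⟨a, rfl⟩ := exists_sum_tmul_basis b t
  have e : ∀ r : LaurentSeries k, r • linearization S.phi
      (∑ i, Twist.of (phiLS O k) (a i) ⊗ₜ[LaurentSeries k] b i) =
      ∑ i, (r * a i) • S.phi (b i) := fun r => by
    rw [map_sum, Finset.smul_sum]
    exact Finset.sum_congr rfl fun i _ => by rw [linearization_tmul, smul_smul]
  have ha : ∀ i, a i = 0 := fun i => by
    refine PsiOperator.eq_zero_of_forall (ψ := ψ) fun r => ?_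
    have h1 := h r
    rw [e, map_sum] at h1
    simp only [psi_smul_phi] at h1
    exact Fintype.linearIndependent_iff.1 b.linearIndependent _ h1 i
  have h1 := e 1
  rw [one_smul] at h1
  rw [h1]
  exact Finset.sum_eq_zero fun i _ => by rw [ha, mul_zero, zero_smul]

/-- A linear map commuting with `ψ` commutes with `φ`. -/
theorem map_phi_of_map_psi (S : EtalePhiGammaModule (phiLS O k) (gammaLS k hπ) D)
    (S' : EtalePhiGammaModule (phiLS O k) (gammaLS k hπ) D') (f : D →ₗ[LaurentSeries k] D')
    (h : ∀ x, f (psi ψ S x) = psi ψ S' (f x)) (x : D) : f (S.phi x) = S'.phi (f x) := by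
  rw [← sub_eq_zero]
  refine eq_zero_of_psi_smul (ψ := ψ) S' fun b => ?_
  rw [smul_sub, map_sub, psi_smul_phi, ← map_smul, ← h, psi_smul_phi, map_smul, sub_self]

end PsiNondegenerate

/-! ### Duals, their localization and exactness. -/

section LocDualBasics
open IsLocalRing TensorProduct
variable {k : Type*} [Field k] {Δ : Type*} [AddCommGroup Δ] [Module k Δ] [Module k⟦X⟧ Δ]
  [IsScalarTower k k⟦X⟧ Δ]
  {Δ' : Type*} [AddCommGroup Δ'] [Module k Δ'] [Module k⟦X⟧ Δ'] [IsScalarTower k k⟦X⟧ Δ']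
  {Δ'' : Type*} [AddCommGroup Δ''] [Module k Δ''] [Module k⟦X⟧ Δ''] [IsScalarTower k k⟦X⟧ Δ'']

omit [Module k⟦X⟧ Δ] [IsScalarTower k k⟦X⟧ Δ] in
theorem DualMod.ext {l l' : DualMod k Δ} (h : ∀ x, l.toLin x = l'.toLin x) : l = l' :=
  LinearMap.ext h

theorem DualMod.toLin_smul (f : k⟦X⟧) (l : DualMod k Δ) (x : Δ) :
    (f • l).toLin x = l.toLin (f • x) := rfl

theorem transpose_toLin {σ : k⟦X⟧ →ₐ[k] k⟦X⟧} (h : Δ →ₛₗ[(σ : k⟦X⟧ →+* k⟦X⟧)] Δ')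
    (l : DualMod k Δ') (x : Δ) : (transpose h l).toLin x = l.toLin (h x) := rfl

theorem transpose_add {σ : k⟦X⟧ →ₐ[k] k⟦X⟧} (h : Δ →ₛₗ[(σ : k⟦X⟧ →+* k⟦X⟧)] Δ')
    (l l' : DualMod k Δ') : transpose h (l + l') = transpose h l + transpose h l' := rfl

variable (k Δ) in
/-- The map `Δ^* → Δ^* ⊗ k((t))`. -/
noncomputable def locMk : DualMod k Δ →ₗ[k⟦X⟧] LocDual k Δ :=
  TensorProduct.mk k⟦X⟧ (LaurentSeries k) (DualMod k Δ) 1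

theorem locMk_apply (l : DualMod k Δ) : locMk k Δ l = (1 : LaurentSeries k) ⊗ₜ[k⟦X⟧] l := rfl

theorem tpow_smul_locMk (n : ℕ) (l : DualMod k Δ) :
    tpow k n • locMk k Δ l = locMk k Δ ((X ^ n : k⟦X⟧) • l) := by
  rw [← algebraMap_X_pow, map_smul, algebraMap_smul]

theorem LocDual.exists_eq (x : LocDual k Δ) :
    ∃ (n : ℕ) (l : DualMod k Δ), x = tpow k (-n) • locMk k Δ l := by
  induction x using TensorProduct.induction_on with
  | zero => exact ⟨0, 0, by rw [map_zero, smul_zero]⟩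
  | tmul a l =>
    obtain ⟨N, hN⟩ := exists_vanishBelow a
    obtain ⟨f, rfl⟩ := vanishBelow_iff.1 hN
    refine ⟨N, f • l, ?_⟩
    rw [map_smul, ← algebraMap_smul (LaurentSeries k) f (locMk k Δ l), smul_smul, locMk_apply,
      TensorProduct.smul_tmul', smul_eq_mul, mul_one]
  | add x y hx hy =>
    obtain ⟨n, l, rfl⟩ := hx
    obtain ⟨n', l', rfl⟩ := hy
    refine ⟨n + n', (X ^ n' : k⟦X⟧) • l + (X ^ n : k⟦X⟧) • l', ?_⟩
    rw [map_add, ← tpow_smul_locMk, ← tpow_smul_locMk, smul_add, smul_smul, smul_smul, ← tpow_add,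
      ← tpow_add]
    congr 3 <;> · push_cast; ring

/-- From t^(-n) = φ(t^(-n)) t^((q-1)n), denominators can be taken in φ(k((t))), where ψ is
semilinear. So ψ on D is controlled by its values on Δ^*. -/
theorem LocDual.exists_eq_phi (O : Type*) [CommRing O] [IsDomain O] [IsDiscreteValuationRing O]
    [Finite (ResidueField O)] (x : LocDual k Δ) :
    ∃ (a : LaurentSeries k) (l : DualMod k Δ), x = phiLS O k a • locMk k Δ l := by
  obtain ⟨n, l, rfl⟩ := LocDual.exists_eq x
  refine ⟨tpow k (-n), (X ^ ((resCard O - 1) * n) : k⟦X⟧) • l, ?_⟩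
  have : 2 ≤ resCard O := two_le_card (O := O)
  rw [← tpow_smul_locMk, smul_smul, phiLS_tpow, ← tpow_add]
  congr 2
  push_cast [Nat.cast_sub (by omega : 1 ≤ resCard O)]
  ring

variable (k Δ) in
/-- The image of `Δ^*` in `Δ^* ⊗ k((t))`. -/
noncomputable def dualLattice : Submodule k⟦X⟧ (LocDual k Δ) := LinearMap.range (locMk k Δ)

theorem isLattice_dualLattice [Module.Finite k⟦X⟧ (DualMod k Δ)] :
    IsLattice (dualLattice k Δ) := by
  refine ⟨?_, eq_top_iff.2 fun x _ => ?_⟩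
  · rw [dualLattice, LinearMap.range_eq_map]
    exact (Module.Finite.fg_top).map _
  · obtain ⟨n, l, rfl⟩ := LocDual.exists_eq x
    exact Submodule.smul_mem _ _ (Submodule.subset_span ⟨l, rfl⟩)

theorem locDualMap_locMk (f : Δ →ₗ[k⟦X⟧] Δ') (l : DualMod k Δ') :
    locDualMap f (locMk k Δ' l) = locMk k Δ (dualMap f l) := rfl

theorem dualMap_toLin (f : Δ →ₗ[k⟦X⟧] Δ') (l : DualMod k Δ') (x : Δ) :
    (dualMap f l).toLin x = l.toLin (f x) := rfl

theorem dualMap_injective {f : Δ →ₗ[k⟦X⟧] Δ'} (hf : Function.Surjective f) :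
    Function.Injective (dualMap (k := k) f) := fun l l' h => DualMod.ext fun x => by
  obtain ⟨y, rfl⟩ := hf x
  rw [← dualMap_toLin, h, dualMap_toLin]

theorem exists_toLin_comp {V W : Type*} [AddCommGroup V] [Module k V] [AddCommGroup W] [Module k W]
    (g : V →ₗ[k] W) (hg : Function.Injective g) (l : V →ₗ[k] k) :
    ∃ l' : W →ₗ[k] k, l' ∘ₗ g = l := by
  obtain ⟨r, hr⟩ := g.exists_leftInverse_of_injective (LinearMap.ker_eq_bot.2 hg)
  exact ⟨l ∘ₗ r, by rw [LinearMap.comp_assoc, hr, LinearMap.comp_id]⟩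

theorem dualMap_surjective {f : Δ →ₗ[k⟦X⟧] Δ'} (hf : Function.Injective f) :
    Function.Surjective (dualMap (k := k) f) := fun l =>
  exists_toLin_comp (f.restrictScalars k) hf l.toLin

theorem dualMap_exact {f : Δ →ₗ[k⟦X⟧] Δ'} {g : Δ' →ₗ[k⟦X⟧] Δ''} (h : Function.Exact f g)
    (hg : Function.Surjective g) :
    Function.Exact (dualMap (k := k) g) (dualMap (k := k) f) := by
  intro l
  constructor
  · intro hl
    have hker : LinearMap.ker (g.restrictScalars k) ≤ LinearMap.ker l.toLin := by
      intro y hy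
      obtain ⟨x, rfl⟩ := (h y).1 hy
      change l.toLin (f x) = 0
      rw [← dualMap_toLin, hl]
      rfl
    let e := (g.restrictScalars k).quotKerEquivOfSurjective hg
    refine ⟨((LinearMap.ker (g.restrictScalars k)).liftQ l.toLin hker) ∘ₗ e.symm.toLinearMap,
      DualMod.ext fun y => ?_⟩
    change (LinearMap.ker (g.restrictScalars k)).liftQ l.toLin hker (e.symm (g y)) = l.toLin y
    have : e.symm (g y) = (LinearMap.ker (g.restrictScalars k)).mkQ y := by
      rw [LinearEquiv.symm_apply_eq]
      rfl
    rw [this, Submodule.mkQ_apply, Submodule.liftQ_apply]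
  · rintro ⟨l', rfl⟩
    refine DualMod.ext fun x => ?_
    rw [dualMap_toLin, dualMap_toLin, h.apply_apply_eq_zero, map_zero]
    rfl

instance flat_laurentSeries : Module.Flat k⟦X⟧ (LaurentSeries k) :=
  IsLocalization.flat _ (Submonoid.powers (X : k⟦X⟧))

theorem locDualMap_injective {f : Δ →ₗ[k⟦X⟧] Δ'} (hf : Function.Surjective f) :
    Function.Injective (locDualMap (k := k) f) :=
  Module.Flat.lTensor_preserves_injective_linearMap (M := LaurentSeries k) _
    (dualMap_injective (k := k) hf)

theorem locDualMap_surjective {f : Δ →ₗ[k⟦X⟧] Δ'} (hf : Function.Injective f) :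
    Function.Surjective (locDualMap (k := k) f) :=
  LinearMap.lTensor_surjective (LaurentSeries k) (dualMap_surjective (k := k) hf)

theorem locDualMap_exact {f : Δ →ₗ[k⟦X⟧] Δ'} {g : Δ' →ₗ[k⟦X⟧] Δ''} (h : Function.Exact f g)
    (hf : Function.Injective f) (hg : Function.Surjective g) :
    Function.Exact (locDualMap (k := k) g) (locDualMap (k := k) f) :=
  lTensor_exact (LaurentSeries k) (dualMap_exact h hg) (dualMap_surjective hf)

end LocDualBasics

/-! ### Γ and ψ on localized duals. -/

section GammaOnDual
open IsLocalRing TensorProduct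
variable {k : Type*} [Field k] {O : Type*} [CommRing O] [IsDomain O] [IsDiscreteValuationRing O]
  [Finite (ResidueField O)] [Algebra (ResidueField O) k] {π : O} {hπ : Irreducible π}
  {Δ : Type*} [AddCommGroup Δ] [Module k Δ] [Module k⟦X⟧ Δ] [IsScalarTower k k⟦X⟧ Δ]
  {Δ' : Type*} [AddCommGroup Δ'] [Module k Δ'] [Module k⟦X⟧ Δ'] [IsScalarTower k k⟦X⟧ Δ']
  (T : TorsionPhiGamma k Δ hπ) (T' : TorsionPhiGamma k Δ' hπ)

theorem transpose_gamma_smul (γ : Oˣ) (f : k⟦X⟧) (l : DualMod k Δ) :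
    transpose (T.gamma γ⁻¹) (f • l) = gammaPS k hπ γ f • transpose (T.gamma γ⁻¹) l := by
  refine DualMod.ext fun x => ?_
  rw [transpose_toLin, DualMod.toLin_smul, DualMod.toLin_smul, transpose_toLin,
    map_smulₛₗ (T.gamma γ⁻¹)]
  congr 2
  rw [RingHom.coe_coe, ← gammaPS_mul, inv_mul_cancel, gammaPS_one]

/-- The action of `Γ` on `Δ^* ⊗ k((t))`. -/
noncomputable def locGamma (γ : Oˣ) : LocDual k Δ →ₛₗ[gammaLS k hπ γ] LocDual k Δ where
  toFun := TensorProduct.liftAddHom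
    (AddMonoidHom.mk' (fun a : LaurentSeries k => AddMonoidHom.mk'
      (fun l : DualMod k Δ => gammaLS k hπ γ a ⊗ₜ[k⟦X⟧] transpose (T.gamma γ⁻¹) l)
      (fun l l' => by rw [transpose_add, TensorProduct.tmul_add]))
      (fun a b => by
        ext l
        change gammaLS k hπ γ (a + b) ⊗ₜ[k⟦X⟧] _ = _ ⊗ₜ[k⟦X⟧] _ + _ ⊗ₜ[k⟦X⟧] _
        rw [map_add, TensorProduct.add_tmul]))
    (fun f a l => by
      change gammaLS k hπ γ (f • a) ⊗ₜ[k⟦X⟧] transpose (T.gamma γ⁻¹) l =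
        gammaLS k hπ γ a ⊗ₜ[k⟦X⟧] transpose (T.gamma γ⁻¹) (f • l)
      rw [transpose_gamma_smul, TensorProduct.tmul_smul, TensorProduct.smul_tmul',
        Algebra.smul_def, Algebra.smul_def, map_mul, gammaLS_algebraMap])
  map_add' := map_add _
  map_smul' a x := by
    induction x using TensorProduct.induction_on with
    | zero => simp only [smul_zero, map_zero]
    | tmul b l =>
      change gammaLS k hπ γ (a * b) ⊗ₜ[k⟦X⟧] transpose (T.gamma γ⁻¹) l =
        gammaLS k hπ γ a • (gammaLS k hπ γ b ⊗ₜ[k⟦X⟧] transpose (T.gamma γ⁻¹) l)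
      rw [map_mul, TensorProduct.smul_tmul', smul_eq_mul]
    | add x y hx hy => simp only [smul_add, map_add, hx, hy]

theorem locGamma_locMk (γ : Oˣ) (l : DualMod k Δ) :
    locGamma T γ (locMk k Δ l) = locMk k Δ (transpose (T.gamma γ⁻¹) l) := by
  change gammaLS k hπ γ 1 ⊗ₜ[k⟦X⟧] _ = _
  rw [map_one]; rfl

variable {T T'} {ψ : PsiOperator k hπ}
  {S : EtalePhiGammaModule (phiLS O k) (gammaLS k hπ) (LocDual k Δ)}
  {S' : EtalePhiGammaModule (phiLS O k) (gammaLS k hπ) (LocDual k Δ')}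

theorem IsAttached.psi_locMk (h : IsAttached ψ T S) (l : DualMod k Δ) :
    psi ψ S (locMk k Δ l) = locMk k Δ (transpose T.phi l) := h.2 l

theorem IsAttached.gamma_locMk (h : IsAttached ψ T S) (γ : Oˣ) (l : DualMod k Δ) :
    S.gamma γ (locMk k Δ l) = locMk k Δ (transpose (T.gamma γ⁻¹) l) := h.1 γ l

/-- `IsAttached` prescribes ψ and not φ on Δ^*. Compatibility with ψ is checked on elements φ(a)ℓ,
and compatibility with φ then follows from nondegeneracy. -/
theorem IsAttached.isEquivariant (h : IsAttached ψ T S) (h' : IsAttached ψ T' S')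
    {f : Δ →ₗ[k⟦X⟧] Δ'} (hf : T.IsEquivariant T' f) :
    S'.IsEquivariant S.toPhiGammaModule (locDualMap f) := by
  constructor
  · refine map_phi_of_map_psi (ψ := ψ) S' S _ fun x => ?_
    obtain ⟨a, l, rfl⟩ := LocDual.exists_eq_phi O x
    rw [psi_phi_smul, map_smul, map_smul, psi_phi_smul, h'.psi_locMk, locDualMap_locMk,
      locDualMap_locMk, h.psi_locMk]
    congr 2
    refine DualMod.ext fun x => ?_
    rw [dualMap_toLin, transpose_toLin, transpose_toLin, dualMap_toLin, hf.1]
  · intro γ x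
    obtain ⟨n, l, rfl⟩ := LocDual.exists_eq x
    rw [map_smulₛₗ, map_smul, map_smul, map_smulₛₗ, h'.gamma_locMk, locDualMap_locMk,
      locDualMap_locMk, h.gamma_locMk]
    congr 2
    refine DualMod.ext fun x => ?_
    rw [dualMap_toLin, transpose_toLin, transpose_toLin, dualMap_toLin, hf.2]

/-- Over the field k the transpose of an injective map is surjective. It applies to Δ, while on Δ₂
the map φ kills ẽ. -/
theorem IsAttached.psi_image_dualLattice (h : IsAttached ψ T S)
    (hφ : Function.Injective T.phi) :
    psi ψ S '' (dualLattice k Δ : Set (LocDual k Δ)) = dualLattice k Δ := by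
  ext x
  constructor
  · rintro ⟨_, ⟨l, rfl⟩, rfl⟩
    exact ⟨_, (h.psi_locMk l).symm⟩
  · rintro ⟨l, rfl⟩
    let φk : Δ →ₗ[k] Δ :=
      { toFun := T.phi
        map_add' := map_add _
        map_smul' := fun c x => by
          rw [← algebraMap_smul k⟦X⟧ c x, map_smulₛₗ, RingHom.coe_coe, AlgHom.commutes,
            algebraMap_smul, RingHom.id_apply] }
    obtain ⟨l', rfl⟩ : ∃ l' : DualMod k Δ, transpose T.phi l' = l :=
      exists_toLin_comp φk hφ l.toLin
    exact ⟨locMk k Δ l', ⟨l', rfl⟩, h.psi_locMk l'⟩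

end GammaOnDual

end PhiGamma

namespace PhiGamma

/-! ### Semilinear operators and lattices in spaces of vectors of Laurent series. -/

section Vectors
open IsLocalRing Matrix
variable (O : Type*) [CommRing O] [IsDomain O] [IsDiscreteValuationRing O]
  [Finite (ResidueField O)] {k : Type*} [Field k] {ι : Type*} [Fintype ι]

/-- The `φ`-semilinear endomorphism of `k((t)) ^ ι` with matrix `A`. -/
noncomputable def phiVec (A : Matrix ι ι (LaurentSeries k)) :
    (ι → LaurentSeries k) →ₛₗ[phiLS O k] (ι → LaurentSeries k) where
  toFun u := A *ᵥ fun j => phiLS O k (u j)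
  map_add' u v := by
    rw [← Matrix.mulVec_add]
    congr 1
    ext1 j
    simp
  map_smul' c u := by
    rw [← Matrix.mulVec_smul]
    congr 1
    ext1 j
    simp

theorem phiVec_apply (A : Matrix ι ι (LaurentSeries k)) (u : ι → LaurentSeries k) (i : ι) :
    phiVec O A u i = ∑ j, A i j * phiLS O k (u j) := rfl

theorem phiVec_smul (A : Matrix ι ι (LaurentSeries k)) (f : k⟦X⟧) (u : ι → LaurentSeries k) :
    phiVec O A (f • u) = phiPS O k f • phiVec O A u := by
  rw [← algebraMap_smul (LaurentSeries k) f u, map_smulₛₗ, phiLS_algebraMap, algebraMap_smul]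

/-- The operator `ψ` adjoint to `phiVec A`. -/
noncomputable def psiVec (A : Matrix ι ι (LaurentSeries k)) :
    (ι → LaurentSeries k) →+ (ι → LaurentSeries k) where
  toFun g j := kap O ((Aᵀ *ᵥ g) j)
  map_zero' := by ext1 j; simp
  map_add' g h := by ext1 j; simp [Matrix.mulVec_add]

theorem psiVec_apply (A : Matrix ι ι (LaurentSeries k)) (g : ι → LaurentSeries k) (j : ι) :
    psiVec O A g j = kap O (∑ i, A i j * g i) := rfl

theorem psiVec_phi_smul (A : Matrix ι ι (LaurentSeries k)) (a : LaurentSeries k)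
    (g : ι → LaurentSeries k) : psiVec O A (phiLS O k a • g) = a • psiVec O A g := by
  ext1 j
  rw [psiVec_apply, Pi.smul_apply, psiVec_apply, smul_eq_mul, ← kap_phi_mul, Finset.mul_sum]
  congr 1
  refine Finset.sum_congr rfl fun i _ => ?_
  rw [Pi.smul_apply, smul_eq_mul, mul_left_comm]

/-- The constant coefficient of the scalar product. -/
noncomputable def pairing (g u : ι → LaurentSeries k) : k := (∑ i, g i * u i).coeff 0

theorem pairing_add_right (g u v : ι → LaurentSeries k) :
    pairing g (u + v) = pairing g u + pairing g v := by
  simp only [pairing, Pi.add_apply, mul_add, Finset.sum_add_distrib, HahnSeries.coeff_add]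

theorem pairing_smul (f : k⟦X⟧) (g u : ι → LaurentSeries k) :
    pairing g (f • u) = pairing (f • g) u := by
  simp only [pairing, Pi.smul_apply, mul_smul_comm, smul_mul_assoc]

theorem pairing_C_smul (c : k) (g u : ι → LaurentSeries k) :
    pairing g ((C c : k⟦X⟧) • u) = c * pairing g u := by
  have : ∀ y : LaurentSeries k, (C c : k⟦X⟧) • y = HahnSeries.C c * y := fun y => by
    rw [Algebra.smul_def, LaurentSeries.coe_algebraMap, PowerSeries.coe_C]
  have e : ∑ i, g i * ((C c : k⟦X⟧) • u) i = HahnSeries.C c * ∑ i, g i * u i := by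
    rw [Finset.mul_sum]
    exact Finset.sum_congr rfl fun i _ => by rw [Pi.smul_apply, this]; ring
  rw [pairing, pairing, e, HahnSeries.C_mul_eq_smul, HahnSeries.coeff_smul, smul_eq_mul]

theorem pairing_phiVec (A : Matrix ι ι (LaurentSeries k)) (g u : ι → LaurentSeries k) :
    pairing g (phiVec O A u) = pairing (psiVec O A g) u := by
  simp only [pairing, phiVec_apply, psiVec_apply, Finset.mul_sum]
  rw [Finset.sum_comm, HahnSeries.coeff_sum, HahnSeries.coeff_sum]
  refine Finset.sum_congr rfl fun j _ => ?_
  rw [← coeff_zero_mul_phi, Finset.sum_mul]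
  congr 1
  exact Finset.sum_congr rfl fun i _ => by ring

theorem pairing_single [DecidableEq ι] (g : ι → LaurentSeries k) (i : ι) (y : LaurentSeries k) :
    pairing g (Pi.single i y) = (g i * y).coeff 0 := by
  rw [pairing, Finset.sum_eq_single i]
  · rw [Pi.single_eq_same]
  · intro j _ hj
    rw [Pi.single_eq_of_ne hj, mul_zero]
  · intro h; exact absurd (Finset.mem_univ i) h

theorem eq_of_pairing {g g' : ι → LaurentSeries k} (h : ∀ u, pairing g u = pairing g' u) :
    g = g' := by
  classical
  ext i n
  have := h (Pi.single i (tpow k (-n)))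
  rw [pairing_single, pairing_single, mul_comm, coeff_tpow_mul, mul_comm, coeff_tpow_mul] at this
  simpa using this

/-- The vectors whose `i`-th entry lies in `t ^ (m i) k[[t]]`. -/
def vecLattice (k : Type*) [Field k] (m : ι → ℤ) : Submodule k⟦X⟧ (ι → LaurentSeries k) where
  carrier := {u | ∀ i, VanishBelow (m i) (u i)}
  add_mem' hu hv i := (hu i).add (hv i)
  zero_mem' i := vanishBelow_zero (m i)
  smul_mem' f u hu i := by
    rw [Pi.smul_apply, Algebra.smul_def, ← zero_add (m i)]
    exact (vanishBelow_algebraMap f).mul (hu i)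

/-- Every product g_i u_i starts in degree at least 1. This is the reason for the exponents 1 - m_i
of the dual lattice. -/
theorem pairing_eq_zero {m : ι → ℤ} {g u : ι → LaurentSeries k}
    (hg : g ∈ vecLattice k fun i => 1 - m i) (hu : u ∈ vecLattice k m) : pairing g u = 0 := by
  rw [pairing, HahnSeries.coeff_sum]
  refine Finset.sum_eq_zero fun i _ => ((hg i).mul (hu i)) 0 (by dsimp only; omega)

theorem vecLattice_fg (m : ι → ℤ) : (vecLattice k m).FG := by
  let f : (ι → k⟦X⟧) →ₗ[k⟦X⟧] (ι → LaurentSeries k) :=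
    { toFun := fun u i => tpow k (m i) * algebraMap k⟦X⟧ (LaurentSeries k) (u i)
      map_add' := fun u v => by ext1 i; simp [mul_add]
      map_smul' := fun c u => by
        ext1 i
        change tpow k (m i) * algebraMap k⟦X⟧ (LaurentSeries k) (c * u i) = c • (tpow k (m i) * _)
        rw [Algebra.smul_def, map_mul]
        ring }
  have : vecLattice k m = LinearMap.range f := by
    ext u
    constructor
    · intro hu
      choose v hv using fun i => vanishBelow_iff.1 (hu i)
      exact ⟨v, funext fun i => (hv i).symm⟩
    · rintro ⟨v, rfl⟩ i
      exact vanishBelow_iff.2 ⟨v i, rfl⟩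
  rw [this, LinearMap.range_eq_map]
  exact (Module.Finite.fg_top).map f

theorem exists_pow_smul_mem_vecLattice (m : ι → ℤ) (u : ι → LaurentSeries k) :
    ∃ N : ℕ, (X ^ N : k⟦X⟧) • u ∈ vecLattice k m := by
  choose N hN using fun i => exists_vanishBelow (u i)
  refine ⟨Finset.univ.sup fun i => N i + (m i).natAbs, fun i => ?_⟩
  rw [Pi.smul_apply, Algebra.smul_def, algebraMap_X_pow, vanishBelow_tpow_mul]
  refine (hN i).mono ?_
  have := Finset.le_sup (f := fun i => N i + (m i).natAbs) (Finset.mem_univ i)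
  omega

end Vectors

/-! ### The étale module attached to a uniformized torsion module. -/

section Model
open IsLocalRing TensorProduct Matrix
variable {O : Type*} [CommRing O] [IsDomain O] [IsDiscreteValuationRing O]
  [Finite (ResidueField O)] {k : Type*} [Field k] [Algebra (ResidueField O) k]
  {π : O} {hπ : Irreducible π}
  {Δ : Type*} [AddCommGroup Δ] [Module k Δ] [Module k⟦X⟧ Δ] [IsScalarTower k k⟦X⟧ Δ]
  {ι : Type*} [Fintype ι]

/-- A presentation of the `k[[t]]`-module `Δ` as the quotient of `k((t)) ^ ι` by the lattice
`vecLattice m`. -/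
structure Uniformization (Δ : Type*) [AddCommGroup Δ] [Module k⟦X⟧ Δ] (m : ι → ℤ) where
  map : (ι → LaurentSeries k) →ₗ[k⟦X⟧] Δ
  surjective : Function.Surjective map
  map_eq_zero_iff : ∀ u, map u = 0 ↔ u ∈ vecLattice k m

variable {m : ι → ℤ} (θ : Uniformization (k := k) Δ m)

omit [IsScalarTower k k⟦X⟧ Δ] [Fintype ι] in
open Classical in
-- The n-th coefficient will be the value of the form on t^(-n) in position i, and this vector lies
-- in the lattice once -n ≥ m_i.
theorem Uniformization.vec_bdd (l : DualMod k Δ) (i : ι) : BddBelow (Function.support fun n : ℤ =>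
    l.toLin (θ.map (Pi.single i (tpow k (-n))))) := by
  refine ⟨1 - m i, fun n hn => le_of_not_gt fun h => hn ?_⟩
  have : θ.map (Pi.single i (tpow k (-n))) = 0 := by
    rw [θ.map_eq_zero_iff]
    intro j
    by_cases hj : j = i
    · subst hj
      rw [Pi.single_eq_same]
      exact (vanishBelow_tpow _).mono (by omega)
    · rw [Pi.single_eq_of_ne hj]
      exact vanishBelow_zero _
  simp only [this, map_zero]

open Classical in
/-- The vector of Laurent series attached to a linear form on `Δ`. -/
noncomputable def Uniformization.vecFun (l : DualMod k Δ) (i : ι) : LaurentSeries k :=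
  HahnSeries.ofSuppBddBelow _ (θ.vec_bdd l i)

omit [IsScalarTower k k⟦X⟧ Δ] [Fintype ι] in
open Classical in
theorem Uniformization.coeff_vecFun (l : DualMod k Δ) (i : ι) (n : ℤ) :
    (θ.vecFun l i).coeff n = l.toLin (θ.map (Pi.single i (tpow k (-n)))) :=
  congrFun (HahnSeries.coeff_ofSuppBddBelow (hf := θ.vec_bdd l i)) n

omit [IsScalarTower k k⟦X⟧ Δ] [Fintype ι] in
theorem Uniformization.vecFun_mem (l : DualMod k Δ) :
    θ.vecFun l ∈ vecLattice k fun i => 1 - m i := by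
  classical
  intro i n hn
  dsimp only at hn
  rw [θ.coeff_vecFun]
  have : θ.map (Pi.single i (tpow k (-n))) = 0 := by
    rw [θ.map_eq_zero_iff]
    intro j
    by_cases hj : j = i
    · subst hj
      rw [Pi.single_eq_same]
      exact (vanishBelow_tpow _).mono (by omega)
    · rw [Pi.single_eq_of_ne hj]
      exact vanishBelow_zero _
  rw [this, map_zero]

theorem toLin_C_smul (l : DualMod k Δ) (c : k) (x : Δ) :
    l.toLin ((C c : k⟦X⟧) • x) = c * l.toLin x := by
  have : (C c : k⟦X⟧) • x = c • x := algebraMap_smul k⟦X⟧ c x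
  rw [this, map_smul, smul_eq_mul]

theorem Uniformization.toLin_map (l : DualMod k Δ) (u : ι → LaurentSeries k) :
    l.toLin (θ.map u) = pairing (θ.vecFun l) u := by
  classical
  -- Both sides vanish on the lattice, so modulo it only finitely many terms of y matter. They are
  -- removed one at a time, starting with the lowest, and on a monomial the formula holds by
  -- construction.
  have key : ∀ (i : ι) (N : ℕ) (y : LaurentSeries k), VanishBelow (m i - N) y →
      l.toLin (θ.map (Pi.single i y)) = pairing (θ.vecFun l) (Pi.single i y) := by
    intro i N
    induction N with
    | zero =>
      intro y hy
      have hmem : Pi.single i y ∈ vecLattice k m := by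
        intro j
        by_cases hj : j = i
        · subst hj
          rw [Pi.single_eq_same]
          simpa using hy
        · rw [Pi.single_eq_of_ne hj]
          exact vanishBelow_zero _
      rw [(θ.map_eq_zero_iff _).2 hmem, map_zero, pairing_eq_zero (θ.vecFun_mem l) hmem]
    | succ N ih =>
      intro y hy
      set d := m i - (N + 1 : ℕ) with hd
      set y' := y - (C (y.coeff d) : k⟦X⟧) • tpow k d with hy'
      have e : Pi.single i y = Pi.single i y' +
          (C (y.coeff d) : k⟦X⟧) • (Pi.single i (tpow k d) : ι → LaurentSeries k) := by
        rw [← Pi.single_smul, ← Pi.single_add, hy', sub_add_cancel]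
      have hC : ∀ c : k, (C c : k⟦X⟧) • tpow k d = HahnSeries.single d c := fun c => by
        rw [Algebra.smul_def, LaurentSeries.coe_algebraMap, PowerSeries.coe_C,
          HahnSeries.C_apply, tpow, HahnSeries.single_mul_single, zero_add, mul_one]
      have hv : VanishBelow (m i - N) y' := by
        intro n hn
        rw [hy', hC, HahnSeries.coeff_sub]
        rcases lt_or_ge n d with h | h
        · rw [hy n h, HahnSeries.coeff_single_of_ne h.ne, sub_zero]
        · obtain rfl : n = d := by omega
          rw [HahnSeries.coeff_single_same, sub_self]
      rw [e, map_add, map_add, pairing_add_right, ih y' hv, map_smul, toLin_C_smul, pairing_C_smul,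
        pairing_single _ i (tpow k d), mul_comm (θ.vecFun l i), coeff_tpow_mul, θ.coeff_vecFun]
      simp
  have hu : u = ∑ i, Pi.single i (u i) := (Finset.univ_sum_single u).symm
  have hp : ∀ s : Finset ι, pairing (θ.vecFun l) (∑ i ∈ s, Pi.single i (u i)) =
      ∑ i ∈ s, pairing (θ.vecFun l) (Pi.single i (u i)) := by
    intro s
    exact map_sum (AddMonoidHom.mk' _ (pairing_add_right (θ.vecFun l))) _ _
  rw [hu, hp, map_sum, map_sum]
  refine Finset.sum_congr rfl fun i _ => ?_
  obtain ⟨N, hN⟩ := exists_vanishBelow (u i)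
  exact key i (N + (m i).natAbs) _ (hN.mono (by omega))

/-- The embedding of the dual of `Δ` in `k((t)) ^ ι`. -/
noncomputable def Uniformization.vec : DualMod k Δ →ₗ[k⟦X⟧] (ι → LaurentSeries k) where
  toFun := θ.vecFun
  map_add' l l' := by
    classical
    ext i n
    rw [Pi.add_apply, HahnSeries.coeff_add, θ.coeff_vecFun, θ.coeff_vecFun, θ.coeff_vecFun]
    rfl
  map_smul' f l := eq_of_pairing fun u => by
    rw [RingHom.id_apply, ← pairing_smul, ← θ.toLin_map, ← θ.toLin_map, map_smul]
    rfl

theorem Uniformization.toLin_map' (l : DualMod k Δ) (u : ι → LaurentSeries k) :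
    l.toLin (θ.map u) = pairing (θ.vec l) u := θ.toLin_map l u

theorem Uniformization.vec_injective : Function.Injective θ.vec := fun l l' h =>
  DualMod.ext fun x => by
    obtain ⟨u, rfl⟩ := θ.surjective x
    rw [θ.toLin_map', h, θ.toLin_map']

theorem Uniformization.exists_vec_eq {g : ι → LaurentSeries k}
    (hg : g ∈ vecLattice k fun i => 1 - m i) : ∃ l, θ.vec l = g := by
  have hwd : ∀ u u', θ.map u = θ.map u' → pairing g u = pairing g u' := by
    intro u u' h
    have h0 : u - u' ∈ vecLattice k m := by
      rw [← θ.map_eq_zero_iff, map_sub, h, sub_self]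
    have := pairing_add_right g (u - u') u'
    rwa [sub_add_cancel, pairing_eq_zero hg h0, zero_add] at this
  let r := Function.surjInv θ.surjective
  have hr : ∀ x, θ.map (r x) = x := Function.surjInv_eq θ.surjective
  let l : DualMod k Δ := show Δ →ₗ[k] k from
    { toFun := fun x => pairing g (r x)
      map_add' := fun x y => by
        rw [← pairing_add_right]
        exact hwd _ _ (by rw [map_add, hr, hr, hr])
      map_smul' := fun c x => by
        rw [RingHom.id_apply, smul_eq_mul, ← pairing_C_smul]
        refine hwd _ _ ?_
        rw [map_smul, hr, hr]
        exact (algebraMap_smul k⟦X⟧ c x).symm }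
  refine ⟨l, eq_of_pairing fun u => ?_⟩
  rw [← θ.toLin_map']
  exact hwd _ _ (hr _)

theorem Uniformization.range_vec : LinearMap.range θ.vec = vecLattice k fun i => 1 - m i := by
  ext g
  exact ⟨fun ⟨l, hl⟩ => hl ▸ θ.vecFun_mem l, fun hg => θ.exists_vec_eq hg⟩

include θ in
theorem Uniformization.finite_dual : Module.Finite k⟦X⟧ (DualMod k Δ) := by
  have e := LinearEquiv.ofInjective θ.vec θ.vec_injective
  have : Module.Finite k⟦X⟧ (LinearMap.range θ.vec) := by
    rw [θ.range_vec]
    exact Module.Finite.iff_fg.2 (vecLattice_fg _)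
  exact Module.Finite.equiv e.symm

/-- Inverting t turns ⊕ t^(1-m_i) k[[t]] into k((t))^ι. This provides the coordinates on Δ^* ⊗
k((t)). -/
instance Uniformization.isLocalizedModule :
    IsLocalizedModule (Submonoid.powers (X : k⟦X⟧)) θ.vec where
  map_units := by
    rintro ⟨_, n, rfl⟩
    rw [Module.End.isUnit_iff]
    have h : ∀ u : ι → LaurentSeries k, (X ^ n : k⟦X⟧) • u = tpow k n • u := fun u => by
      rw [← algebraMap_X_pow, algebraMap_smul]
    constructor
    · intro u v huv
      have : tpow k n • u = tpow k n • v := by rw [← h, ← h]; exact huv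
      exact smul_right_injective _ (tpow_ne_zero (n : ℤ)) this
    · intro u
      have : (X ^ n : k⟦X⟧) • tpow k (-n) • u = u := by
        rw [h, smul_smul, tpow_mul_neg, one_smul]
      exact ⟨_, this⟩
  surj u := by
    obtain ⟨N, hN⟩ := exists_pow_smul_mem_vecLattice (fun i => 1 - m i) u
    obtain ⟨l, hl⟩ := θ.exists_vec_eq hN
    exact ⟨(l, ⟨X ^ N, N, rfl⟩), hl.symm⟩
  exists_of_eq h := ⟨1, by rw [θ.vec_injective h]⟩

/-- The coordinates on `Δ^* ⊗ k((t))`. -/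
noncomputable def Uniformization.coord : LocDual k Δ ≃ₗ[LaurentSeries k] (ι → LaurentSeries k) :=
  (IsLocalizedModule.isBaseChange (Submonoid.powers (X : k⟦X⟧)) (LaurentSeries k) θ.vec).equiv

theorem Uniformization.coord_locMk (l : DualMod k Δ) : θ.coord (locMk k Δ l) = θ.vec l := by
  rw [Uniformization.coord, locMk_apply, IsBaseChange.equiv_tmul, one_smul]

theorem Uniformization.mem_dualLattice {x : LocDual k Δ} :
    x ∈ dualLattice k Δ ↔ θ.coord x ∈ vecLattice k fun i => 1 - m i := by
  rw [← θ.range_vec]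
  constructor
  · rintro ⟨l, rfl⟩
    exact ⟨l, (θ.coord_locMk l).symm⟩
  · rintro ⟨l, hl⟩
    exact ⟨l, θ.coord.injective (by rw [θ.coord_locMk, hl])⟩

variable {θ} {T : TorsionPhiGamma k Δ hπ} {A : Matrix ι ι (LaurentSeries k)}

theorem vec_transpose_phi (hT : ∀ u, T.phi (θ.map u) = θ.map (phiVec O A u)) (l : DualMod k Δ) :
    θ.vec (transpose T.phi l) = psiVec O A (θ.vec l) := eq_of_pairing fun u => by
  rw [← θ.toLin_map', transpose_toLin, hT, θ.toLin_map', pairing_phiVec]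

variable (ψ : PsiOperator k hπ)

/-- The étale `(φ,Γ)`-module attached to `Δ`. -/
theorem exists_isAttached [DecidableEq ι] (hT : ∀ u, T.phi (θ.map u) = θ.map (phiVec O A u))
    (hA : IsUnit A.det) :
    ∃ S : EtalePhiGammaModule (phiLS O k) (gammaLS k hπ) (LocDual k Δ), IsAttached ψ T S ∧
      (∀ x, θ.coord (psi ψ S x) = psiVec O A (θ.coord x)) ∧
      ∃ c : LaurentSeries k, c ≠ 0 ∧
        ∀ x i, ∑ j, A j i * θ.coord (S.phi x) j = c * phiLS O k (θ.coord x i) := by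
  obtain ⟨c, hc, hψ⟩ := ψ.exists_eq_kap
  have hA' : IsUnit Aᵀ.det := by rwa [Matrix.det_transpose]
  -- On vectors ψ has to be κ ∘ Aᵀ, whereas ψ on k((t)) is x ↦ κ(cx). The identity ψ(bφ(x)) = ψ(b)x
  -- therefore calls for Aᵀ B = c.
  let B : Matrix ι ι (LaurentSeries k) := c • (Aᵀ)⁻¹
  have hAB : ∀ v : ι → LaurentSeries k, Aᵀ *ᵥ (B *ᵥ v) = c • v := fun v => by
    rw [Matrix.mulVec_mulVec, Matrix.mul_smul, Matrix.mul_nonsing_inv _ hA', Matrix.smul_mulVec,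
      Matrix.one_mulVec]
  let Φ : LocDual k Δ →ₛₗ[phiLS O k] LocDual k Δ :=
    { toFun := fun x => θ.coord.symm (phiVec O B (θ.coord x))
      map_add' := fun x y => by rw [map_add, map_add, map_add]
      map_smul' := fun r x => by rw [map_smul, map_smulₛₗ, map_smul] }
  have hΦ : ∀ x, θ.coord (Φ x) = phiVec O B (θ.coord x) := fun x =>
    θ.coord.apply_symm_apply _
  have hAΦ : ∀ x i, ∑ j, A j i * θ.coord (Φ x) j = c * phiLS O k (θ.coord x i) := fun x i => by
    rw [hΦ]
    exact congrFun (hAB fun j => phiLS O k (θ.coord x j)) i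
  let Ψ : LocDual k Δ →+ LocDual k Δ :=
    (θ.coord.symm.toAddEquiv.toAddMonoidHom.comp (psiVec O A)).comp
      θ.coord.toAddEquiv.toAddMonoidHom
  have hΨ : ∀ x, θ.coord (Ψ x) = psiVec O A (θ.coord x) := fun x => θ.coord.apply_symm_apply _
  have hΨl : ∀ (a : LaurentSeries k) (l : DualMod k Δ),
      Ψ (phiLS O k a • locMk k Δ l) = a • locMk k Δ (transpose T.phi l) := fun a l => by
    apply θ.coord.injective
    rw [hΨ, LinearEquiv.map_smul, LinearEquiv.map_smul, psiVec_phi_smul, θ.coord_locMk, θ.coord_locMk,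
      vec_transpose_phi hT]
  have hΨΦ : ∀ (b : LaurentSeries k) x, Ψ (b • Φ x) = ψ.toHom b • x := fun b x => by
    apply θ.coord.injective
    ext1 i
    rw [hΨ, LinearEquiv.map_smul, LinearEquiv.map_smul, psiVec_apply, Pi.smul_apply, smul_eq_mul, hψ,
      mul_comm _ (θ.coord x i), ← kap_phi_mul]
    congr 1
    calc _ = b * ∑ j, A j i * θ.coord (Φ x) j := by
          rw [Finset.mul_sum]
          exact Finset.sum_congr rfl fun j _ => by rw [Pi.smul_apply, smul_eq_mul]; ring
      _ = _ := by rw [hAΦ]; ring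
  -- Nondegeneracy is needed before the étale structure exists, because γφ = φγ is deduced from the
  -- commutation of Ψ with γ.
  have hΨ0 : ∀ y, (∀ b : LaurentSeries k, Ψ (b • y) = 0) → y = 0 := fun y hy => by
    have h0 : Aᵀ *ᵥ θ.coord y = 0 := by
      ext1 i
      refine eq_zero_of_kap_mul O fun b => ?_
      have := congrFun (congrArg θ.coord (hy b)) i
      rw [hΨ, map_smul, map_zero, psiVec_apply] at this
      refine Eq.trans ?_ this
      congr 1
      change b * ∑ j, A j i * θ.coord y j = _
      rw [Finset.mul_sum]
      exact Finset.sum_congr rfl fun j _ => by rw [Pi.smul_apply, smul_eq_mul]; ring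
    have h1 := congrArg ((Aᵀ)⁻¹ *ᵥ ·) h0
    simp only [Matrix.mulVec_mulVec, Matrix.nonsing_inv_mul _ hA', Matrix.one_mulVec,
      Matrix.mulVec_zero] at h1
    exact θ.coord.map_eq_zero_iff.1 h1
  have hΨγ : ∀ γ x, Ψ (locGamma T γ x) = locGamma T γ (Ψ x) := fun γ x => by
    obtain ⟨a, l, rfl⟩ := LocDual.exists_eq_phi O x
    rw [map_smulₛₗ, gammaLS_phiLS, locGamma_locMk, hΨl, hΨl, map_smulₛₗ, locGamma_locMk]
    congr 2
    refine DualMod.ext fun x => ?_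
    simp only [transpose_toLin]
    rw [T.gamma_phi]
  have hB : Function.Bijective (linearization Φ) := by
    have hdet : IsUnit B.det := by
      rw [Matrix.det_smul]
      exact ((IsUnit.mk0 c hc).pow _).mul (Matrix.isUnit_nonsing_inv_det _ hA')
    let b := (Pi.basisFun (LaurentSeries k) ι).map θ.coord.symm
    let BE : (ι → LaurentSeries k) ≃ₗ[LaurentSeries k] (ι → LaurentSeries k) :=
      LinearEquiv.ofBijective B.mulVecLin
        ⟨Matrix.mulVec_injective_iff_isUnit.2 ((Matrix.isUnit_iff_isUnit_det B).2 hdet),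
          Matrix.mulVec_surjective_iff_isUnit.2 ((Matrix.isUnit_iff_isUnit_det B).2 hdet)⟩
    let b' := ((Pi.basisFun (LaurentSeries k) ι).map BE).map θ.coord.symm
    refine bijective_linearization Φ b b' fun i => ?_
    change θ.coord.symm (phiVec O B (θ.coord (θ.coord.symm (Pi.basisFun (LaurentSeries k) ι i)))) =
      θ.coord.symm (B *ᵥ (Pi.basisFun (LaurentSeries k) ι i))
    rw [LinearEquiv.apply_symm_apply]
    congr 1
    change B *ᵥ _ = _
    congr 1
    ext1 j
    rw [Pi.basisFun_apply]
    by_cases hj : j = i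
    · subst hj; simp
    · simp [hj]
  let S : EtalePhiGammaModule (phiLS O k) (gammaLS k hπ) (LocDual k Δ) :=
    { phi := Φ
      gamma := locGamma T
      gamma_one := fun x => by
        obtain ⟨n, l, rfl⟩ := LocDual.exists_eq x
        rw [map_smulₛₗ, gammaLS_one, locGamma_locMk]
        congr 2
        refine DualMod.ext fun x => ?_
        rw [transpose_toLin, inv_one, T.gamma_one]
      gamma_mul := fun γ γ' x => by
        obtain ⟨n, l, rfl⟩ := LocDual.exists_eq x
        rw [map_smulₛₗ, map_smulₛₗ, map_smulₛₗ, gammaLS_mul, locGamma_locMk, locGamma_locMk,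
          locGamma_locMk]
        congr 2
        refine DualMod.ext fun x => ?_
        simp only [transpose_toLin]
        rw [_root_.mul_inv_rev, T.gamma_mul]
      gamma_phi := fun γ x => by
        rw [← sub_eq_zero]
        refine hΨ0 _ fun b => ?_
        have e : b • locGamma T γ (Φ x) = locGamma T γ (gammaLS k hπ γ⁻¹ b • Φ x) := by
          rw [map_smulₛₗ, gammaLS_inv_gammaLS]
        rw [smul_sub, map_sub, e, hΨγ, hΨΦ, hΨΦ, ψ.map_gamma, map_smulₛₗ, gammaLS_inv_gammaLS,
          sub_self]
      finite := Module.Finite.equiv θ.coord.symm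
      bijective := hB }
  have hpsi : ∀ x, psi ψ S x = Ψ x := psi_eq_of_forall ψ S Ψ hΨΦ
  refine ⟨S, ⟨fun γ l => locGamma_locMk T γ l, fun l => ?_⟩, fun x => ?_, c, hc, hAΦ⟩
  · rw [hpsi]
    have := hΨl 1 l
    rwa [map_one, one_smul, one_smul] at this
  · rw [hpsi, hΨ]

end Model

end PhiGamma

namespace PhiGamma

/-! ### Free modules over k[[t]][φ] and their quotients. -/

section FreeModules
open IsLocalRing
variable (O : Type*) [CommRing O] [IsDomain O] [IsDiscreteValuationRing O]
  [Finite (ResidueField O)] {k : Type*} [Field k] {ι : Type*}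

theorem phiFree_iterate_gen [DecidableEq ι] (i : ι) (n : ℕ) :
    (phiFree O)^[n] (gen i : FreeMod k ι) = Pi.single i (Finsupp.single n 1) := by
  induction n with
  | zero => rfl
  | succ n ih =>
    rw [Function.iterate_succ_apply', ih]
    funext j
    change ((Pi.single i (Finsupp.single n 1) : FreeMod k ι) j |>.mapRange (phiPS O k)
      (map_zero _)).mapDomain Nat.succ = _
    by_cases hj : j = i
    · subst hj
      rw [Pi.single_eq_same, Pi.single_eq_same, Finsupp.mapRange_single, map_one,
        Finsupp.mapDomain_single]
    · rw [Pi.single_eq_of_ne hj, Pi.single_eq_of_ne hj]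
      simp

theorem FreeMod.induction [Fintype ι] [DecidableEq ι] {P : FreeMod k ι → Prop} (h0 : P 0)
    (hadd : ∀ x y, P x → P y → P (x + y))
    (h : ∀ (f : k⟦X⟧) (n : ℕ) (i : ι), P (f • (phiFree O)^[n] (gen i))) (x : FreeMod k ι) : P x := by
  have h1 : ∀ (i : ι) (y : ℕ →₀ k⟦X⟧), P (Pi.single i y) := fun i y => by
    induction y using Finsupp.induction_linear with
    | zero => rwa [Pi.single_zero]
    | add y z hy hz => rw [Pi.single_add]; exact hadd _ _ hy hz
    | single n f =>
      have := h f n i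
      rwa [phiFree_iterate_gen, ← Pi.single_smul, Finsupp.smul_single, smul_eq_mul, mul_one] at this
  rw [← Finset.univ_sum_single x]
  exact Finset.sum_induction _ P hadd h0 fun i _ => h1 i _

variable {O} {V : Type*} [AddCommGroup V] [Module k⟦X⟧ V]
  (F : V →ₛₗ[(phiPS O k : k⟦X⟧ →+* k⟦X⟧)] V)

theorem phiPS_C (c : k) : phiPS O k (C c) = C c := AlgHom.commutes _ c

theorem iterate_smul (n : ℕ) (f : k⟦X⟧) (x : V) : F^[n] (f • x) = (phiPS O k)^[n] f • F^[n] x := by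
  induction n with
  | zero => rfl
  | succ n ih => simp only [Function.iterate_succ_apply', ih, map_smulₛₗ, RingHom.coe_coe]

theorem iterate_X_pow (n m : ℕ) :
    (phiPS O k)^[n] (X ^ m : k⟦X⟧) = X ^ (resCard O ^ n * m) := by
  induction n with
  | zero => simp
  | succ n ih =>
    rw [Function.iterate_succ_apply', ih, phiPS_apply, map_pow, expand_X, ← pow_mul, pow_succ']
    congr 1; ring

variable [Fintype ι]

/-- The `k[[t]][φ]`-linear map `k[[t]][φ] ⊗ M → V` with `e_i ↦ e i`. -/
noncomputable def freeLift (e : ι → V) : FreeMod k ι →ₗ[k⟦X⟧] V :=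
  ∑ i, (Finsupp.linearCombination k⟦X⟧ fun n => F^[n] (e i)) ∘ₗ LinearMap.proj i

variable [DecidableEq ι]

theorem freeLift_iterate (e : ι → V) (n : ℕ) (i : ι) :
    freeLift F e ((phiFree O)^[n] (gen i)) = F^[n] (e i) := by
  rw [phiFree_iterate_gen, freeLift, LinearMap.sum_apply, Finset.sum_eq_single i]
  · simp
  · intro j _ hj
    simp [Pi.single_eq_of_ne hj]
  · intro h; exact absurd (Finset.mem_univ i) h

theorem freeLift_gen (e : ι → V) (i : ι) : freeLift F e (gen i) = e i :=
  freeLift_iterate F e 0 i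

theorem freeLift_phi (e : ι → V) (x : FreeMod k ι) :
    freeLift F e (phiFree O x) = F (freeLift F e x) := by
  refine FreeMod.induction O (P := fun x => freeLift F e (phiFree O x) = F (freeLift F e x)) ?_ ?_ ?_ x
  · simp only [map_zero]
  · intro x y hx hy; simp only [map_add, hx, hy]
  · intro f n i
    rw [map_smulₛₗ, map_smul (freeLift F e), map_smul (freeLift F e), map_smulₛₗ F,
      ← Function.iterate_succ_apply' (phiFree O),
      freeLift_iterate, freeLift_iterate, Function.iterate_succ_apply']

theorem freeLift_iterate_phi (e : ι → V) (n : ℕ) (x : FreeMod k ι) :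
    freeLift F e ((phiFree O)^[n] x) = F^[n] (freeLift F e x) := by
  induction n with
  | zero => rfl
  | succ n ih => rw [Function.iterate_succ_apply', freeLift_phi, ih, Function.iterate_succ_apply']

omit [Fintype ι] [DecidableEq ι] in
theorem nabla_phi_stable (R : Set (FreeMod k ι)) : nabla O R ≤ (nabla O R).comap (phiFree O) := by
  refine Submodule.span_le.2 ?_
  rintro _ ⟨n, r, hr, rfl⟩
  exact Submodule.subset_span ⟨n + 1, r, hr, (Function.iterate_succ_apply' _ _ _).symm⟩

omit [Fintype ι] [DecidableEq ι] in
theorem nabla_iterate_stable {R : Set (FreeMod k ι)} {x : FreeMod k ι} (hx : x ∈ nabla O R)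
    (n : ℕ) : (phiFree O)^[n] x ∈ nabla O R := by
  induction n with
  | zero => exact hx
  | succ n ih => rw [Function.iterate_succ_apply']; exact nabla_phi_stable R ih

omit [Fintype ι] [DecidableEq ι] in
theorem subset_nabla {R : Set (FreeMod k ι)} {r : FreeMod k ι} (hr : r ∈ R) : r ∈ nabla O R :=
  Submodule.subset_span ⟨0, r, hr, rfl⟩

/-- The action of `φ` on a module given by generators and relations. -/
noncomputable def phiQ (R : Set (FreeMod k ι)) :
    Presented O R →ₛₗ[(phiPS O k : k⟦X⟧ →+* k⟦X⟧)] Presented O R :=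
  Submodule.mapQ _ _ (phiFree O) (nabla_phi_stable R)

omit [Fintype ι] [DecidableEq ι] in
theorem phiQ_mkQ (R : Set (FreeMod k ι)) (x : FreeMod k ι) :
    phiQ R ((nabla O R).mkQ x) = (nabla O R).mkQ (phiFree O x) := rfl

omit [Fintype ι] [DecidableEq ι] in
theorem phiQ_iterate_mkQ (R : Set (FreeMod k ι)) (n : ℕ) (x : FreeMod k ι) :
    (phiQ R)^[n] ((nabla O R).mkQ x) = (nabla O R).mkQ ((phiFree O)^[n] x) := by
  induction n with
  | zero => rfl
  | succ n ih => rw [Function.iterate_succ_apply', Function.iterate_succ_apply', ih, phiQ_mkQ]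

theorem nabla_le_comap_freeLift {R : Set (FreeMod k ι)} {e : ι → V} {L : Submodule k⟦X⟧ V}
    (hL : ∀ v ∈ L, F v ∈ L) (hR : ∀ r ∈ R, freeLift F e r ∈ L) :
    nabla O R ≤ L.comap (freeLift F e) := by
  refine Submodule.span_le.2 ?_
  rintro _ ⟨n, r, hr, rfl⟩
  change freeLift F e _ ∈ L
  rw [freeLift_iterate_phi]
  induction n with
  | zero => exact hR r hr
  | succ n ih => rw [Function.iterate_succ_apply']; exact hL _ ih

end FreeModules

/-! ### Actions of Γ on modules given by generators and relations. -/

section GammaOnPresentations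
open IsLocalRing
variable {O : Type*} [CommRing O] [IsDomain O] [IsDiscreteValuationRing O]
  [Finite (ResidueField O)] {k : Type*} [Field k] [Algebra (ResidueField O) k]
  {π : O} {hπ : Irreducible π} {ι : Type*}

theorem gammaPS_C (γ : Oˣ) (c : k) : gammaPS k hπ γ (C c) = C c := AlgHom.commutes _ c

omit [Algebra (ResidueField O) k] in
theorem phi_C_smul {V : Type*} [AddCommGroup V] [Module k⟦X⟧ V]
    (F : V →ₛₗ[(phiPS O k : k⟦X⟧ →+* k⟦X⟧)] V) (c : k) (x : V) :
    F ((C c : k⟦X⟧) • x) = (C c : k⟦X⟧) • F x := by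
  rw [map_smulₛₗ, RingHom.coe_coe, phiPS_C]

theorem gammaFree_iterate_gen [DecidableEq ι] (w : ι → ℤ) (γ : Oˣ) (n : ℕ) (i : ι) :
    gammaFree hπ w γ ((phiFree O)^[n] (gen i : FreeMod k ι)) =
      (C (((scalar k γ) ^ w i : kˣ) : k) : k⟦X⟧) • (phiFree O)^[n] (gen i) := by
  rw [phiFree_iterate_gen]
  funext j
  change (((scalar k γ) ^ w j : kˣ) : k) • ((Pi.single i (Finsupp.single n 1) : FreeMod k ι) j).mapRange
    (gammaPS k hπ γ) (map_zero _) = (C (((scalar k γ) ^ w i : kˣ) : k) : k⟦X⟧) •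
      (Pi.single i (Finsupp.single n 1) : FreeMod k ι) j
  by_cases hj : j = i
  · subst hj
    rw [Pi.single_eq_same, Finsupp.mapRange_single, map_one, Finsupp.smul_single,
      Finsupp.smul_single, smul_eq_mul, ← smul_eq_C_mul]
  · rw [Pi.single_eq_of_ne hj]
    simp

theorem gammaFree_gen [DecidableEq ι] (w : ι → ℤ) (γ : Oˣ) (i : ι) :
    gammaFree hπ w γ (gen i : FreeMod k ι) =
      (C (((scalar k γ) ^ w i : kˣ) : k) : k⟦X⟧) • (gen i : FreeMod k ι) :=
  gammaFree_iterate_gen (O := O) w γ 0 i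

variable [Fintype ι]

theorem gammaFree_phiFree (w : ι → ℤ) (γ : Oˣ) (x : FreeMod k ι) :
    gammaFree hπ w γ (phiFree O x) = phiFree O (gammaFree hπ w γ x) := by
  classical
  refine FreeMod.induction O (P := fun x => gammaFree hπ w γ (phiFree O x) = phiFree O (gammaFree hπ w γ x)) ?_ ?_ ?_ x
  · simp only [map_zero]
  · intro x y hx hy; simp only [map_add, hx, hy]
  · intro f n i
    rw [map_smulₛₗ, map_smulₛₗ, ← Function.iterate_succ_apply' (phiFree O), gammaFree_iterate_gen,
      map_smulₛₗ, map_smulₛₗ, gammaFree_iterate_gen, phi_C_smul,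
      ← Function.iterate_succ_apply' (phiFree O)]
    simp only [RingHom.coe_coe]
    rw [gammaPS_phiPS]

theorem gammaFree_one (w : ι → ℤ) (x : FreeMod k ι) : gammaFree hπ w 1 x = x := by
  classical
  refine FreeMod.induction O (P := fun x => gammaFree hπ w 1 x = x) ?_ ?_ ?_ x
  · simp only [map_zero]
  · intro x y hx hy; simp only [map_add, hx, hy]
  · intro f n i
    rw [map_smulₛₗ, gammaFree_iterate_gen, RingHom.coe_coe, gammaPS_one, scalar, map_one, one_zpow,
      Units.val_one, map_one, one_smul]

theorem gammaFree_mul (w : ι → ℤ) (γ γ' : Oˣ) (x : FreeMod k ι) :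
    gammaFree hπ w (γ * γ') x = gammaFree hπ w γ (gammaFree hπ w γ' x) := by
  classical
  refine FreeMod.induction O (P := fun x => gammaFree hπ w (γ * γ') x = gammaFree hπ w γ (gammaFree hπ w γ' x)) ?_ ?_ ?_ x
  · simp only [map_zero]
  · intro x y hx hy; simp only [map_add, hx, hy]
  · intro f n i
    have h : scalar k (γ * γ') = scalar k γ * scalar k γ' := by simp only [scalar, map_mul]
    simp only [map_smulₛₗ, gammaFree_iterate_gen, RingHom.coe_coe, gammaPS_mul, gammaPS_C, smul_smul,
      map_mul, h, mul_zpow, Units.val_mul]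
    congr 1
    ring

theorem exists_isInduced (w : ι → ℤ) (R : Set (FreeMod k ι))
    (h : ∀ γ, ∀ r ∈ R, gammaFree hπ w γ r ∈ nabla O R) :
    ∃ T : TorsionPhiGamma k (Presented O R) hπ, IsInduced w R T := by
  have hle : ∀ γ, nabla O R ≤ (nabla O R).comap (gammaFree hπ w γ) := by
    refine fun γ => Submodule.span_le.2 ?_
    rintro _ ⟨n, r, hr, rfl⟩
    have e : gammaFree hπ w γ ((phiFree O)^[n] r) = (phiFree O)^[n] (gammaFree hπ w γ r) := by
      induction n with
      | zero => rfl
      | succ n ih =>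
        rw [Function.iterate_succ_apply', gammaFree_phiFree, ih, Function.iterate_succ_apply']
    change gammaFree hπ w γ _ ∈ nabla O R
    rw [e]
    exact nabla_iterate_stable (h γ r hr) n
  let G : ∀ γ, Presented O R →ₛₗ[(gammaPS k hπ γ : k⟦X⟧ →+* k⟦X⟧)] Presented O R := fun γ =>
    Submodule.mapQ _ _ (gammaFree hπ w γ) (hle γ)
  have hG : ∀ γ x, G γ ((nabla O R).mkQ x) = (nabla O R).mkQ (gammaFree hπ w γ x) := fun _ _ => rfl
  refine ⟨⟨phiQ R, G, fun x => ?_, fun γ γ' x => ?_, fun γ x => ?_⟩, fun x => rfl, fun γ x => rfl⟩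
  all_goals obtain ⟨x, rfl⟩ := (nabla O R).mkQ_surjective x
  · rw [hG, gammaFree_one]
  · rw [hG, hG, hG, gammaFree_mul]
  · rw [hG, phiQ_mkQ, phiQ_mkQ, hG, gammaFree_phiFree]

end GammaOnPresentations

end PhiGamma

namespace PhiGamma

/-! ### Cyclic presentations: t^(w_i) φ(g_σ(i)) = g_i. -/

section Cyclic
open IsLocalRing Matrix
variable (O : Type*) [CommRing O] [IsDomain O] [IsDiscreteValuationRing O]
  [Finite (ResidueField O)] {k : Type*} [Field k] {ι κ : Type*} [Fintype ι]

/-- The map `phiVec A`, considered as a semilinear map of `k[[t]]`-modules. -/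
noncomputable def phiVecPS (A : Matrix ι ι (LaurentSeries k)) :
    (ι → LaurentSeries k) →ₛₗ[(phiPS O k : k⟦X⟧ →+* k⟦X⟧)] (ι → LaurentSeries k) where
  toFun := phiVec O A
  map_add' := map_add _
  map_smul' := phiVec_smul O A

theorem phiVecPS_apply (A : Matrix ι ι (LaurentSeries k)) (u : ι → LaurentSeries k) :
    phiVecPS O A u = phiVec O A u := rfl

variable {O} in
theorem exists_uniformization [Fintype κ] [DecidableEq κ] {A : Matrix ι ι (LaurentSeries k)}
    {m : ι → ℤ} {R : Set (FreeMod k κ)} {e : κ → ι → LaurentSeries k}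
    (hs : Function.Surjective (freeLift (phiVecPS O A) e))
    (hR : nabla O R = (vecLattice k m).comap (freeLift (phiVecPS O A) e)) :
    ∃ θ : Uniformization (k := k) (Presented O R) m,
      ∀ x, θ.map (freeLift (phiVecPS O A) e x) = (nabla O R).mkQ x := by
  set Θ := freeLift (phiVecPS O A) e
  have hle : LinearMap.ker Θ ≤ nabla O R := fun x hx => by
    rw [hR, Submodule.mem_comap, LinearMap.mem_ker.1 hx]
    exact zero_mem _
  let f := (Submodule.factor hle) ∘ₗ (Θ.quotKerEquivOfSurjective hs).symm.toLinearMap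
  have hf : ∀ x, f (Θ x) = (nabla O R).mkQ x := fun x => by
    have : (Θ.quotKerEquivOfSurjective hs).symm (Θ x) = (LinearMap.ker Θ).mkQ x := by
      rw [LinearEquiv.symm_apply_eq]
      rfl
    change Submodule.factor hle ((Θ.quotKerEquivOfSurjective hs).symm (Θ x)) = _
    rw [this]
    rfl
  refine ⟨⟨f, fun y => ?_, fun u => ?_⟩, hf⟩
  · obtain ⟨x, rfl⟩ := (nabla O R).mkQ_surjective y
    exact ⟨Θ x, hf x⟩
  · obtain ⟨x, rfl⟩ := hs u
    rw [hf, Submodule.mkQ_apply, Submodule.Quotient.mk_eq_zero, hR, Submodule.mem_comap]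

variable [DecidableEq ι]

/-- The matrix of `u ↦ (t ^ (-w i) φ(u (σ i)))_i`. -/
noncomputable def cycleMat (σ : Equiv.Perm ι) (w : ι → ℕ) : Matrix ι ι (LaurentSeries k) :=
  Matrix.of fun i j => if j = σ i then tpow k (-(w i : ℤ)) else 0

theorem phiVec_cycleMat (σ : Equiv.Perm ι) (w : ι → ℕ) (u : ι → LaurentSeries k) (i : ι) :
    phiVec O (cycleMat σ w) u i = tpow k (-(w i : ℤ)) * phiLS O k (u (σ i)) := by
  rw [phiVec_apply, Finset.sum_eq_single (σ i)]
  · simp [cycleMat]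
  · intro j _ hj
    simp [cycleMat, hj]
  · intro h; exact absurd (Finset.mem_univ _) h

theorem psiVec_cycleMat (σ : Equiv.Perm ι) (w : ι → ℕ) (g : ι → LaurentSeries k) (i : ι) :
    psiVec O (cycleMat σ w) g (σ i) = kap O (tpow k (-(w i : ℤ)) * g i) := by
  rw [psiVec_apply, Finset.sum_eq_single i]
  · simp [cycleMat]
  · intro j _ hj
    simp [cycleMat, hj.symm]
  · intro h; exact absurd (Finset.mem_univ _) h

/-- The exponents with `φ ^ n (b_{σ ^ n i}) = t ^ (-c_{n, i}) b_i` for the standard basis `b`. -/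
noncomputable def cycleExp (σ : Equiv.Perm ι) (w : ι → ℕ) : ℕ → ι → ℕ
  | 0, _ => 0
  | n + 1, i => w i + resCard O * cycleExp σ w n (σ i)

omit [Fintype ι] [DecidableEq ι] in
-- The relation g_i = t^(w_i) φ(g_σ(i)) is substituted into itself n times. The lemma serves both
-- the standard basis of the model and the generators of the presented module.
theorem pow_cycleExp_smul {σ : Equiv.Perm ι} {w : ι → ℕ} {V : Type*} [AddCommGroup V]
    [Module k⟦X⟧ V] (F : V →ₛₗ[(phiPS O k : k⟦X⟧ →+* k⟦X⟧)] V) {g : ι → V}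
    (hg : ∀ i, (X ^ w i : k⟦X⟧) • F (g (σ i)) = g i) (n : ℕ) (i : ι) :
    (X ^ cycleExp O σ w n i : k⟦X⟧) • F^[n] (g (σ^[n] i)) = g i := by
  induction n generalizing i with
  | zero => exact one_smul _ _
  | succ n ih =>
    rw [cycleExp, Function.iterate_succ_apply σ, Function.iterate_succ_apply' F, pow_add, mul_smul,
      ← hg i]
    congr 1
    have h := congrArg F (ih (σ i))
    rw [map_smulₛₗ, RingHom.coe_coe, ← Function.iterate_one (phiPS O k : k⟦X⟧ → k⟦X⟧),
      iterate_X_pow, pow_one] at h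
    exact h

theorem phiVecPS_single_one (A : Matrix ι ι (LaurentSeries k)) (j : ι) :
    phiVecPS O A (Pi.single j 1) = fun i => A i j := by
  ext1 i
  rw [phiVecPS_apply, phiVec_apply, Finset.sum_eq_single j]
  · rw [Pi.single_eq_same, map_one, mul_one]
  · intro l _ hl
    rw [Pi.single_eq_of_ne hl, map_zero, mul_zero]
  · intro h; exact absurd (Finset.mem_univ _) h

theorem pow_smul_phiVecPS_single (σ : Equiv.Perm ι) (w : ι → ℕ) (i : ι) :
    (X ^ w i : k⟦X⟧) • phiVecPS O (cycleMat σ w) (Pi.single (σ i) 1 : ι → LaurentSeries k) =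
      Pi.single i 1 := by
  ext1 j
  rw [phiVecPS_single_one, ← algebraMap_smul (LaurentSeries k), algebraMap_X_pow, Pi.smul_apply,
    smul_eq_mul]
  by_cases hj : j = i
  · subst hj
    simp [cycleMat]
  · simp [cycleMat, Ne.symm hj]

theorem iterate_phiVecPS_single (σ : Equiv.Perm ι) (w : ι → ℕ) (n : ℕ) (i : ι) :
    (phiVecPS O (cycleMat σ w))^[n] (Pi.single (σ^[n] i) 1 : ι → LaurentSeries k) =
      Pi.single i (tpow k (-(cycleExp O σ w n i : ℤ))) := by
  have h := pow_cycleExp_smul (k := k) (σ := σ) (w := w) O (phiVecPS O (cycleMat σ w))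
    (g := fun i => (Pi.single i 1 : ι → LaurentSeries k)) (pow_smul_phiVecPS_single O σ w) n i
  rw [← algebraMap_smul (LaurentSeries k), algebraMap_X_pow] at h
  have h2 := congrArg (tpow k (-(cycleExp O σ w n i : ℤ)) • ·) h
  rwa [smul_smul, tpow_neg_mul, one_smul, ← Pi.single_smul, smul_eq_mul, mul_one] at h2

theorem phiVecPS_cycleMat_mem {σ : Equiv.Perm ι} {w : ι → ℕ} {m : ι → ℤ}
    (h : ∀ i, m i ≤ resCard O * m (σ i) - w i) {v : ι → LaurentSeries k}
    (hv : v ∈ vecLattice k m) : phiVecPS O (cycleMat σ w) v ∈ vecLattice k m := by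
  intro i
  rw [phiVecPS_apply, phiVec_cycleMat, vanishBelow_tpow_mul]
  refine (VanishBelow.phi O (hv (σ i))).mono ?_
  have := h i
  omega

theorem exists_le_cycleExp {w : Fin 2 → ℕ} (hw : 0 < w 0 + w 1) (N : ℕ) (i : Fin 2) :
    ∃ n, N ≤ cycleExp O (Equiv.swap 0 1) w n i := by
  -- A single step of the recursion may add nothing, since one weight can be zero. Two steps meet
  -- both weights and add at least w_0 + w_1.
  refine ⟨2 * N, ?_⟩
  induction N with
  | zero => exact Nat.zero_le _
  | succ N ih =>
    have hq : 0 < resCard O := Nat.pos_of_ne_zero (resCard_ne_zero O)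
    have h1 : w i + w (Equiv.swap 0 1 i) = w 0 + w 1 := by
      fin_cases i
      · rfl
      · exact add_comm _ _
    have hs : Equiv.swap 0 1 (Equiv.swap 0 1 i) = i := by fin_cases i <;> rfl
    rw [show 2 * (N + 1) = 2 * N + 1 + 1 by ring, cycleExp, cycleExp, hs]
    have h2 := Nat.le_mul_of_pos_left (w (Equiv.swap 0 1 i) + resCard O *
      cycleExp O (Equiv.swap 0 1) w (2 * N) i) hq
    have h3 := Nat.le_mul_of_pos_left (cycleExp O (Equiv.swap 0 1) w (2 * N) i) hq
    omega

omit [Fintype ι] in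
theorem single_mem_vecLattice {m : ι → ℤ} {i : ι} {y : LaurentSeries k} (h : VanishBelow (m i) y) :
    Pi.single i y ∈ vecLattice k m := by
  intro j
  by_cases hj : j = i
  · subst hj
    rwa [Pi.single_eq_same]
  · rw [Pi.single_eq_of_ne hj]
    exact vanishBelow_zero _

theorem X_pow_smul_tpow (n : ℕ) (d : ℤ) : (X ^ n : k⟦X⟧) • tpow k d = tpow k (n + d) := by
  rw [Algebra.smul_def, algebraMap_X_pow, tpow_add]

variable {O} [Fintype κ] [DecidableEq κ] {σ : Equiv.Perm ι} {w m : ι → ℕ} {R : Set (FreeMod k κ)}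
  {ε : ι → κ} {e : κ → ι → LaurentSeries k}

omit [DecidableEq ι] in
-- The span of the φ^n(g_i) grows with n, because g_i is a multiple of φ(g_σ(i)). Hence every
-- element can be written with one common, sufficiently large power of φ.
theorem exists_eq_sum_of_generators
    (hg : ∀ i, (X ^ w i : k⟦X⟧) • phiFree O (gen (ε (σ i)) : FreeMod k κ) - (gen (ε i) : FreeMod k κ) ∈ nabla O R)
    (hgen : ∀ j, (nabla O R).mkQ (gen j) ∈
      Submodule.span k⟦X⟧ (Set.range fun i => (nabla O R).mkQ (gen (ε i)))) (x : FreeMod k κ) :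
    ∃ (n : ℕ) (a : ι → k⟦X⟧),
      x - ∑ i, a i • (phiFree O)^[n] (gen (ε (σ^[n] i)) : FreeMod k κ) ∈ nabla O R := by
  let g : ι → Presented O R := fun i => (nabla O R).mkQ (gen (ε i))
  let Q : ℕ → Submodule k⟦X⟧ (Presented O R) := fun n =>
    Submodule.span k⟦X⟧ (Set.range fun i => (phiQ R)^[n] (g i))
  have hg' : ∀ i, (X ^ w i : k⟦X⟧) • phiQ R (g (σ i)) = g i := fun i =>
    (Submodule.Quotient.eq _).2 (hg i)
  have hstep : ∀ n, Q n ≤ Q (n + 1) := fun n => by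
    refine Submodule.span_le.2 ?_
    rintro _ ⟨i, rfl⟩
    change (phiQ R)^[n] (g i) ∈ Q (n + 1)
    rw [← hg' i, iterate_smul, ← Function.iterate_succ_apply]
    exact Submodule.smul_mem _ _ (Submodule.subset_span ⟨σ i, rfl⟩)
  have hmono : Monotone Q := monotone_nat_of_le_succ hstep
  have hQ : ∀ n, ∀ y ∈ Q 0, (phiQ R)^[n] y ∈ Q n := fun n y hy => by
    induction hy using Submodule.span_induction with
    | mem y hy => obtain ⟨i, rfl⟩ := hy; exact Submodule.subset_span ⟨i, rfl⟩
    | zero => rw [iterate_map_zero]; exact zero_mem _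
    | add y z _ _ hy hz => rw [iterate_map_add]; exact add_mem hy hz
    | smul f y _ hy => rw [iterate_smul]; exact Submodule.smul_mem _ _ hy
  have hx : ∃ n, (nabla O R).mkQ x ∈ Q n := by
    refine FreeMod.induction O (P := fun x => ∃ n, (nabla O R).mkQ x ∈ Q n) ?_ ?_ ?_ x
    · exact ⟨0, by rw [map_zero]; exact zero_mem _⟩
    · rintro x y ⟨n, hn⟩ ⟨n', hn'⟩
      refine ⟨max n n', ?_⟩
      rw [map_add]
      exact add_mem (hmono (le_max_left _ _) hn) (hmono (le_max_right _ _) hn')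
    · intro f n j
      refine ⟨n, ?_⟩
      rw [map_smul, ← phiQ_iterate_mkQ]
      exact Submodule.smul_mem _ _ (hQ n _ (hgen j))
  obtain ⟨n, hn⟩ := hx
  obtain ⟨b, hb⟩ := (Submodule.mem_span_range_iff_exists_fun _).1 hn
  refine ⟨n, fun i => b (σ^[n] i), (Submodule.Quotient.eq _).1 ?_⟩
  change (nabla O R).mkQ x = (nabla O R).mkQ _
  rw [← hb, map_sum, ← Equiv.sum_comp (σ ^ n) (fun i => b i • (phiQ R)^[n] (g i))]
  refine Finset.sum_congr rfl fun i _ => ?_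
  rw [map_smul, ← phiQ_iterate_mkQ, Equiv.Perm.coe_pow]

/-- One inclusion holds since the lattice is φ-stable and contains the images of the relators. For
the other, write x modulo the relations as Σ a_i φ^n(g_σⁿ(i)). Its image has the entries a_i
t^(-c_i), c_i being the exponents `cycleExp`, so if it lies in the lattice then t^(m_i + c_i)
divides a_i. The i-th term is then a multiple of t^(m_i) g_i, which is zero in the quotient. -/
theorem nabla_eq_comap_vecLattice
    (he : ∀ i, e (ε i) = Pi.single i 1)
    (hg : ∀ i, (X ^ w i : k⟦X⟧) • phiFree O (gen (ε (σ i)) : FreeMod k κ) - (gen (ε i) : FreeMod k κ) ∈ nabla O R)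
    (hgen : ∀ j, (nabla O R).mkQ (gen j) ∈
      Submodule.span k⟦X⟧ (Set.range fun i => (nabla O R).mkQ (gen (ε i))))
    (hm : ∀ i, (X ^ m i : k⟦X⟧) • (gen (ε i) : FreeMod k κ) ∈ nabla O R)
    (hL : ∀ v ∈ vecLattice k (fun i => (m i : ℤ)),
      phiVecPS (k := k) O (cycleMat σ w) v ∈ vecLattice k (fun i => (m i : ℤ)))
    (hR : ∀ r ∈ R, freeLift (phiVecPS (k := k) O (cycleMat σ w)) e r ∈ vecLattice k (fun i => (m i : ℤ))) :
    nabla O R =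
      (vecLattice k (fun i => (m i : ℤ))).comap (freeLift (phiVecPS (k := k) O (cycleMat σ w)) e) := by
  have hle := nabla_le_comap_freeLift _ hL hR
  refine le_antisymm hle fun x hx => ?_
  obtain ⟨n, a, hna⟩ := exists_eq_sum_of_generators hg hgen x
  have hsum := Submodule.sub_mem _ (Submodule.mem_comap.1 hx) (hle hna)
  rw [← map_sub, sub_sub_cancel, map_sum] at hsum
  have hcoord : ∀ i, ∃ b : k⟦X⟧, a i = b * X ^ (m i) * X ^ cycleExp O σ w n i := fun i => by
    have h := hsum i
    rw [Finset.sum_apply, Finset.sum_eq_single i] at h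
    · rw [map_smul, freeLift_iterate, he, iterate_phiVecPS_single, Pi.smul_apply,
        Pi.single_eq_same, Algebra.smul_def, mul_comm, vanishBelow_tpow_mul, vanishBelow_iff] at h
      obtain ⟨b, hb⟩ := h
      refine ⟨b, FaithfulSMul.algebraMap_injective k⟦X⟧ (LaurentSeries k) ?_⟩
      rw [hb, mul_assoc, ← pow_add, map_mul, algebraMap_X_pow, mul_comm]
      push_cast
      rw [sub_neg_eq_add]
    · intro j _ hj
      rw [map_smul, freeLift_iterate, he, iterate_phiVecPS_single, Pi.smul_apply,
        Pi.single_eq_of_ne hj.symm, smul_zero]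
    · intro h; exact absurd (Finset.mem_univ _) h
  have hmem : ∀ i, a i • (phiFree O)^[n] (gen (ε (σ^[n] i)) : FreeMod k κ) ∈ nabla O R := fun i => by
    obtain ⟨b, hb⟩ := hcoord i
    have h := pow_cycleExp_smul O (phiQ R) (g := fun i => (nabla O R).mkQ (gen (ε i)))
      (fun i => (Submodule.Quotient.eq _).2 (hg i)) n i
    rw [← Submodule.Quotient.mk_eq_zero]
    change (nabla O R).mkQ _ = 0
    rw [map_smul, ← phiQ_iterate_mkQ, hb, mul_smul, mul_smul, h, ← map_smul,
      Submodule.mkQ_apply, (Submodule.Quotient.mk_eq_zero _).2 (hm i), smul_zero]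
  have := Submodule.add_mem _ hna (Submodule.sum_mem _ fun i (_ : i ∈ Finset.univ) => hmem i)
  rwa [sub_add_cancel] at this

/-- The images of φ^n(g_σⁿ(i)) are the basis vectors divided by powers of t of unbounded exponent.
-/
theorem freeLift_surjective_of_cycle (he : ∀ i, e (ε i) = Pi.single i 1)
    (hc : ∀ N i, ∃ n, N ≤ cycleExp O σ w n i) :
    Function.Surjective (freeLift (phiVecPS (k := k) O (cycleMat σ w)) e) := by
  have h1 : ∀ i (y : LaurentSeries k), Pi.single i y ∈
      LinearMap.range (freeLift (phiVecPS (k := k) O (cycleMat σ w)) e) := fun i y => by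
    obtain ⟨N, hN⟩ := exists_vanishBelow y
    obtain ⟨n, hn⟩ := hc N i
    obtain ⟨f, hf⟩ := vanishBelow_iff.1
      (hN.mono (d' := -(cycleExp O σ w n i : ℤ)) (by omega))
    refine ⟨f • (phiFree O)^[n] (gen (ε (σ^[n] i)) : FreeMod k κ), ?_⟩
    rw [map_smul, freeLift_iterate, he, iterate_phiVecPS_single, ← Pi.single_smul,
      Algebra.smul_def, mul_comm, ← hf]
  intro u
  change u ∈ LinearMap.range _
  rw [← Finset.univ_sum_single u]
  exact Submodule.sum_mem _ fun i _ => h1 i _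

end Cyclic

/-! ### Comparing lifts from free modules. -/

section Comparison
open IsLocalRing
variable {O : Type*} [CommRing O] [IsDomain O] [IsDiscreteValuationRing O]
  [Finite (ResidueField O)] {k : Type*} [Field k] {ι κ : Type*} [Fintype ι] [Fintype κ]
  [DecidableEq ι] [DecidableEq κ]
  {V V' : Type*} [AddCommGroup V] [Module k⟦X⟧ V] [AddCommGroup V'] [Module k⟦X⟧ V']

theorem map_freeLift {F : V →ₛₗ[(phiPS O k : k⟦X⟧ →+* k⟦X⟧)] V}
    {F' : V' →ₛₗ[(phiPS O k : k⟦X⟧ →+* k⟦X⟧)] V'} {e : ι → V} {e' : κ → V'}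
    {h : FreeMod k ι →ₗ[k⟦X⟧] FreeMod k κ} (hφ : ∀ x, h (phiFree O x) = phiFree O (h x))
    {G : V →ₗ[k⟦X⟧] V'} (hG : ∀ v, G (F v) = F' (G v))
    (hgen : ∀ i, G (e i) = freeLift F' e' (h (gen i))) (x : FreeMod k ι) :
    G (freeLift F e x) = freeLift F' e' (h x) := by
  refine FreeMod.induction O (P := fun x => G (freeLift F e x) = freeLift F' e' (h x)) ?_ ?_ ?_ x
  · simp only [map_zero]
  · intro x y hx hy; simp only [map_add, hx, hy]
  · intro f n i
    rw [map_smul, map_smul, map_smul, map_smul]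
    congr 1
    induction n with
    | zero => exact (congrArg G (freeLift_gen F e i)).trans (hgen i)
    | succ n ih =>
      rw [Function.iterate_succ_apply', freeLift_phi, hG, ih, hφ, freeLift_phi]

end Comparison

end PhiGamma

namespace PhiGamma

/-! ### The models of Δ₁, Δ₂ and Δ, and the exact sequence between them. -/

section Models
open IsLocalRing Matrix
variable (O : Type*) [CommRing O] [IsDomain O] [IsDiscreteValuationRing O]
  [Finite (ResidueField O)] (k : Type*) [Field k]

/-- The matrix of `φ` on the model of `Δ₁`. -/
noncomputable def matSub (s : ℕ) : Matrix (Fin 2) (Fin 2) (LaurentSeries k) :=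
  cycleMat (Equiv.swap 0 1) ![1 + s, resCard O - 2 - s]

/-- The matrix of `φ` on the model of `Δ₂`. -/
noncomputable def matQuot : Matrix (Fin 2) (Fin 2) (LaurentSeries k) :=
  cycleMat (Equiv.swap 0 1) ![0, resCard O - 1]

/-- The matrix of `φ` on the model of `Δ`. -/
noncomputable def matExt (s : ℕ) : Matrix (Fin 2 ⊕ Fin 2) (Fin 2 ⊕ Fin 2) (LaurentSeries k) :=
  fromBlocks (matQuot O k) 0 !![tpow k (-(resCard O : ℤ)), 0; 0, 0] (matSub O k s)

/-- The exponents of the lattice by which `Δ₁` is uniformized. -/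
def expSub : Fin 2 → ℕ := ![1, 1]

/-- The exponents of the lattice by which `Δ₂` is uniformized. -/
def expQuot : Fin 2 → ℕ := ![2, 1]

/-- The exponents of the lattice by which `Δ` is uniformized. -/
def expExt : Fin 2 ⊕ Fin 2 → ℕ := Sum.elim expQuot expSub

/-- The lattice `⊕ t ^ (m i) k[[t]]`. -/
abbrev natLattice {ι : Type*} (m : ι → ℕ) : Submodule k⟦X⟧ (ι → LaurentSeries k) :=
  vecLattice k fun i => (m i : ℤ)

/-- The images of the generators of `Δ₁` in the model. -/
noncomputable def genSub : Fin 2 → Fin 2 → LaurentSeries k := fun i => Pi.single i 1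

/-- The images of the generators of `Δ₂` in the model. -/
noncomputable def genQuot : Fin 3 → Fin 2 → LaurentSeries k :=
  ![Pi.single 0 1, Pi.single 1 1, Pi.single 0 (tpow k 1)]

/-- The images of the generators of `Δ` in the model. -/
noncomputable def genExt : Fin 3 ⊕ Fin 2 → Fin 2 ⊕ Fin 2 → LaurentSeries k :=
  Sum.elim (fun i => Sum.elim (genQuot k i) 0) fun i => Sum.elim 0 (genSub k i)

/-- The map from the free module to the model of `Δ₁`. -/
noncomputable abbrev liftSub (s : ℕ) :=
  freeLift (phiVecPS O (matSub O k s)) (genSub k)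

/-- The map from the free module to the model of `Δ₂`. -/
noncomputable abbrev liftQuot := freeLift (phiVecPS O (matQuot O k)) (genQuot k)

/-- The map from the free module to the model of `Δ`. -/
noncomputable abbrev liftExt (s : ℕ) := freeLift (phiVecPS O (matExt O k s)) (genExt k)

variable {O k} {s : ℕ}

theorem sub_mem_of_eq {V : Type*} [AddCommGroup V] [Module k⟦X⟧ V] (S : Submodule k⟦X⟧ V) {x y : V}
    (h : x = y) : x - y ∈ S := by
  rw [h, sub_self]
  exact zero_mem _

theorem matSub_mem (hs : s + 2 ≤ resCard O) : ∀ v ∈ natLattice k expSub,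
    phiVecPS O (matSub O k s) v ∈ natLattice k expSub := fun v hv =>
  phiVecPS_cycleMat_mem O (fun i => by
    fin_cases i <;> simp [expSub] <;> omega) hv

theorem matQuot_mem : ∀ v ∈ natLattice k expQuot,
    phiVecPS O (matQuot O k) v ∈ natLattice k expQuot := fun v hv =>
  phiVecPS_cycleMat_mem O (fun i => by
    have := two_le_resCard O
    fin_cases i <;> simp [expQuot] <;> omega) hv

theorem nabla_relSub (hs : s + 2 ≤ resCard O) :
    nabla O (relSub O k s) = (natLattice k expSub).comap (liftSub O k s) := by
  refine nabla_eq_comap_vecLattice (σ := Equiv.swap 0 1) (ε := id) (fun i => rfl) ?_ ?_ ?_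
    (matSub_mem hs) ?_
  · intro i
    fin_cases i
    · exact subset_nabla (by simp [relSub])
    · exact subset_nabla (by simp [relSub])
  · exact fun j => Submodule.subset_span ⟨j, rfl⟩
  · intro i
    fin_cases i
    · exact subset_nabla (by simp [relSub, expSub])
    · exact subset_nabla (by simp [relSub, expSub])
  · have h := pow_smul_phiVecPS_single (k := k) O (Equiv.swap 0 1) ![1 + s, resCard O - 2 - s]
    have h0 := h 0
    have h1 := h 1
    have hX : ∀ i : Fin 2, (X : k⟦X⟧) • (Pi.single i 1 : Fin 2 → LaurentSeries k) ∈
        natLattice k expSub := fun i => by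
      rw [← Pi.single_smul, ← pow_one (X : k⟦X⟧), ← tpow_zero, X_pow_smul_tpow]
      refine single_mem_vecLattice ((vanishBelow_tpow _).mono ?_)
      fin_cases i <;> simp [expSub]
    intro r hr
    simp only [relSub, Set.mem_insert_iff, Set.mem_singleton_iff] at hr
    rcases hr with rfl | rfl | rfl | rfl
    · rw [map_sub, map_smul, freeLift_phi, freeLift_gen, freeLift_gen]
      exact sub_mem_of_eq _ h1
    · rw [map_sub, map_smul, freeLift_phi, freeLift_gen, freeLift_gen]
      exact sub_mem_of_eq _ h0
    · rw [map_smul, freeLift_gen]; exact hX 0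
    · rw [map_smul, freeLift_gen]; exact hX 1

theorem nabla_relQuot :
    nabla O (relQuot O k) = (natLattice k expQuot).comap (liftQuot O k) := by
  have hmem : ∀ (n : ℕ) (i : Fin 2) (d : ℤ), (expQuot i : ℤ) ≤ n + d →
      (X ^ n : k⟦X⟧) • (Pi.single i (tpow k d) : Fin 2 → LaurentSeries k) ∈
        natLattice k expQuot := fun n i d h => by
    rw [← Pi.single_smul, X_pow_smul_tpow]
    exact single_mem_vecLattice ((vanishBelow_tpow _).mono h)
  refine nabla_eq_comap_vecLattice (σ := Equiv.swap 0 1) (ε := ![0, 1]) ?_ ?_ ?_ ?_ matQuot_mem ?_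
  · intro i
    fin_cases i <;> rfl
  · intro i
    fin_cases i
    · exact subset_nabla (by simp [relQuot])
    · exact subset_nabla (by simp [relQuot])
  · intro j
    fin_cases j
    · exact Submodule.subset_span ⟨0, rfl⟩
    · exact Submodule.subset_span ⟨1, rfl⟩
    · have : (nabla O (relQuot O k)).mkQ (gen 2) = (X : k⟦X⟧) • (nabla O (relQuot O k)).mkQ (gen 0) :=
        Eq.symm ((Submodule.Quotient.eq _).2 (subset_nabla (by simp [relQuot])))
      change (nabla O (relQuot O k)).mkQ (gen 2) ∈ _
      rw [this]
      exact Submodule.smul_mem _ _ (Submodule.subset_span ⟨0, rfl⟩)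
  · intro i
    fin_cases i
    · have h1 : (X : k⟦X⟧) • gen 0 - gen 2 ∈ nabla O (relQuot O k) :=
        subset_nabla (by simp [relQuot])
      have h2 : (X : k⟦X⟧) • gen 2 ∈ nabla O (relQuot O k) := subset_nabla (by simp [relQuot])
      have h3 := Submodule.add_mem _ (Submodule.smul_mem _ (X : k⟦X⟧) h1) h2
      rw [smul_sub, sub_add_cancel, smul_smul, ← pow_two] at h3
      exact h3
    · exact subset_nabla (by simp [relQuot, expQuot])
  · have h := pow_smul_phiVecPS_single (k := k) O (Equiv.swap 0 1) ![0, resCard O - 1]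
    have h0 := h 0
    have h1 := h 1
    intro r hr
    simp only [relQuot, Set.mem_insert_iff, Set.mem_singleton_iff] at hr
    rcases hr with rfl | rfl | rfl | rfl | rfl
    · rw [map_sub, map_smul, freeLift_phi, freeLift_gen, freeLift_gen]
      exact sub_mem_of_eq _ h1
    · rw [map_sub, freeLift_phi, freeLift_gen, freeLift_gen]
      refine sub_mem_of_eq _ (Eq.trans ?_ h0)
      exact (one_smul k⟦X⟧ _).symm
    · rw [map_sub, map_smul, freeLift_gen, freeLift_gen]
      refine sub_mem_of_eq _ ?_
      change (X : k⟦X⟧) • (Pi.single 0 (tpow k 0) : Fin 2 → LaurentSeries k) = Pi.single 0 (tpow k 1)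
      rw [← Pi.single_smul, ← pow_one (X : k⟦X⟧), X_pow_smul_tpow]
      rfl
    · rw [map_smul, freeLift_gen, ← pow_one (X : k⟦X⟧)]
      exact hmem 1 0 1 (by simp [expQuot])
    · rw [map_smul, freeLift_gen, ← pow_one (X : k⟦X⟧)]
      exact hmem 1 1 0 (by simp [expQuot])

theorem liftSub_surjective : Function.Surjective (liftSub O k s) :=
  freeLift_surjective_of_cycle (ε := id) (fun _ => rfl)
    (exists_le_cycleExp O (by simp))

theorem liftQuot_surjective : Function.Surjective (liftQuot O k) :=
  freeLift_surjective_of_cycle (ε := ![0, 1]) (fun i => by fin_cases i <;> rfl)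
    (exists_le_cycleExp O (by have := two_le_resCard O; simp; omega))

theorem phiVecPS_matExt_comp_inl (u : Fin 2 ⊕ Fin 2 → LaurentSeries k) :
    (phiVecPS O (matExt O k s) u) ∘ Sum.inl = phiVecPS O (matQuot O k) (u ∘ Sum.inl) := by
  ext1 i
  simp [phiVecPS_apply, phiVec_apply, matExt]

theorem phiVecPS_matExt_elim (v : Fin 2 → LaurentSeries k) :
    phiVecPS O (matExt O k s) (Sum.elim (0 : Fin 2 → LaurentSeries k) v) =
      Sum.elim (0 : Fin 2 → LaurentSeries k) (phiVecPS O (matSub O k s) v) := by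
  ext1 i
  rcases i with i | i <;> simp [phiVecPS_apply, phiVec_apply, matExt]

theorem comp_inl_liftExt (x : FreeMod k (Fin 3 ⊕ Fin 2)) :
    (liftExt O k s x) ∘ Sum.inl = liftQuot O k (projFree k x) := by
  let G : (Fin 2 ⊕ Fin 2 → LaurentSeries k) →ₗ[k⟦X⟧] (Fin 2 → LaurentSeries k) :=
    LinearMap.funLeft k⟦X⟧ (LaurentSeries k) Sum.inl
  refine map_freeLift (G := G) (projFree_phi O k) phiVecPS_matExt_comp_inl (fun i => ?_) x
  rcases i with i | i
  · rw [projFree_gen_inl, freeLift_gen]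
    rfl
  · rw [projFree_gen_inr, map_zero]
    rfl

theorem elim_liftSub (y : FreeMod k (Fin 2)) :
    Sum.elim (0 : Fin 2 → LaurentSeries k) (liftSub O k s y) = liftExt O k s (inclFree k y) := by
  let G : (Fin 2 → LaurentSeries k) →ₗ[k⟦X⟧] (Fin 2 ⊕ Fin 2 → LaurentSeries k) :=
    { toFun := Sum.elim (0 : Fin 2 → LaurentSeries k)
      map_add' := fun v v' => by ext1 i; rcases i with i | i <;> simp
      map_smul' := fun f v => by ext1 i; rcases i with i | i <;> simp }
  refine map_freeLift (G := G) (inclFree_phi O k) (fun v => (phiVecPS_matExt_elim v).symm)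
    (fun i => ?_) y
  rw [inclFree_gen, freeLift_gen]
  rfl

theorem elim_mem_natLattice {v : Fin 2 → LaurentSeries k} :
    Sum.elim (0 : Fin 2 → LaurentSeries k) v ∈ natLattice k expExt ↔ v ∈ natLattice k expSub := by
  constructor
  · exact fun h i => h (Sum.inr i)
  · rintro h (i | i)
    · exact vanishBelow_zero _
    · exact h i

theorem vanishBelow_phi_tpow {n d e : ℤ} {x : LaurentSeries k} (h : VanishBelow d x)
    (he : e ≤ n + resCard O * d) : VanishBelow e (tpow k n * phiLS O k x) := by
  rw [vanishBelow_tpow_mul]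
  exact (VanishBelow.phi O h).mono (by omega)

theorem matExt_mem (hs : s + 2 ≤ resCard O) : ∀ v ∈ natLattice k expExt,
    phiVecPS O (matExt O k s) v ∈ natLattice k expExt := by
  intro v hv
  have hq := two_le_resCard O
  have h1 : v ∘ Sum.inl ∈ natLattice k expQuot := fun i => hv (Sum.inl i)
  have h2 : v ∘ Sum.inr ∈ natLattice k expSub := fun i => hv (Sum.inr i)
  have e : phiVecPS O (matExt O k s) v =
      Sum.elim (phiVecPS O (matQuot O k) (v ∘ Sum.inl)) (phiVecPS O (matSub O k s) (v ∘ Sum.inr)) +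
      Pi.single (Sum.inr 0) (tpow k (-(resCard O : ℤ)) * phiLS O k (v (Sum.inl 0))) := by
    ext1 i
    rcases i with i | i
    · simp [phiVecPS_apply, phiVec_apply, matExt]
    · fin_cases i <;> simp [phiVecPS_apply, phiVec_apply, matExt, add_comm]
  rw [e]
  refine add_mem ?_ (single_mem_vecLattice (vanishBelow_phi_tpow (hv (Sum.inl 0)) ?_))
  · rintro (i | i)
    · exact matQuot_mem _ h1 i
    · exact matSub_mem hs _ h2 i
  · simp [expExt, expSub, expQuot]

theorem liftExt_gen_inl (i : Fin 3) :
    liftExt O k s (gen (Sum.inl i)) = Sum.elim (genQuot k i) 0 := freeLift_gen _ _ _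

theorem liftExt_rel (hs : s + 2 ≤ resCard O) : ∀ r ∈ rel O k s,
    liftExt O k s r ∈ natLattice k expExt := by
  have hsub : ∀ y ∈ relSub O k s, liftExt O k s (inclFree k y) ∈ natLattice k expExt := by
    intro y hy
    rw [← elim_liftSub, elim_mem_natLattice, ← Submodule.mem_comap, ← nabla_relSub hs]
    exact subset_nabla hy
  intro r hr
  have hq := two_le_resCard O
  simp only [rel, Set.mem_insert_iff, Set.mem_singleton_iff] at hr
  have hinl : ∀ x : FreeMod k (Fin 3 ⊕ Fin 2), projFree k x ∈ relQuot O k →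
      (liftExt O k s x) ∘ Sum.inr ∈ natLattice k expSub → liftExt O k s x ∈ natLattice k expExt := by
    intro x hx hx'
    have h1 : (liftExt O k s x) ∘ Sum.inl ∈ natLattice k expQuot := by
      rw [comp_inl_liftExt, ← Submodule.mem_comap, ← nabla_relQuot]
      exact subset_nabla hx
    rintro (i | i)
    · exact h1 i
    · exact hx' i
  have hz : ∀ (x : Fin 2 → LaurentSeries k), x = 0 → x ∈ natLattice k expSub := by
    rintro _ rfl; exact zero_mem _
  rcases hr with rfl | rfl | rfl | rfl | rfl | rfl | rfl | rfl | rfl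
  · refine hinl _ (by simp [relQuot, projFree_phi, projFree_gen_inl, projFree_gen_inr]) (hz _ ?_)
    rw [map_sub, map_sub, map_smul, map_smul, freeLift_phi, freeLift_phi, freeLift_gen, freeLift_gen,
      freeLift_gen]
    ext1 i
    have e1 : genExt k (Sum.inl 0) = Pi.single (Sum.inl 0) 1 := by
      ext1 j; rcases j with j | j <;> fin_cases j <;> simp [genExt, genQuot]
    have e2 : genExt k (Sum.inr 1) = Pi.single (Sum.inr 1) 1 := by
      ext1 j; rcases j with j | j <;> fin_cases j <;> simp [genExt, genSub]
    rw [e1, e2, phiVecPS_single_one, phiVecPS_single_one]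
    -- At f_1 the relator has the entry t^(q-1) t^(-q) - t^s t^(-(1+s)) = 0. This cancellation
    -- dictates the entry t^(-q) of `matExt`.
    fin_cases i
    · simp only [matExt, genExt, matSub, cycleMat, Function.comp_apply, Pi.sub_apply, Pi.smul_apply]
      simp [X_pow_smul_tpow]
      rw [show (resCard O - 1 + -resCard O : ℤ) = -1 by ring, sub_self]
    · simp only [matExt, genExt, matSub, cycleMat, Function.comp_apply, Pi.sub_apply, Pi.smul_apply]
      simp
  · refine hinl _ (by simp [relQuot, projFree_phi, projFree_gen_inl]) (hz _ ?_)
    rw [map_sub, freeLift_phi, freeLift_gen, freeLift_gen]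
    have e1 : genExt k (Sum.inl 1) = Pi.single (Sum.inl 1) 1 := by
      ext1 j; rcases j with j | j <;> fin_cases j <;> simp [genExt, genQuot]
    rw [e1, phiVecPS_single_one]
    ext1 i
    fin_cases i <;> simp [matExt, genExt]
  · have := hsub _ (show _ ∈ relSub O k s from Or.inl rfl)
    rwa [map_sub, map_smul, inclFree_phi, inclFree_gen, inclFree_gen] at this
  · have := hsub _ (show _ ∈ relSub O k s from Or.inr (Or.inl rfl))
    rwa [map_sub, map_smul, inclFree_phi, inclFree_gen, inclFree_gen] at this
  · refine hinl _ (by simp [relQuot, projFree_gen_inl]) (hz _ ?_)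
    rw [map_sub, map_smul, liftExt_gen_inl, liftExt_gen_inl]
    ext1 i
    simp
  · refine hinl _ (by simp [relQuot, projFree_gen_inl]) (hz _ ?_)
    rw [map_smul, liftExt_gen_inl]
    ext1 i
    simp
  · refine hinl _ (by simp [relQuot, projFree_gen_inl]) (hz _ ?_)
    rw [map_smul, liftExt_gen_inl]
    ext1 i
    simp
  · have := hsub _ (show _ ∈ relSub O k s from Or.inr (Or.inr (Or.inl rfl)))
    rwa [map_smul, inclFree_gen] at this
  · have := hsub _ (show _ ∈ relSub O k s from Or.inr (Or.inr (Or.inr rfl)))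
    rwa [map_smul, inclFree_gen] at this

/-- Each relator of Δ₂ is the projection of a relator of Δ. Exactness at Δ and the chase in
`nabla_rel` rest on this lifting. -/
theorem exists_mem_nabla_rel {z : FreeMod k (Fin 3)} (hz : z ∈ nabla O (relQuot O k)) :
    ∃ x ∈ nabla O (rel O k s), projFree k x = z := by
  have : nabla O (relQuot O k) ≤ (nabla O (rel O k s)).map (projFree k) := by
    refine Submodule.span_le.2 ?_
    rintro _ ⟨n, r, hr, rfl⟩
    have key : ∃ r' ∈ rel O k s, projFree k r' = r := by
      simp only [relQuot, Set.mem_insert_iff, Set.mem_singleton_iff] at hr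
      rcases hr with rfl | rfl | rfl | rfl | rfl
      · exact ⟨_, Or.inl rfl, by
          simp [projFree_phi, projFree_gen_inl, projFree_gen_inr]⟩
      · exact ⟨_, Or.inr (Or.inl rfl), by simp [projFree_phi, projFree_gen_inl]⟩
      · exact ⟨_, Or.inr (Or.inr (Or.inr (Or.inr (Or.inl rfl)))), by simp [projFree_gen_inl]⟩
      · exact ⟨_, Or.inr (Or.inr (Or.inr (Or.inr (Or.inr (Or.inl rfl))))), by
          simp [projFree_gen_inl]⟩
      · exact ⟨_, Or.inr (Or.inr (Or.inr (Or.inr (Or.inr (Or.inr (Or.inl rfl)))))), by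
          simp [projFree_gen_inl]⟩
    obtain ⟨r', hr', rfl⟩ := key
    refine ⟨(phiFree O)^[n] r', nabla_iterate_stable (subset_nabla hr') n, ?_⟩
    induction n with
    | zero => rfl
    | succ n ih => rw [Function.iterate_succ_apply', Function.iterate_succ_apply', projFree_phi, ih]
  exact this hz

theorem exists_inclFree_eq {x : FreeMod k (Fin 3 ⊕ Fin 2)} (h : projFree k x = 0) :
    ∃ y, inclFree k y = x :=
  ⟨fun i => x (Sum.inr i), funext fun i => by
    rcases i with i | i
    · exact (congrFun h i).symm
    · rfl⟩

theorem projFree_surjective : Function.Surjective (projFree k) := fun z => ⟨Sum.elim z 0, rfl⟩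

theorem inclFree_mem {y : FreeMod k (Fin 2)} (hy : y ∈ nabla O (relSub O k s)) :
    inclFree k y ∈ nabla O (rel O k s) := by
  rw [← Submodule.Quotient.mk_eq_zero, ← Submodule.mkQ_apply] at hy ⊢
  have := congrArg (incl O k s) hy
  rwa [map_zero] at this

/-- The relations of Δ are not cyclic, so the result is chased from the two outer terms: correct x
by a relation so that its e-coordinates vanish, and apply the statement for Δ₁ to what is left. -/
theorem nabla_rel (hs : s + 2 ≤ resCard O) :
    nabla O (rel O k s) = (natLattice k expExt).comap (liftExt O k s) := by
  have hle := nabla_le_comap_freeLift (phiVecPS O (matExt O k s)) (e := genExt k) (matExt_mem hs)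
    (liftExt_rel hs)
  refine le_antisymm hle fun x hx => ?_
  have h1 : projFree k x ∈ nabla O (relQuot O k) := by
    rw [nabla_relQuot, Submodule.mem_comap, ← comp_inl_liftExt (s := s)]
    exact fun i => hx (Sum.inl i)
  obtain ⟨x', hx', e⟩ := exists_mem_nabla_rel (s := s) h1
  obtain ⟨y, hy⟩ := exists_inclFree_eq (x := x - x') (by rw [map_sub, e, sub_self])
  have h2 : y ∈ nabla O (relSub O k s) := by
    rw [nabla_relSub hs, Submodule.mem_comap, ← elim_mem_natLattice, elim_liftSub, hy, map_sub]
    exact Submodule.sub_mem _ hx (hle hx')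
  have := Submodule.add_mem _ (inclFree_mem h2) hx'
  rwa [hy, sub_add_cancel] at this

theorem liftExt_surjective : Function.Surjective (liftExt O k s) := by
  intro u
  obtain ⟨z, hz⟩ := liftQuot_surjective (O := O) (k := k) (u ∘ Sum.inl)
  obtain ⟨x, rfl⟩ := projFree_surjective z
  obtain ⟨y, hy⟩ := liftSub_surjective (O := O) (k := k) (s := s)
    ((u - liftExt O k s x) ∘ Sum.inr)
  refine ⟨x + inclFree k y, ?_⟩
  rw [map_add, ← elim_liftSub, hy]
  ext1 i
  rcases i with i | i
  · have := congrFun ((comp_inl_liftExt (s := s) x).trans hz) i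
    simpa using this
  · simp

/-- In the models this is immediate, as the lattice of Δ meets the f-coordinates exactly in the
lattice of Δ₁. -/
theorem incl_injective (hs : s + 2 ≤ resCard O) : Function.Injective (incl O k s) := by
  rw [injective_iff_map_eq_zero]
  intro y hy
  obtain ⟨y, rfl⟩ := (nabla O (relSub O k s)).mkQ_surjective y
  have h : inclFree k y ∈ nabla O (rel O k s) := (Submodule.Quotient.mk_eq_zero _).1 hy
  refine (Submodule.Quotient.mk_eq_zero _).2 ?_
  rwa [nabla_rel hs, Submodule.mem_comap, ← elim_liftSub, elim_mem_natLattice,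
    ← Submodule.mem_comap, ← nabla_relSub hs] at h

theorem proj_surjective : Function.Surjective (proj O k s) := by
  intro z
  obtain ⟨z, rfl⟩ := (nabla O (relQuot O k)).mkQ_surjective z
  obtain ⟨x, rfl⟩ := projFree_surjective z
  exact ⟨(nabla O (rel O k s)).mkQ x, rfl⟩

theorem exact_incl_proj : Function.Exact (incl O k s) (proj O k s) := by
  intro x
  obtain ⟨x, rfl⟩ := (nabla O (rel O k s)).mkQ_surjective x
  constructor
  · intro h
    obtain ⟨x', hx', e⟩ := exists_mem_nabla_rel (s := s) ((Submodule.Quotient.mk_eq_zero _).1 h)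
    obtain ⟨y, hy⟩ := exists_inclFree_eq (x := x - x') (by rw [map_sub, e, sub_self])
    refine ⟨(nabla O (relSub O k s)).mkQ y, (Submodule.Quotient.eq _).2 ?_⟩
    rw [hy, sub_sub_cancel_left]
    exact Submodule.neg_mem _ hx'
  · rintro ⟨y, hy⟩
    obtain ⟨y, rfl⟩ := (nabla O (relSub O k s)).mkQ_surjective y
    rw [← hy]
    rfl

end Models

end PhiGamma

namespace PhiGamma

/-! ### Elements on which Γ acts through a character modulo the relations. -/

section Homogeneous
open IsLocalRing
variable {O : Type*} [CommRing O] [IsDomain O] [IsDiscreteValuationRing O]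
  [Finite (ResidueField O)] {k : Type*} [Field k] [Algebra (ResidueField O) k]
  {π : O} {hπ : Irreducible π} {ι : Type*} {w : ι → ℤ} {R : Set (FreeMod k ι)}

omit [Finite (ResidueField O)] in
variable (k) in
theorem scalar_pow_eq_one (γ : Oˣ) : scalar k γ ^ (resCard O - 1) = 1 := by
  have h : Units.map (residue O : O →* ResidueField O) γ ^ (resCard O - 1) = 1 := by
    rw [resCard, ← Nat.card_units]
    exact pow_card_eq_one'
  have e : scalar k γ = Units.map (algebraMap (ResidueField O) k : ResidueField O →* k)
      (Units.map (residue O : O →* ResidueField O) γ) := by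
    ext; rfl
  rw [e, ← map_pow, h, map_one]

omit [Finite (ResidueField O)] in
variable (k) in
theorem scalar_zpow_congr (γ : Oˣ) {W W' : ℤ} (h : ((resCard O - 1 : ℕ) : ℤ) ∣ W - W') :
    scalar k γ ^ W = scalar k γ ^ W' := by
  obtain ⟨c, hc⟩ := h
  rw [show W = W' + ((resCard O - 1 : ℕ) : ℤ) * c by omega, zpow_add, zpow_mul, zpow_natCast,
    scalar_pow_eq_one, one_zpow, mul_one]

variable (hπ w R) in
/-- Modulo the relations, the units `γ` act on `x` by multiplication with `γ ^ W`. -/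
def IsHomogeneous (W : ℤ) (x : FreeMod k ι) : Prop :=
  ∀ γ, gammaFree hπ w γ x - (C ((scalar k γ ^ W : kˣ) : k) : k⟦X⟧) • x ∈ nabla O R

theorem IsHomogeneous.congr {W W' : ℤ} {x : FreeMod k ι} (h : IsHomogeneous hπ w R W x)
    (hW : ((resCard O - 1 : ℕ) : ℤ) ∣ W - W') : IsHomogeneous hπ w R W' x := fun γ => by
  rw [← scalar_zpow_congr k γ hW]
  exact h γ

theorem IsHomogeneous.sub {W : ℤ} {x y : FreeMod k ι} (hx : IsHomogeneous hπ w R W x)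
    (hy : IsHomogeneous hπ w R W y) : IsHomogeneous hπ w R W (x - y) := fun γ => by
  rw [map_sub, smul_sub, sub_sub_sub_comm]
  exact sub_mem (hx γ) (hy γ)

theorem IsHomogeneous.gammaFree_mem {W : ℤ} {x : FreeMod k ι} (h : IsHomogeneous hπ w R W x)
    (hx : x ∈ nabla O R) (γ : Oˣ) : gammaFree hπ w γ x ∈ nabla O R := by
  have := Submodule.add_mem _ (h γ)
    (Submodule.smul_mem _ (C ((scalar k γ ^ W : kˣ) : k) : k⟦X⟧) hx)
  rwa [sub_add_cancel] at this

theorem smul_smul_sub_smul_smul (c p q r v : k⟦X⟧) (y : FreeMod k ι) :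
    (c * p + q * v) • r • y - (c * r) • p • y = (v * r) • q • y := by
  funext i
  ext1 n
  simp only [Pi.sub_apply, Pi.smul_apply, Finsupp.sub_apply, Finsupp.smul_apply, smul_eq_mul]
  ring

/-- γ(t^m) differs from γ^m t^m by a multiple of t^(m+q-1), and the hypothesis makes that multiple
vanish on φ^n e_i. -/
theorem isHomogeneous_pow_smul [DecidableEq ι] (m n : ℕ) (i : ι)
    (h : m = 0 ∨ (X ^ (m + (resCard O - 1)) : k⟦X⟧) • (phiFree O)^[n] (gen i) ∈ nabla O R) :
    IsHomogeneous hπ w R (m + w i) ((X ^ m : k⟦X⟧) • (phiFree O)^[n] (gen i)) := fun γ => by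
  obtain ⟨v, hv, hv0⟩ := gammaPS_X_pow hπ k γ m
  rw [map_smulₛₗ, RingHom.coe_coe, gammaFree_iterate_gen, hv, zpow_add, zpow_natCast, Units.val_mul,
    map_mul]
  rw [smul_smul_sub_smul_smul]
  rcases h with h | h
  · rw [hv0 h, zero_mul, zero_smul]
    exact zero_mem _
  · exact Submodule.smul_mem _ _ h

theorem pow_smul_mem_of_le {S : Submodule k⟦X⟧ (FreeMod k ι)} {a b : ℕ} {y : FreeMod k ι}
    (h : (X ^ a : k⟦X⟧) • y ∈ S) (hab : a ≤ b) : (X ^ b : k⟦X⟧) • y ∈ S := by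
  obtain ⟨c, rfl⟩ := Nat.exists_eq_add_of_le' hab
  rw [pow_add, mul_smul]
  exact Submodule.smul_mem _ _ h

theorem pow_smul_mem_of_sub {S : Submodule k⟦X⟧ (FreeMod k ι)} {a b c : ℕ} {y z : FreeMod k ι}
    (h : (X ^ a : k⟦X⟧) • y - z ∈ S) (hz : (X ^ b : k⟦X⟧) • z ∈ S) (hc : a + b ≤ c) :
    (X ^ c : k⟦X⟧) • y ∈ S := by
  refine pow_smul_mem_of_le ?_ hc
  have := Submodule.add_mem _ (Submodule.smul_mem _ (X ^ b : k⟦X⟧) h) hz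
  rwa [smul_sub, sub_add_cancel, smul_smul, ← pow_add, add_comm] at this

end Homogeneous

/-! ### The actions on Δ₁, Δ, Δ₂ and the injectivity of φ on Δ. -/

section Actions
open IsLocalRing
variable {O : Type*} [CommRing O] [IsDomain O] [IsDiscreteValuationRing O]
  [Finite (ResidueField O)] {k : Type*} [Field k] [Algebra (ResidueField O) k]
  {π : O} (hπ : Irreducible π) {s : ℕ} (a : ℤ)

/-- Scalars coming from γ have order dividing q-1, so weights matter only modulo q-1. All terms of a
relator have congruent weights, for instance (q-2-s) + (1+a) = (a-s) + (q-1), so γ acts on it by a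
scalar modulo relations. -/
theorem gammaFree_relSub (hs : s + 2 ≤ resCard O) (γ : Oˣ) : ∀ r ∈ relSub O k s,
    gammaFree hπ (weightSub s a) γ r ∈ nabla O (relSub O k s) := by
  intro r hr
  have hmem := subset_nabla (O := O) hr
  have hf0 : (X ^ 1 : k⟦X⟧) • gen 0 ∈ nabla O (relSub O k s) := subset_nabla (by simp [relSub])
  have hf1 : (X ^ 1 : k⟦X⟧) • gen 1 ∈ nabla O (relSub O k s) := subset_nabla (by simp [relSub])
  simp only [relSub, Set.mem_insert_iff, Set.mem_singleton_iff] at hr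
  have key := fun (m n : ℕ) (i : Fin 2) => isHomogeneous_pow_smul (O := O) (hπ := hπ)
    (w := weightSub s a) (R := relSub O k s) m n i
  have key0 := fun (i : Fin 2) => key 0 0 i (Or.inl rfl)
  simp only [pow_zero, one_smul, Nat.cast_zero, zero_add] at key0
  rcases hr with rfl | rfl | rfl | rfl
  · refine (IsHomogeneous.sub ((key _ 1 0 (Or.inr ?_)).congr ?_) (key0 1)).gammaFree_mem hmem γ
    · exact pow_smul_mem_of_sub hmem hf1 (by omega)
    · exact ⟨1, by simp [weightSub]; omega⟩
  · refine (IsHomogeneous.sub ((key _ 1 1 (Or.inr ?_)).congr ?_) (key0 0)).gammaFree_mem hmem γ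
    · exact pow_smul_mem_of_sub hmem hf0 (by omega)
    · exact ⟨0, by simp [weightSub]⟩
  · have := key 1 0 0 (Or.inr (pow_smul_mem_of_le hf0 (by omega)))
    rw [pow_one] at this
    exact this.gammaFree_mem hmem γ
  · have := key 1 0 1 (Or.inr (pow_smul_mem_of_le hf1 (by omega)))
    rw [pow_one] at this
    exact this.gammaFree_mem hmem γ

theorem gammaFree_relQuot (hq : 2 < resCard O) (γ : Oˣ) : ∀ r ∈ relQuot O k,
    gammaFree hπ (weightQuot a) γ r ∈ nabla O (relQuot O k) := by
  intro r hr
  have hmem := subset_nabla (O := O) hr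
  have h1 : (X ^ 1 : k⟦X⟧) • gen 1 ∈ nabla O (relQuot O k) := subset_nabla (by simp [relQuot])
  have h2 : (X ^ 1 : k⟦X⟧) • gen 2 ∈ nabla O (relQuot O k) := subset_nabla (by simp [relQuot])
  have h0 : (X ^ 1 : k⟦X⟧) • gen 0 - gen 2 ∈ nabla O (relQuot O k) :=
    subset_nabla (by simp [relQuot])
  simp only [relQuot, Set.mem_insert_iff, Set.mem_singleton_iff] at hr
  have key := fun (m n : ℕ) (i : Fin 3) => isHomogeneous_pow_smul (O := O) (hπ := hπ)
    (w := weightQuot a) (R := relQuot O k) m n i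
  have key0 := fun (n : ℕ) (i : Fin 3) => key 0 n i (Or.inl rfl)
  simp only [pow_zero, one_smul, Nat.cast_zero, zero_add] at key0
  rcases hr with rfl | rfl | rfl | rfl | rfl
  · refine (IsHomogeneous.sub ((key _ 1 0 (Or.inr ?_)).congr ?_) (key0 0 1)).gammaFree_mem hmem γ
    · exact pow_smul_mem_of_sub hmem h1 (by omega)
    · exact ⟨1, by simp [weightQuot]⟩
  · exact (IsHomogeneous.sub (key0 1 1) (key0 0 0)).gammaFree_mem hmem γ
  · have := key 1 0 0 (Or.inr (pow_smul_mem_of_sub h0 h2 (by omega)))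
    rw [pow_one] at this
    exact (IsHomogeneous.sub (this.congr ⟨0, by simp [weightQuot]; omega⟩)
      (key0 0 2)).gammaFree_mem hmem γ
  · have := key 1 0 2 (Or.inr (pow_smul_mem_of_le h2 (by omega)))
    rw [pow_one] at this
    exact this.gammaFree_mem hmem γ
  · have := key 1 0 1 (Or.inr (pow_smul_mem_of_le h1 (by omega)))
    rw [pow_one] at this
    exact this.gammaFree_mem hmem γ

theorem gammaFree_rel (hq : 2 < resCard O) (hs : s + 2 ≤ resCard O) (γ : Oˣ) : ∀ r ∈ rel O k s,
    gammaFree hπ (weight s a) γ r ∈ nabla O (rel O k s) := by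
  intro r hr
  have hmem := subset_nabla (O := O) hr
  have h1 : (X ^ 1 : k⟦X⟧) • gen (Sum.inl 1) ∈ nabla O (rel O k s) :=
    subset_nabla (by simp [rel])
  have h2 : (X ^ 1 : k⟦X⟧) • gen (Sum.inl 2) ∈ nabla O (rel O k s) :=
    subset_nabla (by simp [rel])
  have h0 : (X ^ 1 : k⟦X⟧) • gen (Sum.inl 0) - gen (Sum.inl 2) ∈ nabla O (rel O k s) :=
    subset_nabla (by simp [rel])
  have hf0 : (X ^ 1 : k⟦X⟧) • gen (Sum.inr 0) ∈ nabla O (rel O k s) :=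
    subset_nabla (by simp [rel])
  have hf1 : (X ^ 1 : k⟦X⟧) • gen (Sum.inr 1) ∈ nabla O (rel O k s) :=
    subset_nabla (by simp [rel])
  have hφ : (X ^ (1 + s) : k⟦X⟧) • phiFree O (gen (Sum.inr 1)) - gen (Sum.inr 0) ∈
    nabla O (rel O k s) := subset_nabla (by simp [rel])
  simp only [rel, Set.mem_insert_iff, Set.mem_singleton_iff] at hr
  have key := fun (m n : ℕ) (i : Fin 3 ⊕ Fin 2) => isHomogeneous_pow_smul (O := O) (hπ := hπ)
    (w := weight s a) (R := rel O k s) m n i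
  have key0 := fun (n : ℕ) (i : Fin 3 ⊕ Fin 2) => key 0 n i (Or.inl rfl)
  simp only [pow_zero, one_smul, Nat.cast_zero, zero_add] at key0
  rcases hr with rfl | rfl | rfl | rfl | rfl | rfl | rfl | rfl | rfl
  · refine (IsHomogeneous.sub (IsHomogeneous.sub ((key _ 1 (Sum.inl 0) (Or.inr ?_)).congr ?_)
      (key0 0 (Sum.inl 1))) ((key _ 1 (Sum.inr 1) (Or.inr ?_)).congr ?_)).gammaFree_mem hmem γ
    -- The assumption q > 2 is needed here. The element e_2 + t^s φ(f_2) is killed by t², because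
    -- t^(s+2) φ(f_2) = t f_1 = 0, and the available power is t^(q-1).
    · rw [sub_sub] at hmem
      refine pow_smul_mem_of_sub (b := 2) hmem ?_ (by omega)
      rw [smul_add, smul_smul, ← pow_add]
      exact add_mem (pow_smul_mem_of_le h1 (by omega)) (pow_smul_mem_of_sub hφ hf0 (by omega))
    · exact ⟨1, by simp [weight, weightQuot]⟩
    · exact pow_smul_mem_of_sub hφ hf0 (by omega)
    · exact ⟨0, by simp [weight, weightQuot, weightSub]⟩
  · exact (IsHomogeneous.sub (key0 1 (Sum.inl 1)) (key0 0 (Sum.inl 0))).gammaFree_mem hmem γ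
  · refine (IsHomogeneous.sub ((key _ 1 (Sum.inr 0) (Or.inr ?_)).congr ?_)
      (key0 0 (Sum.inr 1))).gammaFree_mem hmem γ
    · exact pow_smul_mem_of_sub hmem hf1 (by omega)
    · exact ⟨1, by simp [weight, weightSub]; omega⟩
  · refine (IsHomogeneous.sub ((key _ 1 (Sum.inr 1) (Or.inr ?_)).congr ?_)
      (key0 0 (Sum.inr 0))).gammaFree_mem hmem γ
    · exact pow_smul_mem_of_sub hmem hf0 (by omega)
    · exact ⟨0, by simp [weight, weightSub]⟩
  · have := key 1 0 (Sum.inl 0) (Or.inr (pow_smul_mem_of_sub h0 h2 (by omega)))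
    rw [pow_one] at this
    exact (IsHomogeneous.sub (this.congr ⟨0, by simp [weight, weightQuot]; omega⟩)
      (key0 0 (Sum.inl 2))).gammaFree_mem hmem γ
  · have := key 1 0 (Sum.inl 2) (Or.inr (pow_smul_mem_of_le h2 (by omega)))
    rw [pow_one] at this
    exact this.gammaFree_mem hmem γ
  · have := key 1 0 (Sum.inl 1) (Or.inr (pow_smul_mem_of_le h1 (by omega)))
    rw [pow_one] at this
    exact this.gammaFree_mem hmem γ
  · have := key 1 0 (Sum.inr 0) (Or.inr (pow_smul_mem_of_le hf0 (by omega)))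
    rw [pow_one] at this
    exact this.gammaFree_mem hmem γ
  · have := key 1 0 (Sum.inr 1) (Or.inr (pow_smul_mem_of_le hf1 (by omega)))
    rw [pow_one] at this
    exact this.gammaFree_mem hmem γ

variable {hπ} {a}

theorem isEquivariant_incl {T₁ : TorsionPhiGamma k (DeltaSub O k s) hπ}
    {T : TorsionPhiGamma k (Delta O k s) hπ} (h₁ : IsInduced (weightSub s a) (relSub O k s) T₁)
    (h : IsInduced (weight s a) (rel O k s) T) : T₁.IsEquivariant T (incl O k s) := by
  have hi : ∀ y, incl O k s ((nabla O (relSub O k s)).mkQ y) =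
      (nabla O (rel O k s)).mkQ (inclFree k y) := fun _ => rfl
  constructor
  · intro x
    obtain ⟨x, rfl⟩ := (nabla O (relSub O k s)).mkQ_surjective x
    rw [h₁.1, hi, hi, h.1, inclFree_phi]
  · intro γ x
    obtain ⟨x, rfl⟩ := (nabla O (relSub O k s)).mkQ_surjective x
    rw [h₁.2, hi, hi, h.2]
    congr 1
    ext1 i
    rcases i with i | i <;> simp [inclFree, gammaFree, weight]

theorem isEquivariant_proj {T : TorsionPhiGamma k (Delta O k s) hπ}
    {T₂ : TorsionPhiGamma k (DeltaQuot O k) hπ} (h : IsInduced (weight s a) (rel O k s) T)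
    (h₂ : IsInduced (weightQuot a) (relQuot O k) T₂) : T.IsEquivariant T₂ (proj O k s) := by
  have hi : ∀ y, proj O k s ((nabla O (rel O k s)).mkQ y) =
      (nabla O (relQuot O k)).mkQ (projFree k y) := fun _ => rfl
  constructor
  · intro x
    obtain ⟨x, rfl⟩ := (nabla O (rel O k s)).mkQ_surjective x
    rw [h.1, hi, hi, h₂.1, projFree_phi]
  · intro γ x
    obtain ⟨x, rfl⟩ := (nabla O (rel O k s)).mkQ_surjective x
    rw [h.2, hi, hi, h₂.2]
    rfl

theorem IsInduced.phi_map {ι κ : Type*} [Fintype ι] [Fintype κ] [DecidableEq κ]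
    {A : Matrix ι ι (LaurentSeries k)} {m : ι → ℤ} {R : Set (FreeMod k κ)}
    {e : κ → ι → LaurentSeries k} {w : κ → ℤ} {T : TorsionPhiGamma k (Presented O R) hπ}
    (h : IsInduced w R T) (hs : Function.Surjective (freeLift (phiVecPS O A) e))
    {θ : Uniformization (k := k) (Presented O R) m}
    (hθ : ∀ x, θ.map (freeLift (phiVecPS O A) e x) = (nabla O R).mkQ x)
    (u : ι → LaurentSeries k) : T.phi (θ.map u) = θ.map (phiVec O A u) := by
  obtain ⟨x, rfl⟩ := hs u
  rw [hθ, h.1, ← hθ, freeLift_phi, phiVecPS_apply]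

theorem phi_injective_of_uniformization {Δ : Type*} [AddCommGroup Δ] [Module k⟦X⟧ Δ]
    {ι : Type*} [Fintype ι] {A : Matrix ι ι (LaurentSeries k)} {m : ι → ℤ}
    {θ : Uniformization (k := k) Δ m} {T : TorsionPhiGamma k Δ hπ}
    (hT : ∀ u, T.phi (θ.map u) = θ.map (phiVec O A u))
    (h : ∀ u, phiVec O A u ∈ vecLattice k m → u ∈ vecLattice k m) :
    Function.Injective T.phi := by
  rw [injective_iff_map_eq_zero]
  intro x hx
  obtain ⟨u, rfl⟩ := θ.surjective x
  rw [hT, θ.map_eq_zero_iff] at hx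
  exact (θ.map_eq_zero_iff _).2 (h u hx)

omit [Algebra (ResidueField O) k] in
theorem VanishBelow.of_phi {d e : ℤ} {x : LaurentSeries k} (h : VanishBelow d (phiLS O k x))
    (he : resCard O * (e - 1) < d) : VanishBelow e x := by
  rw [← kap_phi O x]
  exact h.kap O he

omit [Algebra (ResidueField O) k] in
-- In the model, this is the injectivity of φ on Δ. The only delicate point is that the
-- e_1-coordinate is divisible by t²: the e_2-entry of φ(u) gives just t, and the off-diagonal entry
-- t^(-q) supplies the missing factor.
theorem mem_of_matExt_mem (hs : s + 2 ≤ resCard O) (u : Fin 2 ⊕ Fin 2 → LaurentSeries k)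
    (hu : phiVec O (matExt O k s) u ∈ natLattice k expExt) : u ∈ natLattice k expExt := by
  have hq := two_le_resCard O
  have h0 := hu (Sum.inl 0)
  have h1 := hu (Sum.inl 1)
  have h2 := hu (Sum.inr 0)
  have h3 := hu (Sum.inr 1)
  simp [phiVec_apply, matExt, matSub, matQuot, cycleMat, expExt, expSub, expQuot] at h0 h1 h2 h3
  have hx1 : VanishBelow 1 (u (Sum.inl 0)) :=
    ((vanishBelow_tpow_mul _).1 h1).of_phi (by simp)
  have hx : VanishBelow 2 (u (Sum.inl 0)) := by
    intro n hn
    rcases lt_or_eq_of_le (show n ≤ 1 by omega) with h | rfl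
    · exact hx1 n h
    -- The constant term of the f_1-entry is the t-coefficient of the e_1-coordinate. The other
    -- summand t^(-(1+s)) φ(·) does not contribute, since 0 < 1+s < q.
    · have := h2 0 one_pos
      rw [HahnSeries.coeff_add, coeff_tpow_mul, coeff_tpow_mul, zero_sub, zero_sub, neg_neg,
        coeff_phiLS_of_not_dvd O (n := -(-(s : ℤ) + -1)), add_zero] at this
      · rw [← coeff_phiLS_mul O, mul_one]
        exact this
      · intro h
        have := Int.le_of_dvd (by omega) h
        omega
  have hy : VanishBelow 1 (tpow k (-(s : ℤ) + -1) * phiLS O k (u (Sum.inr 1))) := by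
    have h : VanishBelow 1 (tpow k (-(resCard O : ℤ)) * phiLS O k (u (Sum.inl 0))) :=
      vanishBelow_phi_tpow hx (by omega)
    intro n hn
    have := h2 n hn
    rwa [HahnSeries.coeff_add, h n hn, zero_add] at this
  rintro (i | i) <;> fin_cases i
  · exact hx
  · exact h0.of_phi (by simp [expExt, expQuot])
  · exact ((vanishBelow_tpow_mul _).1 h3).of_phi (by simp [expExt, expSub]; omega)
  · exact ((vanishBelow_tpow_mul _).1 hy).of_phi (by simp [expExt, expSub])

end Actions

end PhiGamma

namespace PhiGamma

/-! ### Rank two modules with a cyclic matrix: ψ-stable lattices and φ-stable lines. -/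

section RankTwo
open IsLocalRing Matrix
variable {O : Type*} [CommRing O] [IsDomain O] [IsDiscreteValuationRing O]
  [Finite (ResidueField O)] {k : Type*} [Field k] [Algebra (ResidueField O) k]
  {π : O} {hπ : Irreducible π}
  {D : Type*} [AddCommGroup D] [Module (LaurentSeries k) D] [Module k⟦X⟧ D]
  [IsScalarTower k⟦X⟧ (LaurentSeries k) D]
  {ι : Type*} [Fintype ι] (e : D ≃ₗ[LaurentSeries k] (ι → LaurentSeries k))

/-- The vectors whose `i`-th coordinate lies in `t ^ (m i) k[[t]]`. -/
noncomputable def coordLattice (m : ι → ℤ) : Submodule k⟦X⟧ D :=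
  (vecLattice k m).comap (e.toLinearMap.restrictScalars k⟦X⟧)

omit [Fintype ι] in
theorem mem_coordLattice {m : ι → ℤ} {x : D} : x ∈ coordLattice e m ↔ e x ∈ vecLattice k m :=
  Iff.rfl

theorem isLattice_coordLattice (m : ι → ℤ) : IsLattice (coordLattice e m) := by
  constructor
  · have : coordLattice e m =
        (vecLattice k m).map (e.symm.toLinearMap.restrictScalars k⟦X⟧) := by
      ext x
      constructor
      · intro h
        exact ⟨e x, h, e.symm_apply_apply x⟩
      · rintro ⟨u, hu, rfl⟩
        rw [mem_coordLattice]
        change e (e.symm u) ∈ _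
        rwa [e.apply_symm_apply]
    rw [this]
    exact (vecLattice_fg m).map _
  · refine eq_top_iff.2 fun x _ => ?_
    obtain ⟨N, hN⟩ := exists_pow_smul_mem_vecLattice m (e x)
    have h : (X ^ N : k⟦X⟧) • x ∈ coordLattice e m := by
      have := (e.toLinearMap.restrictScalars k⟦X⟧).map_smul (X ^ N : k⟦X⟧) x
      exact (mem_coordLattice e).2 (this ▸ hN)
    have h2 : x = tpow k (-N) • (X ^ N : k⟦X⟧) • x := by
      rw [← algebraMap_smul (LaurentSeries k) (X ^ N : k⟦X⟧) x, algebraMap_X_pow, smul_smul,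
        tpow_neg_mul, one_smul]
    rw [h2]
    exact Submodule.smul_mem _ _ (Submodule.subset_span h)

theorem IsLattice.exists_coordLattice_le {E : Submodule k⟦X⟧ D} (hE : IsLattice E) :
    ∃ N : ℕ, coordLattice e (fun _ => (N : ℤ)) ≤ E := by
  classical
  choose N hN using fun i => hE.exists_pow_smul_mem (e.symm (Pi.single i 1))
  refine ⟨∑ i, N i, fun x hx => ?_⟩
  have hx' : x = ∑ i, e x i • e.symm (Pi.single i 1) := by
    apply e.injective
    rw [map_sum]
    simp_rw [map_smul, e.apply_symm_apply, ← Pi.single_smul, smul_eq_mul, mul_one]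
    exact (Finset.univ_sum_single (e x)).symm
  rw [hx']
  refine Submodule.sum_mem _ fun i _ => ?_
  have hle : N i ≤ ∑ j, N j := Finset.single_le_sum (fun _ _ => Nat.zero_le _) (Finset.mem_univ i)
  obtain ⟨f, hf⟩ := vanishBelow_iff.1 ((hx i).mono (d' := N i) (Int.ofNat_le.2 hle))
  change e x i = _ at hf
  rw [hf, mul_comm, ← algebraMap_X_pow, mul_smul, algebraMap_smul, algebraMap_smul]
  exact Submodule.smul_mem _ _ (hN i)

variable {e : D ≃ₗ[LaurentSeries k] (Fin 2 → LaurentSeries k)} {ψ : PsiOperator k hπ}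
  {S : EtalePhiGammaModule (phiLS O k) (gammaLS k hπ) D} {w : Fin 2 → ℕ}

local notation "τ" => (Equiv.swap (0 : Fin 2) 1)

omit [Algebra (ResidueField O) k] in
theorem psiVec_swap (w : Fin 2 → ℕ) (g : Fin 2 → LaurentSeries k) (i : Fin 2) :
    psiVec O (cycleMat τ w) g i = kap O (tpow k (-(w (τ i) : ℤ)) * g (τ i)) := by
  have := psiVec_cycleMat O τ w g (τ i)
  rwa [show τ (τ i) = i by fin_cases i <;> rfl] at this

omit [Algebra (ResidueField O) k] in
theorem VanishBelow.kap_tpow {d d' : ℤ} {n : ℕ} {x : LaurentSeries k} (h : VanishBelow d x)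
    (hd : resCard O * (d' - 1) < d - n) : VanishBelow d' (PhiGamma.kap O (tpow k (-(n : ℤ)) * x)) := by
  refine VanishBelow.kap (d := d - n) O ?_ hd
  rw [vanishBelow_tpow_mul]
  exact h.mono (by omega)

omit [Finite (ResidueField O)] in
theorem weight_add_swap (hw : w 0 + w 1 + 1 = resCard O) (i : Fin 2) :
    w i + w (τ i) + 1 = resCard O := by
  fin_cases i
  · exact hw
  · exact (congrArg (· + 1) (add_comm _ _)).trans hw

/-- Both weights are at most q-1, so t^(-w_i) k[[t]] is mapped into k[[t]] by κ, and t^(w_i) φ(y) is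
a preimage of y. On vectors with poles, ψ² lowers the bound for the pole order by at least one. -/
theorem isSharp_coordLattice (hw : w 0 + w 1 + 1 = resCard O)
    (hψ : ∀ x, e (psi ψ S x) = psiVec O (cycleMat τ w) (e x)) :
    IsSharp ψ S (coordLattice e 0) := by
  have hq := two_le_resCard O
  have hττ : ∀ i : Fin 2, τ (τ i) = i := fun i => by fin_cases i <;> rfl
  refine ⟨isLattice_coordLattice e 0, ?_, fun x => ?_⟩
  · ext y
    constructor
    · rintro ⟨x, hx, rfl⟩ i
      change VanishBelow 0 (e (psi ψ S x) i)
      rw [hψ, psiVec_swap]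
      have := weight_add_swap hw i
      exact (hx (τ i)).kap_tpow (by simp; omega)
    · intro hy
      refine ⟨e.symm fun i => tpow k (w i) * phiLS O k (e y (τ i)), ?_, e.injective ?_⟩
      · intro i
        change VanishBelow 0 (e (e.symm _) i)
        rw [e.apply_symm_apply]
        exact vanishBelow_phi_tpow (hy (τ i)) (by simp)
      · ext1 i
        rw [hψ, psiVec_swap, e.apply_symm_apply, hττ, kap_tpow_neg_mul_cancel]
  · have step : ∀ (N : ℕ) (x : D), x ∈ coordLattice e (fun _ => -((N + 1 : ℕ) : ℤ)) →
        psi ψ S (psi ψ S x) ∈ coordLattice e (fun _ => -(N : ℤ)) := by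
      intro N x hx i
      change VanishBelow _ (e (psi ψ S (psi ψ S x)) i)
      rw [hψ, psiVec_swap, hψ, psiVec_swap, hττ]
      have h1 := hx i
      have hwi := weight_add_swap hw i
      change VanishBelow (-((N + 1 : ℕ) : ℤ)) (e x i) at h1
      push_cast at h1
      have hN : (0 : ℤ) ≤ N := Int.natCast_nonneg N
      zify at hwi
      -- The weight used by the first ψ is w_i and by the second w_τ(i). If w_τ(i) = 0, then w_i =
      -- q-1 and the second application produces the gain. Otherwise w_i ≤ q-2 and the first one
      -- does.
      by_cases hi : w (τ i) = 0
      · refine (h1.kap_tpow (d' := -N - 1) ?_).kap_tpow ?_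
        · nlinarith
        · rw [hi]
          push_cast
          nlinarith
      · have : (1 : ℤ) ≤ w (τ i) := by omega
        refine (h1.kap_tpow (d' := -N) ?_).kap_tpow ?_
        · nlinarith
        · have : (0 : ℤ) ≤ w i := Int.natCast_nonneg _
          nlinarith
    have all : ∀ (N : ℕ) (x : D), x ∈ coordLattice e (fun _ => -(N : ℤ)) →
        ∃ n, (psi ψ S)^[n] x ∈ coordLattice e 0 := by
      intro N
      induction N with
      | zero => exact fun x hx => ⟨0, fun i => by simpa using hx i⟩
      | succ N ih =>
        intro x hx
        obtain ⟨n, hn⟩ := ih _ (step N x hx)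
        exact ⟨n + 2, hn⟩
    choose N hN using fun i => exists_vanishBelow (e x i)
    exact all (N 0 + N 1) x fun i => (hN i).mono (by fin_cases i <;> simp)

/-- A lattice contains t^N k[[t]]² for some N, and N can be lowered to 0. A vector divisible by t^N
has a ψ²-preimage divisible by t to the power w_i + q w_τ(i) + q²N ≥ N+1, and that preimage lies in
E. -/
theorem coordLattice_le_of_stable (hw : w 0 + w 1 + 1 = resCard O)
    (hψ : ∀ x, e (psi ψ S x) = psiVec O (cycleMat τ w) (e x)) {E : Submodule k⟦X⟧ D}
    (hE : IsLattice E) (hst : ∀ x ∈ E, psi ψ S x ∈ E) : coordLattice e 0 ≤ E := by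
  have hq := two_le_resCard O
  have hττ : ∀ i : Fin 2, τ (τ i) = i := fun i => by fin_cases i <;> rfl
  obtain ⟨N, hN⟩ := hE.exists_coordLattice_le e
  induction N with
  | zero => exact fun x hx => hN fun i => by simpa using hx i
  | succ N ih =>
    refine ih fun x hx => ?_
    let y' : D := e.symm fun i => tpow k (w i) * phiLS O k (e x (τ i))
    let y : D := e.symm fun i => tpow k (w i) * phiLS O k (e y' (τ i))
    have hy' : psi ψ S y' = x := e.injective (by
      ext1 i
      rw [hψ, psiVec_swap, e.apply_symm_apply, hττ, kap_tpow_neg_mul_cancel])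
    have hy : psi ψ S y = y' := e.injective (by
      ext1 i
      rw [hψ, psiVec_swap, e.apply_symm_apply, hττ, kap_tpow_neg_mul_cancel])
    have hmem : y ∈ E := by
      refine hN fun i => ?_
      change VanishBelow ((N + 1 : ℕ) : ℤ) (e y i)
      have h1 : VanishBelow (w (τ i) + resCard O * N : ℤ) (e y' (τ i)) := by
        change VanishBelow _ (e (e.symm _) (τ i))
        rw [e.apply_symm_apply, hττ]
        exact vanishBelow_phi_tpow (hx i) le_rfl
      change VanishBelow _ (e (e.symm _) i)
      rw [e.apply_symm_apply]
      refine vanishBelow_phi_tpow h1 ?_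
      have hwi := weight_add_swap hw i
      zify at hwi
      have h2 : (0 : ℤ) ≤ w i := Int.natCast_nonneg _
      have h3 : (0 : ℤ) ≤ w (τ i) := Int.natCast_nonneg _
      have h4 : (0 : ℤ) ≤ N := Int.natCast_nonneg _
      push_cast
      have h5 : (w (τ i) : ℤ) ≤ resCard O * w (τ i) := by nlinarith
      have h6 : (N : ℤ) ≤ resCard O * (resCard O * N) := by
        have h7 : (N : ℤ) ≤ resCard O * N := by nlinarith
        nlinarith
      rw [mul_add]
      omega
    rw [← hy', ← hy]
    exact hst _ (hst _ hmem)

omit [Module k⟦X⟧ D] [IsScalarTower k⟦X⟧ (LaurentSeries k) D] in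
/-- A line stable under `φ` constrains the exponents. -/
theorem exists_order_of_eigenvector {c l : LaurentSeries k} (hc : c ≠ 0) {x : D} (hx : x ≠ 0)
    (hφ : ∀ i, ∑ j, (cycleMat τ w : Matrix (Fin 2) (Fin 2) (LaurentSeries k)) j i *
      e (S.phi x) j = c * phiLS O k (e x i)) (hl : S.phi x = l • x) :
    (∀ i, e x i ≠ 0) ∧ (w 1 : ℤ) - w 0 = (resCard O + 1) * ((e x 1).order - (e x 0).order) := by
  -- In coordinates φ(x) = lx becomes two equations exchanging the entries of x. Comparing orders
  -- and subtracting eliminates the orders of l and c.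
  have hφ' : ∀ i, tpow k (-(w i : ℤ)) * (l * e x i) = c * phiLS O k (e x (τ i)) := fun i => by
    rw [← hφ, Finset.sum_eq_single i]
    · simp [cycleMat, hl]
    · intro j _ hj
      simp [cycleMat, hj.symm]
    · intro h; exact absurd (Finset.mem_univ _) h
  have h0 := hφ' 0
  have h1 := hφ' 1
  simp only [Equiv.swap_apply_left, Equiv.swap_apply_right] at h0 h1
  have hz : ∀ y : LaurentSeries k, c * phiLS O k y = 0 → y = 0 := fun y hy =>
    (_root_.map_eq_zero _).1 ((mul_eq_zero.1 hy).resolve_left hc)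
  have hne : ∀ i, e x i ≠ 0 := by
    have key : ¬ (e x 0 = 0 ∧ e x 1 = 0) := fun ⟨ha, hb⟩ => hx (e.injective (by
      rw [map_zero]; ext1 i; fin_cases i <;> assumption))
    intro i hi
    fin_cases i
    · refine key ⟨hi, hz _ ?_⟩
      rw [← h0, show e x 0 = 0 from hi, mul_zero, mul_zero]
    · refine key ⟨hz _ ?_, hi⟩
      rw [← h1, show e x 1 = 0 from hi, mul_zero, mul_zero]
  refine ⟨hne, ?_⟩
  have hl0 : l ≠ 0 := by
    rintro rfl
    rw [zero_mul, mul_zero] at h0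
    exact hne 1 (hz _ h0.symm)
  have ord : ∀ y y' : LaurentSeries k, y ≠ 0 → y' ≠ 0 → (y * y').order = y.order + y'.order :=
    fun y y' hy hy' => HahnSeries.order_mul hy hy'
  have hp : ∀ y : LaurentSeries k, y ≠ 0 → phiLS O k y ≠ 0 := fun y hy => (map_ne_zero _).2 hy
  have o0 := congrArg HahnSeries.order h0
  have o1 := congrArg HahnSeries.order h1
  rw [ord _ _ (tpow_ne_zero _) (mul_ne_zero hl0 (hne _)), ord _ _ hl0 (hne _), order_tpow,
    ord _ _ hc (hp _ (hne _)), order_phiLS O (hne _)] at o0 o1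
  linear_combination o0 - o1

omit [Module k⟦X⟧ D] [IsScalarTower k⟦X⟧ (LaurentSeries k) D] in
theorem exists_eigenvector [Module.Finite (LaurentSeries k) D]
    (hD : Module.finrank (LaurentSeries k) D = 2) {W : Submodule (LaurentSeries k) D}
    (hbot : W ≠ ⊥) (htop : W ≠ ⊤) :
    ∃ x ∈ W, x ≠ 0 ∧ ∀ y ∈ W, ∃ l : LaurentSeries k, y = l • x := by
  have h2 := Submodule.finrank_lt htop
  have h1 : Module.finrank (LaurentSeries k) W ≠ 0 := fun h => hbot (Submodule.finrank_eq_zero.1 h)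
  have h3 : Module.finrank (LaurentSeries k) W = 1 := by omega
  obtain ⟨v, hv, hspan⟩ := finrank_eq_one_iff'.1 h3
  refine ⟨v, v.2, fun h => hv (Subtype.ext h), fun y hy => ?_⟩
  obtain ⟨l, hl⟩ := hspan ⟨y, hy⟩
  exact ⟨l, (congrArg Subtype.val hl).symm⟩

end RankTwo

/-! ### Morphisms and ψ, and a unit of maximal order. -/

section MorphismsAndPsi
open IsLocalRing
variable {O : Type*} [CommRing O] [IsDomain O] [IsDiscreteValuationRing O]
  [Finite (ResidueField O)] {k : Type*} [Field k] [Algebra (ResidueField O) k]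
  {π : O} {hπ : Irreducible π}
  {D D' : Type*} [AddCommGroup D] [Module (LaurentSeries k) D] [AddCommGroup D']
  [Module (LaurentSeries k) D']

theorem map_psi_of_isEquivariant (ψ : PsiOperator k hπ)
    {S : EtalePhiGammaModule (phiLS O k) (gammaLS k hπ) D}
    {S' : EtalePhiGammaModule (phiLS O k) (gammaLS k hπ) D'} {f : D →ₗ[LaurentSeries k] D'}
    (hf : S.IsEquivariant S'.toPhiGammaModule f) (x : D) :
    f (psi ψ S x) = psi ψ S' (f x) := by
  induction x using EtalePhiGammaModule.induction (S := S) with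
  | h0 => simp only [map_zero]
  | h a x => rw [psi_smul_phi, map_smul, map_smul, hf.1, psi_smul_phi]
  | hadd x y hx hy => simp only [map_add, hx, hy]

theorem map_psi_iterate_of_isEquivariant (ψ : PsiOperator k hπ)
    {S : EtalePhiGammaModule (phiLS O k) (gammaLS k hπ) D}
    {S' : EtalePhiGammaModule (phiLS O k) (gammaLS k hπ) D'} {f : D →ₗ[LaurentSeries k] D'}
    (hf : S.IsEquivariant S'.toPhiGammaModule f) (n : ℕ) (x : D) :
    f ((psi ψ S)^[n] x) = (psi ψ S')^[n] (f x) := by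
  induction n with
  | zero => rfl
  | succ n ih =>
    rw [Function.iterate_succ_apply', Function.iterate_succ_apply', ← ih,
      map_psi_of_isEquivariant ψ hf]

/-- The unit γ lifts a generator of the cyclic group 𝔽_q^×. -/
theorem exists_scalar_orderOf (O : Type*) [CommRing O] [IsDomain O] [IsDiscreteValuationRing O]
    [Finite (ResidueField O)] (k : Type*) [Field k] [Algebra (ResidueField O) k] :
    ∃ γ : Oˣ, ∀ n : ℕ, scalar k γ ^ n = 1 → resCard O - 1 ∣ n := by
  obtain ⟨g, hg⟩ := IsCyclic.exists_generator (α := (ResidueField O)ˣ)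
  obtain ⟨y, hy⟩ := residue_surjective (g : ResidueField O)
  have hu : IsUnit y := by
    by_contra h
    have := (residue_eq_zero_iff y).2 ((mem_maximalIdeal y).2 h)
    rw [hy] at this
    exact g.ne_zero this
  refine ⟨hu.unit, fun n hn => ?_⟩
  have h1 : algebraMap (ResidueField O) k ((g : ResidueField O) ^ n) = 1 := by
    have := congrArg Units.val hn
    rw [map_pow, ← hy]
    exact this
  have h2 : g ^ n = 1 := Units.ext ((algebraMap (ResidueField O) k).injective (by
    rw [Units.val_pow_eq_pow_val, h1, Units.val_one, map_one]))
  have h3 := orderOf_dvd_of_pow_eq_one h2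
  rwa [orderOf_eq_card_of_forall_mem_zpowers hg, Nat.card_units] at h3

end MorphismsAndPsi

end PhiGamma

namespace PhiGamma

/-! ### Irreducibility of D₁ and D₂, and the identification of D^♯. -/

section Conclusions
open IsLocalRing Matrix
variable {O : Type*} [CommRing O] [IsDomain O] [IsDiscreteValuationRing O]
  [Finite (ResidueField O)] {k : Type*} [Field k] [Algebra (ResidueField O) k]
  {π : O} {hπ : Irreducible π}

theorem isUnit_det_cycleMat_swap (w : Fin 2 → ℕ) :
    IsUnit (cycleMat (k := k) (Equiv.swap 0 1) w).det := by
  rw [isUnit_iff_ne_zero, det_fin_two]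
  simp [cycleMat]

omit [Finite (ResidueField O)] [Algebra (ResidueField O) k] in
theorem isUnit_det_matExt (s : ℕ) : IsUnit (matExt O k s).det := by
  rw [matExt, det_fromBlocks_zero₁₂]
  exact (isUnit_det_cycleMat_swap _).mul (isUnit_det_cycleMat_swap _)

/-- In rank two a proper nonzero submodule is a line. The hypothesis `h` concerns only lines that
pass the order condition imposed by φ, and asks that some γ move them. -/
theorem isIrreducible_of_not_dvd {D : Type*} [AddCommGroup D] [Module (LaurentSeries k) D]
    {S : EtalePhiGammaModule (phiLS O k) (gammaLS k hπ) D} {w : Fin 2 → ℕ}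
    {e : D ≃ₗ[LaurentSeries k] (Fin 2 → LaurentSeries k)} {c : LaurentSeries k} (hc : c ≠ 0)
    (hφ : ∀ x i, ∑ j, cycleMat (Equiv.swap 0 1) w j i * e (S.phi x) j = c * phiLS O k (e x i))
    (h : ∀ x : D, (∀ i, e x i ≠ 0) →
      (w 1 : ℤ) - w 0 = (resCard O + 1) * ((e x 1).order - (e x 0).order) →
      ∃ γ, ∀ l : LaurentSeries k, S.gamma γ x ≠ l • x) : S.IsIrreducible := by
  have hfin : Module.finrank (LaurentSeries k) D = 2 := by
    rw [e.finrank_eq, Module.finrank_fin_fun]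
  have := S.finite
  refine ⟨Module.nontrivial_of_finrank_pos (R := LaurentSeries k) (by omega), fun W hW hΓ => ?_⟩
  by_contra! hcon
  obtain ⟨x, hx, hx0, hspan⟩ := exists_eigenvector hfin hcon.1 hcon.2
  obtain ⟨l, hl⟩ := hspan _ (hW x hx)
  obtain ⟨hne, hord⟩ := exists_order_of_eigenvector hc hx0 (hφ x) hl
  obtain ⟨γ, hγ⟩ := h x hne hord
  obtain ⟨l', hl'⟩ := hspan _ (hΓ γ x hx)
  exact hγ l' hl'

theorem one_sub_expSub : (fun i => 1 - (expSub i : ℤ)) = 0 := by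
  ext i
  fin_cases i <;> simp [expSub]

variable {s : ℕ} {a : ℤ}

omit [Algebra (ResidueField O) k] in
theorem pairing_zero_gen {θ : Uniformization (k := k) (DeltaSub O k s) fun i => (expSub i : ℤ)}
    (hθ : ∀ x, θ.map (liftSub O k s x) = (nabla O (relSub O k s)).mkQ x)
    (l : DualMod k (DeltaSub O k s)) (i : Fin 2) :
    l.toLin ((nabla O (relSub O k s)).mkQ (gen i)) = (θ.vec l i).coeff 0 := by
  rw [← hθ, freeLift_gen, θ.toLin_map', genSub, pairing_single, mul_one]

/-- Here w_1 - w_0 = q-3-2s has absolute value less than q+1, so a φ-stable line forces both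
coordinates to have the same order and q-1 = 2(1+s). Normalized to (1, v), its generator lies in
Δ₁^*, and its constant terms are values of a form on f_1 and f_2. Γ acts on these by the characters
with exponents 1+a and a-s, whose difference 1+s is not divisible by q-1. -/
theorem isIrreducible_sub {ψ : PsiOperator k hπ}
    {θ : Uniformization (k := k) (DeltaSub O k s) fun i => (expSub i : ℤ)}
    (hθ : ∀ x, θ.map (liftSub O k s x) = (nabla O (relSub O k s)).mkQ x)
    {T : TorsionPhiGamma k (DeltaSub O k s) hπ} (hT : IsInduced (weightSub s a) (relSub O k s) T)
    {S : EtalePhiGammaModule (phiLS O k) (gammaLS k hπ) (LocDual k (DeltaSub O k s))}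
    (hS : IsAttached ψ T S) {c : LaurentSeries k} (hc : c ≠ 0)
    (hφ : ∀ x i, ∑ j, matSub O k s j i * θ.coord (S.phi x) j = c * phiLS O k (θ.coord x i))
    (hs : s + 2 ≤ resCard O) : S.IsIrreducible := by
  refine isIrreducible_of_not_dvd (e := θ.coord) hc hφ fun x hne hord => ?_
  have hq := two_le_resCard O
  set d := (θ.coord x 1).order - (θ.coord x 0).order with hd
  simp only [Matrix.cons_val_zero, Matrix.cons_val_one] at hord
  push_cast [Nat.cast_sub (show s ≤ resCard O - 2 by omega),
    Nat.cast_sub (show 2 ≤ resCard O by omega)] at hord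
  have hd0 : d = 0 := by
    rcases lt_trichotomy d 0 with h | h | h
    · nlinarith
    · exact h
    · nlinarith
  rw [hd0, mul_zero] at hord
  obtain ⟨γ, hγ⟩ := exists_scalar_orderOf O k
  refine ⟨γ, fun μ hμ => ?_⟩
  set v := (θ.coord x 0)⁻¹ * θ.coord x 1 with hv
  have hv0 : v ≠ 0 := mul_ne_zero (inv_ne_zero (hne 0)) (hne 1)
  have hvo : v.order = 0 := by
    have h1 : (θ.coord x 0 * v).order = (θ.coord x 0).order + v.order :=
      HahnSeries.order_mul (hne 0) hv0
    rw [hv, mul_inv_cancel_left₀ (hne 0)] at h1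
    rw [← hv] at h1
    omega
  have hvan : VanishBelow 0 v := fun n hn => HahnSeries.coeff_eq_zero_of_lt_order (by omega)
  have hvc : v.coeff 0 ≠ 0 := by
    rw [← hvo]
    exact HahnSeries.coeff_order_eq_zero.not.2 hv0
  set y := (θ.coord x 0)⁻¹ • x with hy
  have hy0 : θ.coord y 0 = 1 := by
    rw [hy, map_smul, Pi.smul_apply, smul_eq_mul, inv_mul_cancel₀ (hne 0)]
  have hy1 : θ.coord y 1 = v := by
    rw [hy, map_smul, Pi.smul_apply, smul_eq_mul]
  have hymem : y ∈ dualLattice k (DeltaSub O k s) := by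
    rw [θ.mem_dualLattice, one_sub_expSub]
    intro i
    fin_cases i
    · change VanishBelow 0 (θ.coord y 0)
      rw [hy0]
      exact vanishBelow_tpow 0
    · change VanishBelow 0 (θ.coord y 1)
      rw [hy1]
      exact hvan
  obtain ⟨ν, hν⟩ : ∃ ν : LaurentSeries k, S.gamma γ y = ν • y := by
    refine ⟨gammaLS k hπ γ (θ.coord x 0)⁻¹ * μ * θ.coord x 0, ?_⟩
    rw [hy, map_smulₛₗ, hμ, smul_smul, smul_smul, mul_assoc _ (θ.coord x 0),
      mul_inv_cancel₀ (hne 0), mul_one]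
  obtain ⟨l, hl⟩ := hymem
  rw [← hl, hS.gamma_locMk] at hν
  set l' := transpose (T.gamma γ⁻¹) l with hl'
  have hvec : ∀ i, θ.vec l i = θ.coord y i := fun i => by rw [← hl, θ.coord_locMk]
  have hvec' : ∀ i, θ.vec l' i = ν * θ.coord y i := fun i => by
    rw [← θ.coord_locMk, hν, map_smul, hl]
    rfl
  have hνvan : VanishBelow 0 ν := by
    have h1 := θ.mem_dualLattice.1 ⟨l', rfl⟩
    rw [one_sub_expSub] at h1
    have h2 := h1 0
    rwa [θ.coord_locMk, hvec', hy0, mul_one] at h2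
  -- The constant term in position i is the value of the form on f_i, where γ acts by a known
  -- scalar.
  have hact : ∀ i, (θ.vec l' i).coeff 0 =
      ((scalar k γ⁻¹ ^ weightSub s a i : kˣ) : k) * (θ.vec l i).coeff 0 := fun i => by
    rw [← pairing_zero_gen hθ, hl', transpose_toLin, hT.2, gammaFree_gen, map_smul, toLin_C_smul,
      pairing_zero_gen hθ]
  have h0 := hact 0
  have h1 := hact 1
  rw [hvec', hvec, hy0, mul_one, HahnSeries.coeff_one, if_pos rfl, mul_one] at h0
  have hmul : (ν * v).coeff 0 = ν.coeff 0 * v.coeff 0 := by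
    obtain ⟨f, rfl⟩ := vanishBelow_zero_iff.1 hνvan
    obtain ⟨g, hg⟩ := vanishBelow_zero_iff.1 hvan
    rw [← hg, ← map_mul]
    have := fun f : k⟦X⟧ => coeff_algebraMap f 0
    rw [Nat.cast_zero] at this
    rw [this, this, this, coeff_zero_eq_constantCoeff_apply, coeff_zero_eq_constantCoeff_apply,
      coeff_zero_eq_constantCoeff_apply, map_mul]
  rw [hvec', hvec, hy1, hmul, h0] at h1
  have h2 : scalar k γ⁻¹ ^ (1 + a) = scalar k γ⁻¹ ^ (a - s) :=
    Units.ext (mul_right_cancel₀ hvc h1)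
  have h3 : scalar k γ⁻¹ = (scalar k γ)⁻¹ := by simp only [scalar, map_inv]
  rw [h3, _root_.inv_zpow, _root_.inv_zpow, _root_.inv_inj, show 1 + a = (a - s) + ((1 + s : ℕ) : ℤ) by push_cast; ring,
    _root_.zpow_add, mul_eq_left, zpow_natCast] at h2
  -- This gives q-1 ≤ 1+s, contrary to q-1 = 2(1+s) in `hord`.
  have h4 := Nat.le_of_dvd (by omega) (hγ _ h2)
  omega

/-- Here w_1 - w_0 = q-1 lies strictly between 0 and q+1, so φ alone excludes stable lines. -/
theorem isIrreducible_quot {D : Type*} [AddCommGroup D] [Module (LaurentSeries k) D]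
    {S : EtalePhiGammaModule (phiLS O k) (gammaLS k hπ) D}
    {e : D ≃ₗ[LaurentSeries k] (Fin 2 → LaurentSeries k)} {c : LaurentSeries k} (hc : c ≠ 0)
    (hφ : ∀ x i, ∑ j, matQuot O k j i * e (S.phi x) j = c * phiLS O k (e x i)) :
    S.IsIrreducible := by
  refine isIrreducible_of_not_dvd (e := e) hc hφ fun x hne hord => ?_
  exfalso
  have hq := two_le_resCard O
  simp only [Matrix.cons_val_zero, Matrix.cons_val_one] at hord
  push_cast [Nat.cast_sub (show 1 ≤ resCard O by omega)] at hord
  rcases lt_or_ge 0 ((e x 1).order - (e x 0).order) with h | h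
  · nlinarith
  · nlinarith

/-- A power of ψ brings the image of x in D₂ into Δ₁^*. After subtracting a lift to Δ^* the
remainder comes from D₁, where a further power brings it into `E₁`, hence into Δ₂^* and so into Δ^*.
The inclusion of `E₁` in Δ₂^* suffices; they need not be equal. -/
theorem isSharp_dualLattice_ext {ψ : PsiOperator k hπ} (hs : s + 2 ≤ resCard O)
    {T : TorsionPhiGamma k (Delta O k s) hπ}
    {S₁ : EtalePhiGammaModule (phiLS O k) (gammaLS k hπ) (LocDual k (DeltaQuot O k))}
    {S : EtalePhiGammaModule (phiLS O k) (gammaLS k hπ) (LocDual k (Delta O k s))}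
    {S₂ : EtalePhiGammaModule (phiLS O k) (gammaLS k hπ) (LocDual k (DeltaSub O k s))}
    (hS : IsAttached ψ T S) (hinj : Function.Injective T.phi)
    [Module.Finite k⟦X⟧ (DualMod k (Delta O k s))]
    (h₁ : S₁.IsEquivariant S.toPhiGammaModule (locDualMap (proj O k s)))
    (h₂ : S.IsEquivariant S₂.toPhiGammaModule (locDualMap (incl O k s)))
    {E₁ : Submodule k⟦X⟧ (LocDual k (DeltaQuot O k))} (hE₁ : IsSharp ψ S₁ E₁)
    (hle : E₁ ≤ dualLattice k (DeltaQuot O k))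
    (hE₂ : IsSharp ψ S₂ (dualLattice k (DeltaSub O k s))) :
    IsSharp ψ S (dualLattice k (Delta O k s)) := by
  refine ⟨isLattice_dualLattice, hS.psi_image_dualLattice hinj, fun x => ?_⟩
  have hst : ∀ x ∈ dualLattice k (Delta O k s), psi ψ S x ∈ dualLattice k (Delta O k s) := by
    rintro _ ⟨l, rfl⟩
    exact ⟨_, (hS.psi_locMk l).symm⟩
  obtain ⟨n, l₁, hl₁⟩ := hE₂.2.2 (locDualMap (incl O k s) x)
  obtain ⟨l, rfl⟩ := dualMap_surjective (k := k) (incl_injective (O := O) (k := k) hs) l₁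
  have h0 : locDualMap (incl O k s) ((psi ψ S)^[n] x - locMk k _ l) = 0 := by
    rw [map_sub, map_psi_iterate_of_isEquivariant ψ h₂, ← hl₁, locDualMap_locMk, sub_self]
  obtain ⟨z, hz⟩ := (locDualMap_exact (k := k) exact_incl_proj (incl_injective hs)
    proj_surjective _).1 h0
  obtain ⟨m, hm⟩ := hE₁.2.2 z
  obtain ⟨l', hl'⟩ := hle hm
  refine ⟨m + n, ?_⟩
  rw [Function.iterate_add_apply, ← sub_add_cancel ((psi ψ S)^[n] x) (locMk k _ l), ← hz,
    iterate_map_add, ← map_psi_iterate_of_isEquivariant ψ h₁, ← hl', locDualMap_locMk]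
  exact add_mem ⟨_, rfl⟩ (psi_iterate_mem ψ S hst ⟨l, rfl⟩ m)

end Conclusions

end PhiGamma

namespace PhiGamma

/-! ### Assembly of the exact sequences and the failure of exactness. -/

section Main
open IsLocalRing
variable {O : Type*} [CommRing O] [IsDomain O] [IsDiscreteValuationRing O]
  [Finite (ResidueField O)] {k : Type*} [Field k] [Algebra (ResidueField O) k]
  {π : O} {hπ : Irreducible π} {s : ℕ} {a : ℤ}

set_option maxHeartbeats 1000000 in
theorem exists_exact_sequence (hs : s + 2 ≤ resCard O)
    {T₁ : TorsionPhiGamma k (DeltaSub O k s) hπ} {T : TorsionPhiGamma k (Delta O k s) hπ}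
    {T₂ : TorsionPhiGamma k (DeltaQuot O k) hπ}
    (hT₁ : IsInduced (weightSub s a) (relSub O k s) T₁)
    (hT : IsInduced (weight s a) (rel O k s) T)
    (hT₂ : IsInduced (weightQuot a) (relQuot O k) T₂) (ψ : PsiOperator k hπ) :
    -- the exact sequence of étale `(φ,Γ)`-modules `0 → D₁ → D → D₂ → 0` obtained by duality
    ∃ (S₁ : EtalePhiGammaModule (phiLS O k) (gammaLS k hπ) (LocDual k (DeltaQuot O k)))
      (S : EtalePhiGammaModule (phiLS O k) (gammaLS k hπ) (LocDual k (Delta O k s)))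
      (S₂ : EtalePhiGammaModule (phiLS O k) (gammaLS k hπ) (LocDual k (DeltaSub O k s))),
      IsAttached ψ T₂ S₁ ∧ IsAttached ψ T S ∧ IsAttached ψ T₁ S₂ ∧
      S₁.IsEquivariant S.toPhiGammaModule (locDualMap (proj O k s)) ∧
      S.IsEquivariant S₂.toPhiGammaModule (locDualMap (incl O k s)) ∧
      Function.Injective (locDualMap (proj O k s)) ∧
      Function.Exact (locDualMap (proj O k s)) (locDualMap (incl O k s)) ∧
      Function.Surjective (locDualMap (incl O k s)) ∧
      Module.finrank (LaurentSeries k) (LocDual k (DeltaQuot O k)) = 2 ∧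
      Module.finrank (LaurentSeries k) (LocDual k (DeltaSub O k s)) = 2 ∧
      S₁.IsIrreducible ∧ S₂.IsIrreducible ∧
      -- the lattices `D₁^♯`, `D^♯`, `D₂^♯`
      IsSharp ψ S₁ (sharp ψ S₁) ∧ IsSharp ψ S (sharp ψ S) ∧ IsSharp ψ S₂ (sharp ψ S₂) ∧
      sharp ψ S₁ = natural ψ S₁ ∧ sharp ψ S₂ = natural ψ S₂ ∧
      -- the sequence `0 → D₁^♯ → D^♯ → D₂^♯ → 0`
      ∃ (h₁ : ∀ x ∈ sharp ψ S₁,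
          (locDualMap (proj O k s)).restrictScalars k⟦X⟧ x ∈ sharp ψ S)
        (h₂ : ∀ x ∈ sharp ψ S,
          (locDualMap (incl O k s)).restrictScalars k⟦X⟧ x ∈ sharp ψ S₂),
        Function.Injective
          (((locDualMap (proj O k s)).restrictScalars k⟦X⟧).restrict h₁) ∧
        Function.Surjective
          (((locDualMap (incl O k s)).restrictScalars k⟦X⟧).restrict h₂) ∧
        ¬ Function.Exact
          (((locDualMap (proj O k s)).restrictScalars k⟦X⟧).restrict h₁)
          (((locDualMap (incl O k s)).restrictScalars k⟦X⟧).restrict h₂) := by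
  have hincl := isEquivariant_incl hT₁ hT
  have hproj := isEquivariant_proj hT hT₂
  have hinj := incl_injective (O := O) (k := k) hs
  have hexact := exact_incl_proj (O := O) (k := k) (s := s)
  have hsurj := proj_surjective (O := O) (k := k) (s := s)
  obtain ⟨θ₁, hθ₁⟩ := exists_uniformization liftSub_surjective (nabla_relSub (k := k) hs)
  obtain ⟨θ, hθ⟩ := exists_uniformization liftExt_surjective (nabla_rel (k := k) hs)
  obtain ⟨θ₂, hθ₂⟩ := exists_uniformization (O := O) liftQuot_surjective (nabla_relQuot (k := k))
  have hφ₁ := hT₁.phi_map liftSub_surjective hθ₁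
  have hφ := hT.phi_map liftExt_surjective hθ
  have hφ₂ := hT₂.phi_map liftQuot_surjective hθ₂
  obtain ⟨S₂, hS₂, hψ₂, c₂, hc₂, hc₂'⟩ := exists_isAttached ψ hφ₁ (isUnit_det_cycleMat_swap _)
  obtain ⟨S, hS, -⟩ := exists_isAttached ψ hφ (isUnit_det_matExt s)
  obtain ⟨S₁, hS₁, hψ₁, c₁, hc₁, hc₁'⟩ := exists_isAttached ψ hφ₂ (isUnit_det_cycleMat_swap _)
  have hE₁ := hS.isEquivariant hS₁ hproj
  have hE₂ := hS₂.isEquivariant hS hincl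
  have hDinj := locDualMap_injective (k := k) hsurj
  have hDexact := locDualMap_exact (k := k) hexact hinj hsurj
  have hw₁ : (![0, resCard O - 1] : Fin 2 → ℕ) 0 + (![0, resCard O - 1] : Fin 2 → ℕ) 1 + 1 =
      resCard O := by
    simp only [Matrix.cons_val_zero, Matrix.cons_val_one]
    omega
  have hw₂ : (![1 + s, resCard O - 2 - s] : Fin 2 → ℕ) 0 +
      (![1 + s, resCard O - 2 - s] : Fin 2 → ℕ) 1 + 1 = resCard O := by
    simp only [Matrix.cons_val_zero, Matrix.cons_val_one]
    omega
  have hsh₁ := isSharp_coordLattice hw₁ hψ₁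
  have hsh₂ := isSharp_coordLattice hw₂ hψ₂
  have hdual₂ : coordLattice θ₁.coord 0 = dualLattice k (DeltaSub O k s) := by
    ext x
    rw [θ₁.mem_dualLattice, one_sub_expSub]
    rfl
  -- The lattice on the right has the exponents 1 - `expQuot` = (-1, 0). The gap in the first
  -- coordinate is what destroys exactness.
  have hle₁ : coordLattice θ₂.coord 0 ≤ dualLattice k (DeltaQuot O k) := fun x hx => by
    rw [θ₂.mem_dualLattice]
    intro i
    refine (hx i).mono ?_
    fin_cases i <;> simp [expQuot]
  have := θ.finite_dual
  have hsh : IsSharp ψ S (dualLattice k (Delta O k s)) :=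
    isSharp_dualLattice_ext hs hS (phi_injective_of_uniformization hφ (mem_of_matExt_mem hs))
      hE₁ hE₂ hsh₁ hle₁ (hdual₂ ▸ hsh₂)
  refine ⟨S₁, S, S₂, hS₁, hS, hS₂, hE₁, hE₂, hDinj, hDexact, locDualMap_surjective hinj, ?_, ?_,
    isIrreducible_quot hc₁ hc₁', isIrreducible_sub hθ₁ hT₁ hS₂ hc₂ hc₂' hs, ?_, ?_, ?_,
    natural_eq_sharp hsh₁ fun E' hE' _ hst => coordLattice_le_of_stable hw₁ hψ₁ hE' hst,
    natural_eq_sharp hsh₂ fun E' hE' _ hst => coordLattice_le_of_stable hw₂ hψ₂ hE' hst, ?_⟩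
  · rw [θ₂.coord.finrank_eq, Module.finrank_fin_fun]
  · rw [θ₁.coord.finrank_eq, Module.finrank_fin_fun]
  · rwa [hsh₁.sharp_eq]
  · rwa [hsh.sharp_eq]
  · rwa [hsh₂.sharp_eq]
  rw [hsh₁.sharp_eq, hsh.sharp_eq, hsh₂.sharp_eq, hdual₂]
  refine ⟨fun x hx => ?_, fun x hx => ?_, fun x y hxy => ?_, fun y => ?_, fun hex => ?_⟩
  · obtain ⟨l, rfl⟩ := hle₁ hx
    exact ⟨_, rfl⟩
  · obtain ⟨l, rfl⟩ := hx
    exact ⟨_, rfl⟩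
  · exact Subtype.ext (hDinj (congrArg Subtype.val hxy))
  · obtain ⟨_, l, rfl⟩ := y
    obtain ⟨l, rfl⟩ := dualMap_surjective (k := k) hinj l
    exact ⟨⟨_, l, rfl⟩, rfl⟩
  -- The form with vector (t^(-1), 0) belongs to Δ₂^* but not to D₁^♯ = k[[t]]². Its image lies in
  -- D^♯ and dies in D₂^♯. By injectivity on D₁, exactness would put the form itself into k[[t]]².
  · obtain ⟨l, hl⟩ := θ₂.exists_vec_eq (g := Pi.single 0 (tpow k (-1)))
      (single_mem_vecLattice ((vanishBelow_tpow (-1)).mono (by simp [expQuot])))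
    obtain ⟨⟨z, hz⟩, hz'⟩ := (hex ⟨locMk k _ (dualMap (proj O k s) l), _, rfl⟩).1 (Subtype.ext
      ((hDexact _).2 ⟨locMk k _ l, rfl⟩))
    have hzl : z = locMk k _ l := hDinj (congrArg Subtype.val hz')
    have h1 := hz 0 (-1) (by simp)
    rw [hzl] at h1
    change (θ₂.coord (locMk k _ l) 0).coeff (-1) = 0 at h1
    rw [θ₂.coord_locMk, hl, Pi.single_eq_same, tpow, HahnSeries.coeff_single_same] at h1
    exact one_ne_zero h1

variable (hπ) (k) (s) (a)

set_option maxHeartbeats 1000000 in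
theorem exists_extension [CharZero O] (hq : 2 < resCard O) (hs : s + 2 ≤ resCard O) :
    Nonempty (PsiOperator k hπ) ∧
    -- the exact sequence of `k[[t]][φ,Γ]`-modules `0 → Δ₁ → Δ → Δ₂ → 0`
    ∃ (T₁ : TorsionPhiGamma k (DeltaSub O k s) hπ) (T : TorsionPhiGamma k (Delta O k s) hπ)
      (T₂ : TorsionPhiGamma k (DeltaQuot O k) hπ),
      IsInduced (weightSub s a) (relSub O k s) T₁ ∧
      IsInduced (weight s a) (rel O k s) T ∧
      IsInduced (weightQuot a) (relQuot O k) T₂ ∧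
      T₁.IsEquivariant T (incl O k s) ∧ T.IsEquivariant T₂ (proj O k s) ∧
      Function.Injective (incl O k s) ∧
      Function.Exact (incl O k s) (proj O k s) ∧
      Function.Surjective (proj O k s) ∧
      ∀ ψ : PsiOperator k hπ,
      -- the exact sequence of étale `(φ,Γ)`-modules `0 → D₁ → D → D₂ → 0` obtained by duality
      ∃ (S₁ : EtalePhiGammaModule (phiLS O k) (gammaLS k hπ) (LocDual k (DeltaQuot O k)))
        (S : EtalePhiGammaModule (phiLS O k) (gammaLS k hπ) (LocDual k (Delta O k s)))
        (S₂ : EtalePhiGammaModule (phiLS O k) (gammaLS k hπ) (LocDual k (DeltaSub O k s))),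
        IsAttached ψ T₂ S₁ ∧ IsAttached ψ T S ∧ IsAttached ψ T₁ S₂ ∧
        S₁.IsEquivariant S.toPhiGammaModule (locDualMap (proj O k s)) ∧
        S.IsEquivariant S₂.toPhiGammaModule (locDualMap (incl O k s)) ∧
        Function.Injective (locDualMap (proj O k s)) ∧
        Function.Exact (locDualMap (proj O k s)) (locDualMap (incl O k s)) ∧
        Function.Surjective (locDualMap (incl O k s)) ∧
        Module.finrank (LaurentSeries k) (LocDual k (DeltaQuot O k)) = 2 ∧
        Module.finrank (LaurentSeries k) (LocDual k (DeltaSub O k s)) = 2 ∧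
        S₁.IsIrreducible ∧ S₂.IsIrreducible ∧
        -- the lattices `D₁^♯`, `D^♯`, `D₂^♯`
        IsSharp ψ S₁ (sharp ψ S₁) ∧ IsSharp ψ S (sharp ψ S) ∧ IsSharp ψ S₂ (sharp ψ S₂) ∧
        sharp ψ S₁ = natural ψ S₁ ∧ sharp ψ S₂ = natural ψ S₂ ∧
        -- the sequence `0 → D₁^♯ → D^♯ → D₂^♯ → 0`
        ∃ (h₁ : ∀ x ∈ sharp ψ S₁,
            (locDualMap (proj O k s)).restrictScalars k⟦X⟧ x ∈ sharp ψ S)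
          (h₂ : ∀ x ∈ sharp ψ S,
            (locDualMap (incl O k s)).restrictScalars k⟦X⟧ x ∈ sharp ψ S₂),
          Function.Injective
            (((locDualMap (proj O k s)).restrictScalars k⟦X⟧).restrict h₁) ∧
          Function.Surjective
            (((locDualMap (incl O k s)).restrictScalars k⟦X⟧).restrict h₂) ∧
          ¬ Function.Exact
            (((locDualMap (proj O k s)).restrictScalars k⟦X⟧).restrict h₁)
            (((locDualMap (incl O k s)).restrictScalars k⟦X⟧).restrict h₂) := by
  refine ⟨nonempty_psiOperator hπ k, ?_⟩
  obtain ⟨T₁, hT₁⟩ := exists_isInduced (hπ := hπ) (weightSub s a) (relSub O k s)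
    (gammaFree_relSub hπ a hs)
  obtain ⟨T, hT⟩ := exists_isInduced (hπ := hπ) (weight s a) (rel O k s)
    (gammaFree_rel hπ a hq hs)
  obtain ⟨T₂, hT₂⟩ := exists_isInduced (hπ := hπ) (weightQuot a) (relQuot O k)
    (gammaFree_relQuot hπ a hq)
  refine ⟨T₁, T, T₂, hT₁, hT, hT₂, isEquivariant_incl hT₁ hT,
    isEquivariant_proj hT hT₂, incl_injective hs, exact_incl_proj, proj_surjective, 
    fun ψ => exists_exact_sequence hs hT₁ hT hT₂ ψ⟩

end Main

end PhiGamma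

theorem mainTheorem6 {F : Type*} [Field F] [ValuativeRel F] [TopologicalSpace F]
    [IsNonarchimedeanLocalField F] [CharZero F] {π : 𝒪[F]} (hπ : Irreducible π)
    (k : Type*) [Field k] [Algebra 𝓀[F] k] [FiniteDimensional 𝓀[F] k]
    (s : ℕ) (a : ℤ) (hq : 2 < Nat.card 𝓀[F]) (hs : s + 2 ≤ Nat.card 𝓀[F]) :
    Nonempty (PsiOperator k hπ) ∧
    -- the exact sequence of `k[[t]][φ,Γ]`-modules `0 → Δ₁ → Δ → Δ₂ → 0`
    ∃ (T₁ : TorsionPhiGamma k (DeltaSub 𝒪[F] k s) hπ) (T : TorsionPhiGamma k (Delta 𝒪[F] k s) hπ)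
      (T₂ : TorsionPhiGamma k (DeltaQuot 𝒪[F] k) hπ),
      IsInduced (weightSub s a) (relSub 𝒪[F] k s) T₁ ∧
      IsInduced (weight s a) (rel 𝒪[F] k s) T ∧
      IsInduced (weightQuot a) (relQuot 𝒪[F] k) T₂ ∧
      T₁.IsEquivariant T (incl 𝒪[F] k s) ∧ T.IsEquivariant T₂ (proj 𝒪[F] k s) ∧
      Function.Injective (incl 𝒪[F] k s) ∧
      Function.Exact (incl 𝒪[F] k s) (proj 𝒪[F] k s) ∧
      Function.Surjective (proj 𝒪[F] k s) ∧
      ∀ ψ : PsiOperator k hπ,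
      -- the exact sequence of étale `(φ,Γ)`-modules `0 → D₁ → D → D₂ → 0` obtained by duality
      ∃ (S₁ : EtalePhiGammaModule (phiLS 𝒪[F] k) (gammaLS k hπ) (LocDual k (DeltaQuot 𝒪[F] k)))
        (S : EtalePhiGammaModule (phiLS 𝒪[F] k) (gammaLS k hπ) (LocDual k (Delta 𝒪[F] k s)))
        (S₂ : EtalePhiGammaModule (phiLS 𝒪[F] k) (gammaLS k hπ) (LocDual k (DeltaSub 𝒪[F] k s))),
        IsAttached ψ T₂ S₁ ∧ IsAttached ψ T S ∧ IsAttached ψ T₁ S₂ ∧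
        S₁.IsEquivariant S.toPhiGammaModule (locDualMap (proj 𝒪[F] k s)) ∧
        S.IsEquivariant S₂.toPhiGammaModule (locDualMap (incl 𝒪[F] k s)) ∧
        Function.Injective (locDualMap (proj 𝒪[F] k s)) ∧
        Function.Exact (locDualMap (proj 𝒪[F] k s)) (locDualMap (incl 𝒪[F] k s)) ∧
        Function.Surjective (locDualMap (incl 𝒪[F] k s)) ∧
        Module.finrank (LaurentSeries k) (LocDual k (DeltaQuot 𝒪[F] k)) = 2 ∧
        Module.finrank (LaurentSeries k) (LocDual k (DeltaSub 𝒪[F] k s)) = 2 ∧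
        S₁.IsIrreducible ∧ S₂.IsIrreducible ∧
        -- the lattices `D₁^♯`, `D^♯`, `D₂^♯`
        IsSharp ψ S₁ (sharp ψ S₁) ∧ IsSharp ψ S (sharp ψ S) ∧ IsSharp ψ S₂ (sharp ψ S₂) ∧
        sharp ψ S₁ = natural ψ S₁ ∧ sharp ψ S₂ = natural ψ S₂ ∧
        -- the sequence `0 → D₁^♯ → D^♯ → D₂^♯ → 0`
        ∃ (h₁ : ∀ x ∈ sharp ψ S₁,
            (locDualMap (proj 𝒪[F] k s)).restrictScalars k⟦X⟧ x ∈ sharp ψ S)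
          (h₂ : ∀ x ∈ sharp ψ S,
            (locDualMap (incl 𝒪[F] k s)).restrictScalars k⟦X⟧ x ∈ sharp ψ S₂),
          Function.Injective
            (((locDualMap (proj 𝒪[F] k s)).restrictScalars k⟦X⟧).restrict h₁) ∧
          Function.Surjective
            (((locDualMap (incl 𝒪[F] k s)).restrictScalars k⟦X⟧).restrict h₂) ∧
          ¬ Function.Exact
            (((locDualMap (proj 𝒪[F] k s)).restrictScalars k⟦X⟧).restrict h₁)
            (((locDualMap (incl 𝒪[F] k s)).restrictScalars k⟦X⟧).restrict h₂) :=
  exists_extension k hπ s a hq hs
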